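/- Let $M\cong\mathbb Z^n$ be the character lattice of the torus $T=\operatorname{Spec}\mathbb C[M]$ and $N=M^\vee$. Let $\sigma\subset N_{\mathbb R}$ be a rational polyhedral cone whose dual $\sigma^\vee\subset M_{\mathbb R}$ is strongly convex, let $m'_1,\dots,m'_s\in M$, and put $$\tilde P=\operatorname{conv}\{0,m'_1,\dots,m'_s\}+\sigma^\vee\subset M_{\mathbb R}.$$ Let $X=X(\tilde P)$ be the toric variety over $\mathbb C$ of the normal fan of $\tilde P$, with affine charts $U_\tau=\operatorname{Spec}\mathbb C[\tau^\vee\cap M]$, and let $L$ be the pullback of $\mathcal O_{\mathbb P^s}(1)$ under $[1:\chi^{m'_1}:\dots:\chi^{m'_s}]\colon X\to\mathbb P^s$. Let $G\subset T$ be a subtorus with character lattice $M_G$, let $\alpha\colon M\to M_G$ be the corresponding surjection, and let $G$ act on $X$ through $T$. A fractional $G$-linearization of $L$ is a $G$-linearization of some power $L^{\otimes k}$, $k\ge 1$, where a linearization is identified with its tensor powers. (1) The set of fractional $G$-linearizations of $L$ is naturally identified with $M_G\otimes\mathbb Q$. Explicitly, for every $G$-linearization $\rho$ of $L^{\otimes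 k}$ there is $c\in M_G$ such that $G$ acts on each local section $\chi^m$ of $L^{\otimes kj}$ ($j\ge 0$) by the character $\alpha(m)+jc$, and the class of $\rho$ corresponds to $b=\frac1k\otimes c$. (2) Let $b\in M_G\otimes\mathbb Q$ be a fractional $G$-linearization of $L$, and let $$\tilde P_b=\tilde P\cap(\alpha\otimes\mathbb R)^{-1}(-b).$$ There are $x_0\in M\otimes\mathbb Q$ with $(\alpha\otimes\mathbb Q)(x_0)=-b$, and for each such $x_0$, translation by $x_0$ identifies a fractional lattice polyhedron $Q$ in $\operatorname{Ker}(\alpha)\otimes\mathbb R$ (some positive integer multiple of $Q$ is a, possibly empty, lattice polyhedron on $\operatorname{Ker}\alpha$) with $\tilde P_b$. For every linearization $\rho$ of a power $L^{\otimes k}$ that represents $b$, the GIT quotient $$X^{ss}(L,b)/\!\!/G=\operatorname{Proj}\bigoplus_{j\ge 0}H^0(X,L^{\otimes kj})^{G}$$ (invariants with respect to $\rho$) is the toric variety of the polyhedron $Q$ on the lattice $\operatorname{Ker}\alpha$, that is, the $\mathbb C$-scheme glued from the charts $\operatorname{Spec}\mathbb C[\tau^\vee\cap\operatorname{Ker}\alpha]$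 for $\tau$ in the normal fan of $Q$. The identification is given by monomials: if $x\in Q$ has normal cone $\tau$ and $f=\chi^m$ is an invariant section of $L^{\otimes kj}$ with $j>0$ and $m=kj(x+x_0)$, then the chart of $\tau$ is $D_+(f)$, with $\chi^p/f^i$ corresponding to $\chi^{p-im}$. -/

import Mathlib

open CategoryTheory AlgebraicGeometry
open scoped TensorProduct Pointwise

noncomputable section

namespace ToricGIT

/-! ### Lattices, cones, polyhedra -/

/-- `M_ℝ = M ⊗ ℝ`. -/
abbrev MR (M : Type) [AddCommGroup M] : Type := ℝ ⊗[ℤ] M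

/-- `N_ℝ`, the real dual of `M_ℝ`. -/
abbrev NR (M : Type) [AddCommGroup M] : Type := Module.Dual ℝ (MR M)

/-- The point of `M_ℝ` given by a lattice point `m`. -/
def pt {M : Type} [AddCommGroup M] (m : M) : MR M := (1 : ℝ) ⊗ₜ[ℤ] m

/-- The point of `M_ℝ` given by a point of `M ⊗ ℚ`. -/
def ratToReal (M : Type) [AddCommGroup M] : ℚ ⊗[ℤ] M →ₗ[ℤ] MR M :=
  (Algebra.linearMap ℚ ℝ |>.restrictScalars ℤ).rTensor M

/-- The point of `N_ℝ` given by `u ∈ N = Hom(M, ℤ)`. -/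
def dualPt {M : Type} [AddCommGroup M] (u : Module.Dual ℤ M) : NR M :=
  Module.Dual.baseChange ℝ u

/-- `σ ⊆ N_ℝ` is a rational polyhedral cone: it is spanned by finitely many points of `N`. -/
def IsRationalCone {M : Type} [AddCommGroup M] (σ : PointedCone ℝ (NR M)) : Prop :=
  ∃ S : Set (Module.Dual ℤ M), S.Finite ∧ σ = PointedCone.hull ℝ (dualPt '' S)

/-- `σ^∨ ⊆ M_ℝ`. -/
def dualCone {M : Type} [AddCommGroup M] (σ : PointedCone ℝ (NR M)) : PointedCone ℝ (MR M) :=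
  PointedCone.dual LinearMap.id (σ : Set (NR M))

/-- A lattice polyhedron: the Minkowski sum of a lattice polytope and a strongly convex rational
polyhedral cone. (The empty set counts as the polytope spanned by no points.) -/
def IsLatticePolyhedron {M : Type} [AddCommGroup M] (Q : Set (MR M)) : Prop :=
  ∃ (V S : Set M), V.Finite ∧ S.Finite ∧
    (PointedCone.hull ℝ (pt '' S) : ConvexCone ℝ (MR M)).Salient ∧
    Q = convexHull ℝ (pt '' V) + (PointedCone.hull ℝ (pt '' S) : Set (MR M))

/-- A fractional lattice polyhedron: a positive integer multiple of it is a lattice polyhedron. -/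
def IsFractionalLatticePolyhedron {M : Type} [AddCommGroup M] (Q : Set (MR M)) : Prop :=
  ∃ d : ℕ, 0 < d ∧ IsLatticePolyhedron ((d : ℝ) • Q)

/-- The polyhedron `P̃ = conv {0, m'₁, …, m'ₛ} + σ^∨`. -/
def polyhedron {M : Type} [AddCommGroup M] (σ : PointedCone ℝ (NR M)) {s : ℕ}
    (m' : Fin s → M) : Set (MR M) :=
  convexHull ℝ (insert 0 (Set.range fun i => pt (m' i))) + (dualCone σ : Set (MR M))

/-- The cone of those `u ∈ N_ℝ` whose minimum on `Q` is attained at `x ∈ Q`. If `x` lies in the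
relative interior of the face `F` of a polyhedron `Q`, it is the normal cone `σ_F` of `Q` at
`F`. -/
def normalCone {M : Type} [AddCommGroup M] (Q : Set (MR M)) (x : MR M) : PointedCone ℝ (NR M) where
  carrier := {u | ∀ y ∈ Q, u x ≤ u y}
  zero_mem' := by simp
  add_mem' {u v} hu hv y hy := by
    simpa using add_le_add (hu y hy) (hv y hy)
  smul_mem' c u hu y hy := by
    change (c : ℝ) * u x ≤ (c : ℝ) * u y
    exact mul_le_mul_of_nonneg_left (hu y hy) c.2

/-- The normal fan `Σ_Q` of a polyhedron `Q`, as the set of its cones. (A generalized fan if `Q`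
is not full dimensional.) -/
def normalFan {M : Type} [AddCommGroup M] (Q : Set (MR M)) : Set (PointedCone ℝ (NR M)) :=
  {τ | ∃ x ∈ Q, τ = normalCone Q x}

/-! ### Toric varieties -/

/-- The semigroup `τ^∨ ∩ M`. -/
def chartMonoid {M : Type} [AddCommGroup M] (τ : PointedCone ℝ (NR M)) : AddSubmonoid M where
  carrier := {m | pt m ∈ dualCone τ}
  zero_mem' := by simp [pt]
  add_mem' {a b} ha hb := by
    have : pt (a + b) = pt a + pt b := TensorProduct.tmul_add _ _ _
    simpa [this] using add_mem ha hb

theorem chartMonoid_anti {M : Type} [AddCommGroup M] {τ τ' : PointedCone ℝ (NR M)} (h : τ ≤ τ') :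
    chartMonoid τ' ≤ chartMonoid τ :=
  fun _ hm _ hu => hm (h hu)

/-- The affine toric variety `U_τ = Spec ℂ[τ^∨ ∩ M]` over `ℂ`. -/
def affineToric {M : Type} [AddCommGroup M] (τ : PointedCone ℝ (NR M)) :
    Over (Spec (.of ℂ)) :=
  Over.mk (Spec.map (CommRingCat.ofHom (algebraMap ℂ (AddMonoidAlgebra ℂ (chartMonoid τ)))))

/-- The morphism `U_τ ⟶ U_τ'` for `τ ⊆ τ'`, given by `τ'^∨ ∩ M ⊆ τ^∨ ∩ M`. -/
def affineToricMap {M : Type} [AddCommGroup M] {τ τ' : PointedCone ℝ (NR M)} (h : τ ≤ τ') :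
    affineToric τ ⟶ affineToric τ' :=
  Over.homMk (Spec.map (CommRingCat.ofHom
      (AddMonoidAlgebra.mapDomainRingHom ℂ (AddSubmonoid.inclusion (chartMonoid_anti h))))) (by
    simp only [affineToric, Over.mk_left, Over.mk_hom, ← Spec.map_comp, ← CommRingCat.ofHom_comp]
    congr 2
    ext z
    simp)

/-- The diagram `τ ↦ U_τ` of a fan, along the inclusions of its cones. -/
def toricCharts {M : Type} [AddCommGroup M] (F : Set (PointedCone ℝ (NR M))) :
    F ⥤ Over (Spec (.of ℂ)) where
  obj τ := affineToric τ.1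
  map h := affineToricMap (leOfHom h)
  map_id τ := by
    apply Over.OverMorphism.ext
    change Spec.map _ = 𝟙 (Spec _)
    rw [← Spec.map_id]
    congr 1
    ext : 1
    exact AddMonoidAlgebra.mapDomainRingHom_id
  map_comp f g := by
    apply Over.OverMorphism.ext
    change Spec.map _ = Spec.map _ ≫ Spec.map _
    rw [← Spec.map_comp, ← CommRingCat.ofHom_comp, ← AddMonoidAlgebra.mapDomainRingHom_comp]
    rfl

/-- A gluing datum exhibiting `Y` as the toric variety `X(Q)` of the normal fan of the polyhedron
`Q`: open immersions of the charts `U_τ` (`τ ∈ Σ_Q`), compatible with the inclusions of cones,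
such that `Y` is the `ℂ`-scheme glued from these charts (their colimit). -/
structure ToricStructure {M : Type} [AddCommGroup M] (Q : Set (MR M))
    (Y : Over (Spec (.of ℂ))) where
  /-- The charts. -/
  charts : toricCharts (normalFan Q) ⟶ (Functor.const _).obj Y
  isOpenImmersion (τ : normalFan Q) : IsOpenImmersion (charts.app τ).left
  isColimit : Nonempty (Limits.IsColimit (Limits.Cocone.mk Y charts))

/-! ### The line bundle and its linearizations -/

/-- The monomial `χ^m`. -/
abbrev chi {M : Type} [AddCommGroup M] (m : M) : AddMonoidAlgebra ℂ M :=
  AddMonoidAlgebra.single m 1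

/-- `O(U_τ) = ℂ[τ^∨ ∩ M]` inside `ℂ[M]`. -/
def functions {M : Type} [AddCommGroup M] (τ : PointedCone ℝ (NR M)) :
    Submodule ℂ (AddMonoidAlgebra ℂ M) :=
  Submodule.span ℂ (chi '' (chartMonoid τ : Set M))

theorem functions_anti {M : Type} [AddCommGroup M] {τ τ' : PointedCone ℝ (NR M)} (h : τ ≤ τ') :
    functions τ' ≤ functions τ :=
  Submodule.span_mono (Set.image_mono (chartMonoid_anti h))

theorem one_mem_functions {M : Type} [AddCommGroup M] (τ : PointedCone ℝ (NR M)) :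
    (1 : AddMonoidAlgebra ℂ M) ∈ functions τ :=
  Submodule.subset_span ⟨0, zero_mem _, rfl⟩

theorem functions_mul_le {M : Type} [AddCommGroup M] (τ : PointedCone ℝ (NR M)) :
    functions τ * functions τ ≤ functions τ := by
  rw [functions, Submodule.span_mul_span]
  refine Submodule.span_mono ?_
  rintro _ ⟨_, ⟨a, ha, rfl⟩, _, ⟨b, hb, rfl⟩, rfl⟩
  exact ⟨a + b, add_mem ha hb, by simp [chi, AddMonoidAlgebra.single_mul_single]⟩

/-- The span of the pullbacks `χ^{m'₀} = 1, χ^{m'₁}, …, χ^{m'ₛ}` of the homogeneous coordinates of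
`ℙˢ` (divided by the zeroth coordinate). -/
def coordinates {M : Type} [AddCommGroup M] {s : ℕ} (m' : Fin s → M) :
    Submodule ℂ (AddMonoidAlgebra ℂ M) :=
  Submodule.span ℂ (insert 1 (Set.range fun i => chi (m' i)))

/-- The sections over `U_τ` of `L^{⊗n}`, where `L` is the pullback of `O(1)` under
`[1 : χ^{m'₁} : ⋯ : χ^{m'ₛ}]`: the functions times the degree `n` forms in the coordinates. -/
def sections {M : Type} [AddCommGroup M] {s : ℕ} (m' : Fin s → M) (τ : PointedCone ℝ (NR M))
    (n : ℕ) : Submodule ℂ (AddMonoidAlgebra ℂ M) :=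
  functions τ * coordinates m' ^ n

theorem sections_anti {M : Type} [AddCommGroup M] {s : ℕ} (m' : Fin s → M)
    {τ τ' : PointedCone ℝ (NR M)} (h : τ ≤ τ') (n : ℕ) : sections m' τ' n ≤ sections m' τ n :=
  mul_le_mul' (functions_anti h) le_rfl

theorem mul_mem_sections {M : Type} [AddCommGroup M] {s : ℕ} (m' : Fin s → M)
    (τ : PointedCone ℝ (NR M)) {a b : ℕ} {f g : AddMonoidAlgebra ℂ M}
    (hf : f ∈ sections m' τ a) (hg : g ∈ sections m' τ b) : f * g ∈ sections m' τ (a + b) := by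
  have h := Submodule.mul_mem_mul hf hg
  rw [sections, sections, mul_mul_mul_comm, ← pow_add] at h
  exact mul_le_mul' (functions_mul_le τ) le_rfl h

/-- The graded ring `⨁ⱼ Γ(U_τ, L^{⊗kj}) Tʲ ⊆ ℂ[M][T]`, that is, the coordinate ring over `U_τ`
of the total space `Spec Sym L^{⊗k}` (the dual of the line bundle `L^{⊗k}`). -/
def totalRing {M : Type} [AddCommGroup M] {s : ℕ} (m' : Fin s → M) (k : ℕ)
    (τ : PointedCone ℝ (NR M)) : Subalgebra ℂ (Polynomial (AddMonoidAlgebra ℂ M)) where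
  carrier := {f | ∀ j, f.coeff j ∈ sections m' τ (k * j)}
  mul_mem' {f g} hf hg j := by
    rw [Polynomial.coeff_mul]
    refine Submodule.sum_mem _ fun p hp => ?_
    rw [← Finset.HasAntidiagonal.mem_antidiagonal.1 hp, mul_add]
    exact mul_mem_sections m' τ (hf _) (hg _)
  add_mem' {f g} hf hg j := by
    rw [Polynomial.coeff_add]
    exact add_mem (hf j) (hg j)
  algebraMap_mem' c j := by
    rw [Polynomial.algebraMap_apply, Polynomial.coeff_C]
    split_ifs with h
    · subst h
      rw [Algebra.algebraMap_eq_smul_one]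
      refine Submodule.smul_mem _ _ ?_
      simpa [sections] using one_mem_functions τ
    · exact zero_mem _

theorem totalRing_anti {M : Type} [AddCommGroup M] {s : ℕ} (m' : Fin s → M) (k : ℕ)
    {τ τ' : PointedCone ℝ (NR M)} (h : τ ≤ τ') : totalRing m' k τ' ≤ totalRing m' k τ :=
  fun _ hf j => sections_anti m' h _ (hf j)

/-- The component of degree `j`. -/
def component {M : Type} [AddCommGroup M] {s : ℕ} (m' : Fin s → M) (k : ℕ)
    (τ : PointedCone ℝ (NR M)) (j : ℕ) : totalRing m' k τ →ₗ[ℂ] totalRing m' k τ where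
  toFun f := ⟨Polynomial.monomial j ((f : Polynomial (AddMonoidAlgebra ℂ M)).coeff j), fun i => by
    rw [Polynomial.coeff_monomial]
    split_ifs with h
    · subst h; exact f.2 _
    · exact zero_mem _⟩
  map_add' f g := by ext1; simp
  map_smul' c f := by
    ext1
    change Polynomial.monomial j ((c • f.1).coeff j) = c • Polynomial.monomial j (f.1.coeff j)
    rw [Polynomial.coeff_smul, Polynomial.smul_monomial]

/-- The inclusion `⨁ⱼ Γ(U_τ, L^{⊗kpj}) ⊆ ⨁ⱼ Γ(U_τ, L^{⊗kj})`, `T ↦ T^p`. -/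
def veronese {M : Type} [AddCommGroup M] {s : ℕ} (m' : Fin s → M) (k p : ℕ+)
    (τ : PointedCone ℝ (NR M)) : totalRing m' (k * p : ℕ+) τ →ₐ[ℂ] totalRing m' k τ :=
  (((Polynomial.expand (AddMonoidAlgebra ℂ M) p).restrictScalars ℂ).comp
    (totalRing m' (k * p : ℕ+) τ).val).codRestrict _ (fun f j => by
      change ((Polynomial.expand (AddMonoidAlgebra ℂ M) p) f.1).coeff j ∈ _
      rw [Polynomial.coeff_expand p.pos]
      split_ifs with h
      · have e : ((k * p : ℕ+) : ℕ) * (j / p) = k * j := by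
          rw [PNat.mul_coe, mul_assoc, Nat.mul_div_cancel' h]
        exact e ▸ f.2 (j / p)
      · exact zero_mem _)

/-- A `G`-linearization of `L^{⊗k}`, where `G = Spec ℂ[M_G]` acts through `α : M → M_G` on the
variety `X` covered by the `G`-stable affine charts `U_τ`, `τ ∈ F`: a lift of the action of `G` on
`X` to an action on the total space which is linear on the fibres. In terms of functions:
compatible coactions of `ℂ[M_G]` on the coordinate rings of the total space over the `U_τ`, which
extend the coaction `χ^m ↦ χ^m ⊗ χ^{α(m)}` on the functions on `U_τ` and are homogeneous. -/
structure Linearization {M MG : Type} [AddCommGroup M] [AddCommGroup MG] (α : M →ₗ[ℤ] MG)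
    (F : Set (PointedCone ℝ (NR M))) {s : ℕ} (m' : Fin s → M) (k : ℕ) where
  /-- The coaction over `U_τ`. -/
  coact (τ : F) : totalRing m' k τ.1 →ₐ[ℂ] totalRing m' k τ.1 ⊗[ℂ] AddMonoidAlgebra ℂ MG
  coassoc (τ : F) (f : totalRing m' k τ.1) :
    TensorProduct.assoc ℂ _ _ _ ((coact τ).toLinearMap.rTensor _ (coact τ f)) =
      (Coalgebra.comul (R := ℂ) (A := AddMonoidAlgebra ℂ MG)).lTensor _ (coact τ f)
  counit (τ : F) (f : totalRing m' k τ.1) :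
    TensorProduct.rid ℂ _
      ((Coalgebra.counit (R := ℂ) (A := AddMonoidAlgebra ℂ MG)).lTensor _ (coact τ f)) = f
  coact_function (τ : F) (m : M) (f : totalRing m' k τ.1)
    (hf : (f : Polynomial (AddMonoidAlgebra ℂ M)) = Polynomial.C (chi m)) :
    coact τ f = f ⊗ₜ chi (α m)
  coact_component (τ : F) (j : ℕ) (f : totalRing m' k τ.1) :
    coact τ (component m' k τ.1 j f) = (component m' k τ.1 j).rTensor _ (coact τ f)
  coact_restrict (τ τ' : F) (h : τ.1 ≤ τ'.1) (f : totalRing m' k τ'.1) :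
    coact τ (Subalgebra.inclusion (totalRing_anti m' k h) f) =
      (Subalgebra.inclusion (totalRing_anti m' k h)).toLinearMap.rTensor _ (coact τ' f)

/-- The linearization `ρ'` of `L^{⊗kp}` is the `p`-th tensor power of the linearization `ρ` of
`L^{⊗k}`. -/
def IsTensorPower {M MG : Type} [AddCommGroup M] [AddCommGroup MG] {α : M →ₗ[ℤ] MG}
    {F : Set (PointedCone ℝ (NR M))} {s : ℕ} {m' : Fin s → M} {k p : ℕ+}
    (ρ : Linearization α F m' k) (ρ' : Linearization α F m' (k * p : ℕ+)) : Prop :=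
  ∀ (τ : F) (f : totalRing m' (k * p : ℕ+) τ.1),
    ρ.coact τ (veronese m' k p τ.1 f) =
      (veronese m' k p τ.1).toLinearMap.rTensor _ (ρ'.coact τ f)

/-- Elementary identifications of fractional linearizations. -/
inductive FracRel {M MG : Type} [AddCommGroup M] [AddCommGroup MG] (α : M →ₗ[ℤ] MG)
    (F : Set (PointedCone ℝ (NR M))) {s : ℕ} (m' : Fin s → M) :
    (Σ k : ℕ+, Linearization α F m' k) → (Σ k : ℕ+, Linearization α F m' k) → Prop
  | power (k p : ℕ+) (ρ : Linearization α F m' k) (ρ' : Linearization α F m' (k * p : ℕ+))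
      (h : IsTensorPower ρ ρ') : FracRel α F m' ⟨k, ρ⟩ ⟨k * p, ρ'⟩

/-- The fractional linearizations of `L`: linearizations of the powers `L^{⊗k}`, `k ≥ 1`, where
each linearization is identified with its tensor powers. -/
def FractionalLinearization {M MG : Type} [AddCommGroup M] [AddCommGroup MG] (α : M →ₗ[ℤ] MG)
    (F : Set (PointedCone ℝ (NR M))) {s : ℕ} (m' : Fin s → M) : Type :=
  Quot (FracRel α F m')

/-- The fractional linearization given by a linearization of `L^{⊗k}`. -/
def Linearization.toFractional {M MG : Type} [AddCommGroup M] [AddCommGroup MG] {α : M →ₗ[ℤ] MG}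
    {F : Set (PointedCone ℝ (NR M))} {s : ℕ} {m' : Fin s → M} {k : ℕ+}
    (ρ : Linearization α F m' k) : FractionalLinearization α F m' :=
  Quot.mk _ ⟨k, ρ⟩

/-- `G` acts on each local section `χ^m` of `L^{⊗kj}` by the character `α(m) + jc`. -/
def Linearization.HasWeight {M MG : Type} [AddCommGroup M] [AddCommGroup MG] {α : M →ₗ[ℤ] MG}
    {F : Set (PointedCone ℝ (NR M))} {s : ℕ} {m' : Fin s → M} {k : ℕ}
    (ρ : Linearization α F m' k) (c : MG) : Prop :=
  ∀ (τ : F) (m : M) (j : ℕ) (f : totalRing m' k τ.1),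
    (f : Polynomial (AddMonoidAlgebra ℂ M)) = Polynomial.monomial j (chi m) →
      ρ.coact τ f = f ⊗ₜ chi (α m + j • c)

/-! ### The GIT quotient -/

/-- The ring of invariants `⨁ⱼ Γ(X, L^{⊗kj})^G`. A global section is a section over every chart,
and it is invariant if every coaction fixes it. -/
def Linearization.invariants {M MG : Type} [AddCommGroup M] [AddCommGroup MG] {α : M →ₗ[ℤ] MG}
    {F : Set (PointedCone ℝ (NR M))} {s : ℕ} {m' : Fin s → M} {k : ℕ}
    (ρ : Linearization α F m' k) : Subalgebra ℂ (Polynomial (AddMonoidAlgebra ℂ M)) where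
  carrier := {f | ∀ τ : F, ∃ h : f ∈ totalRing m' k τ.1, ρ.coact τ ⟨f, h⟩ = ⟨f, h⟩ ⊗ₜ 1}
  mul_mem' {f g} hf hg τ := by
    obtain ⟨h₁, e₁⟩ := hf τ
    obtain ⟨h₂, e₂⟩ := hg τ
    refine ⟨mul_mem h₁ h₂, ?_⟩
    have := map_mul (ρ.coact τ) ⟨f, h₁⟩ ⟨g, h₂⟩
    rw [e₁, e₂, Algebra.TensorProduct.tmul_mul_tmul, one_mul] at this
    exact this
  add_mem' {f g} hf hg τ := by
    obtain ⟨h₁, e₁⟩ := hf τ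
    obtain ⟨h₂, e₂⟩ := hg τ
    refine ⟨add_mem h₁ h₂, ?_⟩
    have := map_add (ρ.coact τ) ⟨f, h₁⟩ ⟨g, h₂⟩
    rw [e₁, e₂, ← TensorProduct.add_tmul] at this
    exact this
  algebraMap_mem' c τ := by
    refine ⟨algebraMap_mem _ c, ?_⟩
    exact (ρ.coact τ).commutes c

theorem Linearization.monomial_mem_invariants {M MG : Type} [AddCommGroup M] [AddCommGroup MG]
    {α : M →ₗ[ℤ] MG} {F : Set (PointedCone ℝ (NR M))} {s : ℕ} {m' : Fin s → M} {k : ℕ}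
    (ρ : Linearization α F m' k)
    {f : Polynomial (AddMonoidAlgebra ℂ M)} (hf : f ∈ ρ.invariants) (j : ℕ) :
    Polynomial.monomial j (f.coeff j) ∈ ρ.invariants := by
  intro τ
  obtain ⟨h, e⟩ := hf τ
  refine ⟨(component m' k τ.1 j ⟨f, h⟩).2, ?_⟩
  have := ρ.coact_component τ j ⟨f, h⟩
  rw [e, LinearMap.rTensor_tmul] at this
  exact this

/-- The ring of invariants as a type. -/
def Linearization.InvariantRing {M MG : Type} [AddCommGroup M] [AddCommGroup MG]
    {α : M →ₗ[ℤ] MG} {F : Set (PointedCone ℝ (NR M))} {s : ℕ} {m' : Fin s → M} {k : ℕ}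
    (ρ : Linearization α F m' k) : Type :=
  ρ.invariants

instance {M MG : Type} [AddCommGroup M] [AddCommGroup MG]
    {α : M →ₗ[ℤ] MG} {F : Set (PointedCone ℝ (NR M))} {s : ℕ} {m' : Fin s → M} {k : ℕ}
    (ρ : Linearization α F m' k) : CommRing ρ.InvariantRing :=
  inferInstanceAs (CommRing ρ.invariants)

instance {M MG : Type} [AddCommGroup M] [AddCommGroup MG]
    {α : M →ₗ[ℤ] MG} {F : Set (PointedCone ℝ (NR M))} {s : ℕ} {m' : Fin s → M} {k : ℕ}
    (ρ : Linearization α F m' k) : Algebra ℂ ρ.InvariantRing :=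
  inferInstanceAs (Algebra ℂ ρ.invariants)

/-- The inclusion of the ring of invariants in `ℂ[M][T]`. -/
def Linearization.toPolynomial {M MG : Type} [AddCommGroup M] [AddCommGroup MG]
    {α : M →ₗ[ℤ] MG} {F : Set (PointedCone ℝ (NR M))} {s : ℕ} {m' : Fin s → M} {k : ℕ}
    (ρ : Linearization α F m' k) :
    ρ.InvariantRing →ₐ[ℂ] Polynomial (AddMonoidAlgebra ℂ M) :=
  ρ.invariants.val

/-- The invariants of degree `j`, that is, `Γ(X, L^{⊗kj})^G`. -/
def Linearization.grading {M MG : Type} [AddCommGroup M] [AddCommGroup MG]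
    {α : M →ₗ[ℤ] MG} {F : Set (PointedCone ℝ (NR M))} {s : ℕ} {m' : Fin s → M} {k : ℕ}
    (ρ : Linearization α F m' k) (j : ℕ) :
    Submodule ℂ ρ.InvariantRing where
  carrier := {f | ∀ i, i ≠ j → (ρ.toPolynomial f).coeff i = 0}
  zero_mem' := by simp
  add_mem' {f g} hf hg i hi := by simp [hf i hi, hg i hi]
  smul_mem' c f hf i hi := by simp [hf i hi]

/-- The homogeneous component of degree `j` of an invariant. -/
def Linearization.homogeneousPart {M MG : Type} [AddCommGroup M] [AddCommGroup MG]
    {α : M →ₗ[ℤ] MG} {F : Set (PointedCone ℝ (NR M))} {s : ℕ} {m' : Fin s → M} {k : ℕ}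
    (ρ : Linearization α F m' k)
    (j : ℕ) : ρ.InvariantRing →ₗ[ℂ] ρ.grading j where
  toFun f := ⟨⟨Polynomial.monomial j ((ρ.toPolynomial f).coeff j),
    ρ.monomial_mem_invariants f.2 j⟩, fun i hi =>
      (Polynomial.coeff_monomial).trans (if_neg hi.symm)⟩
  map_add' f g := by
    apply Subtype.ext
    apply Subtype.ext
    change Polynomial.monomial j ((ρ.toPolynomial (f + g)).coeff j) =
      Polynomial.monomial j ((ρ.toPolynomial f).coeff j) +
      Polynomial.monomial j ((ρ.toPolynomial g).coeff j)
    simp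
  map_smul' c f := by
    apply Subtype.ext
    apply Subtype.ext
    change Polynomial.monomial j ((ρ.toPolynomial (c • f)).coeff j) =
      c • Polynomial.monomial j ((ρ.toPolynomial f).coeff j)
    rw [map_smul, Polynomial.coeff_smul, Polynomial.smul_monomial]

theorem Linearization.toPolynomial_homogeneousPart {M MG : Type} [AddCommGroup M] [AddCommGroup MG]
    {α : M →ₗ[ℤ] MG} {F : Set (PointedCone ℝ (NR M))} {s : ℕ} {m' : Fin s → M} {k : ℕ}
    (ρ : Linearization α F m' k)
    (j : ℕ) (f : ρ.InvariantRing) : ρ.toPolynomial (ρ.homogeneousPart j f) =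
      Polynomial.monomial j ((ρ.toPolynomial f).coeff j) :=
  rfl

theorem Linearization.toPolynomial_injective {M MG : Type} [AddCommGroup M] [AddCommGroup MG]
    {α : M →ₗ[ℤ] MG} {F : Set (PointedCone ℝ (NR M))} {s : ℕ} {m' : Fin s → M} {k : ℕ}
    (ρ : Linearization α F m' k) :
    Function.Injective ρ.toPolynomial :=
  Subtype.val_injective

theorem Linearization.homogeneousPart_of_mem {M MG : Type} [AddCommGroup M] [AddCommGroup MG]
    {α : M →ₗ[ℤ] MG} {F : Set (PointedCone ℝ (NR M))} {s : ℕ} {m' : Fin s → M} {k : ℕ}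
    (ρ : Linearization α F m' k)
    {i : ℕ} (f : ρ.InvariantRing) (hf : f ∈ ρ.grading i) (j : ℕ) :
    (ρ.homogeneousPart j f : ρ.InvariantRing) = if i = j then f else 0 := by
  apply ρ.toPolynomial_injective
  rw [ρ.toPolynomial_homogeneousPart]
  ext1 n
  rw [Polynomial.coeff_monomial]
  split_ifs with h₁ h₂ h₂
  · rw [h₁]
  · rw [hf j (fun h => h₂ h.symm), map_zero, Polynomial.coeff_zero]
  · rw [hf n (fun h => h₁ (by rw [h, h₂]))]
  · rw [map_zero, Polynomial.coeff_zero]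

theorem Linearization.sum_homogeneousPart {M MG : Type} [AddCommGroup M] [AddCommGroup MG]
    {α : M →ₗ[ℤ] MG} {F : Set (PointedCone ℝ (NR M))} {s : ℕ} {m' : Fin s → M} {k : ℕ}
    (ρ : Linearization α F m' k)
    (f : ρ.InvariantRing) :
    DirectSum.coeAddMonoidHom ρ.grading (∑ j ∈ (ρ.toPolynomial f).support,
      DirectSum.of (fun i => ρ.grading i) j (ρ.homogeneousPart j f)) = f := by
  apply ρ.toPolynomial_injective
  simp only [map_sum, DirectSum.coeAddMonoidHom_of, ρ.toPolynomial_homogeneousPart]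
  exact ((ρ.toPolynomial f).as_sum_support).symm

instance Linearization.gradedAlgebra {M MG : Type} [AddCommGroup M] [AddCommGroup MG]
    {α : M →ₗ[ℤ] MG} {F : Set (PointedCone ℝ (NR M))} {s : ℕ} {m' : Fin s → M} {k : ℕ}
    (ρ : Linearization α F m' k) :
    GradedAlgebra ρ.grading where
  one_mem i hi := by
    rw [map_one, Polynomial.coeff_one, if_neg hi]
  mul_mem i j f g hf hg n hn := by
    rw [map_mul, Polynomial.coeff_mul]
    refine Finset.sum_eq_zero fun p hp => ?_
    by_cases h : p.1 = i
    · rw [hg p.2, mul_zero]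
      rintro rfl
      exact hn (by rw [← Finset.HasAntidiagonal.mem_antidiagonal.1 hp, h])
    · rw [hf p.1 h, zero_mul]
  decompose' f := ∑ j ∈ (ρ.toPolynomial f).support,
    DirectSum.of (fun i => ρ.grading i) j (ρ.homogeneousPart j f)
  left_inv f := ρ.sum_homogeneousPart f
  right_inv x := by
    have h : ∀ (j : ℕ) (y : DirectSum ℕ fun i => ρ.grading i),
        ρ.homogeneousPart j (DirectSum.coeAddMonoidHom ρ.grading y) = y j := by
      intro j y
      induction y using DirectSum.induction_on with
      | zero => simp
      | of i y =>
        apply Subtype.ext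
        rw [DirectSum.coeAddMonoidHom_of, ρ.homogeneousPart_of_mem y.1 y.2 j,
          DirectSum.coe_of_apply]
        split_ifs <;> rfl
      | add y z hy hz => rw [map_add, map_add, hy, hz, DirectSum.add_apply]
    refine DFinsupp.ext fun j => ?_
    rw [← h j, ← h j]
    exact congrArg _ (ρ.sum_homogeneousPart _)

/-- The GIT quotient `X^{ss}(L, b) // G = Proj (⨁ⱼ Γ(X, L^{⊗kj})^G)`, as a scheme over `ℂ`, where
the fractional linearization `b` is given by the linearization `ρ` of `L^{⊗k}`. -/
def Linearization.gitQuotient {M MG : Type} [AddCommGroup M] [AddCommGroup MG]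
    {α : M →ₗ[ℤ] MG} {F : Set (PointedCone ℝ (NR M))} {s : ℕ} {m' : Fin s → M} {k : ℕ}
    (ρ : Linearization α F m' k) :
    Over (Spec (.of ℂ)) :=
  Over.mk (Proj.toSpecZero ρ.grading ≫ Spec.map (CommRingCat.ofHom (algebraMap ℂ (ρ.grading 0))))

/-! ### The polyhedron of the quotient -/

/-- The inclusion `(Ker α)_ℝ → M_ℝ`. -/
def kerInclusion {M MG : Type} [AddCommGroup M] [AddCommGroup MG] (α : M →ₗ[ℤ] MG) :
    MR (LinearMap.ker α) →ₗ[ℝ] MR M :=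
  (LinearMap.ker α).subtype.toAddMonoidHom.toIntLinearMap.baseChange ℝ

/-- The polyhedron `P̃_b = P̃ ∩ (α ⊗ ℝ)⁻¹(-b)`. -/
def slice {M MG : Type} [AddCommGroup M] [AddCommGroup MG] (α : M →ₗ[ℤ] MG) (P : Set (MR M))
    (b : ℚ ⊗[ℤ] MG) : Set (MR M) :=
  P ∩ (α.baseChange ℝ) ⁻¹' {-(ratToReal MG b)}

/-- The polyhedron `P̃_b` viewed in `(Ker α)_ℝ`, after translation by a point `-x₀` where
`x₀ ∈ M ⊗ ℚ` is mapped to `-b`. -/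
def kerSlice {M MG : Type} [AddCommGroup M] [AddCommGroup MG] (α : M →ₗ[ℤ] MG) (P : Set (MR M))
    (b : ℚ ⊗[ℤ] MG) (x₀ : ℚ ⊗[ℤ] M) : Set (MR (LinearMap.ker α)) :=
  (fun y => kerInclusion α y + ratToReal M x₀) ⁻¹' slice α P b

/-- The structure of a toric variety on the GIT quotient is the one given by monomials: if `x` is
a point of the polyhedron `Q` and `f = χ^m T^j` an invariant with `m = kj(x + x₀)`, then the chart
of the normal cone at `x` is the standard open set `D₊(f)`, with each fraction `χ^p T^(ij) / f^i`
of degree zero identified with the monomial `χ^(p - im)`. -/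
def Linearization.IsMonomial {M MG : Type} [AddCommGroup M] [AddCommGroup MG]
    {α : M →ₗ[ℤ] MG} {F : Set (PointedCone ℝ (NR M))} {s : ℕ} {m' : Fin s → M} {k : ℕ}
    (ρ : Linearization α F m' k) (x₀ : ℚ ⊗[ℤ] M) {Q : Set (MR (LinearMap.ker α))}
    (t : ToricStructure Q ρ.gitQuotient) : Prop :=
  ∀ (τ : normalFan Q) (x : MR (LinearMap.ker α)), x ∈ Q → τ.1 = normalCone Q x →
    ∀ (j : ℕ) (hj : 0 < j) (m : M) (f : ρ.InvariantRing) (hf : f ∈ ρ.grading j),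
      ρ.toPolynomial f = Polynomial.monomial j (chi m) →
      pt m = ((k * j : ℕ) : ℝ) • (kerInclusion α x + ratToReal M x₀) →
      ∃ φ : HomogeneousLocalization.Away ρ.grading f ≃+* AddMonoidAlgebra ℂ (chartMonoid τ.1),
        (∀ (i : ℕ) (g : ρ.InvariantRing) (hg : g ∈ ρ.grading (i • j)),
          AddMonoidAlgebra.mapDomain (fun p : chartMonoid τ.1 => ((p : LinearMap.ker α) : M))
              (φ (HomogeneousLocalization.Away.mk ρ.grading hf i g hg)) * chi (i • m) =
            (ρ.toPolynomial g).coeff (i • j)) ∧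
        (t.charts.app τ).left =
          Spec.map (CommRingCat.ofHom φ.toRingHom) ≫ Proj.awayι ρ.grading f hf hj

end ToricGIT

end

open ToricGIT

/-!
Three facts carry the theorem: a linearization is the same as a weight, invariants are spanned by
monomials, and the monomial charts of `Proj` of the invariants are those of the toric variety of
the sliced polyhedron.

*Linearizations.* Write `T` for the generator of `⨁ⱼ Γ(U_τ, L^{⊗kj}) Tʲ` over the chart of the
vertex `0`, where the section `1` trivializes `L`. Under a coaction of `ℂ[M_G]` it decomposes into
components `T_w = h_w T`, each of which is semi-invariant of weight `w`. Since `ℂ[M]` is a domain,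
looking at the highest and at the lowest weights in `h_w T`, for an order on `M_G`, shows that only
one component is nonzero (`eq_of_ne_zero_of_sum_mul`): `G` acts on `T` by a character `c`. Any other
chart meets this one in a chart, namely that of the intersection of the cones, and restriction is
injective, so `c` determines the action everywhere (`Linearization.exists_hasWeight`,
`Linearization.eq_of_hasWeight`). Conversely every `c` defines an action on `ℂ[M][T]`, which
restricts to the charts because sections are spanned by monomials
(`exists_linearization_hasWeight`). The `p`-th tensor power multiplies `c` by `p`, so that
`(k, c) ↦ c / k` is a bijection from fractional linearizations onto `M_G ⊗ ℚ`
(`exists_fractionalLinearization_equiv`).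

*Polyhedra.* Elimination shows that finitely generated rational cones are stable under intersection
with rational half-spaces (`exists_hull_eq_inf_halfSpaces`), and it yields Farkas' lemma
(`exists_dual_neg_of_notMem_hull`). The first, applied to the cone over `P̃`, shows
that its rational slices are fractional lattice polyhedra
(`isFractionalLatticePolyhedron_kerSlice`). The second shows that `χ^m` is a global section of
`L^{⊗n}` exactly if `m ∈ n P̃` (`forall_chi_mem_sections_iff`), and that the tangent cone of a
polyhedron at a point is dual to its normal cone (`exists_add_smul_mem`).

*The quotient.* Let `Q + x₀` be the slice. It follows that the ring of invariants is spanned by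
monomials, those of degree `j > 0` being the `χ^m Tʲ` with `m ∈ kj (Q + x₀)`
(`Linearization.HasWeight.hasMonomialInvariants`). For such a monomial `f`, with
`m = kj (x + x₀)`, the duality of tangent and normal cones identifies the coordinate ring of
`D₊(f)` with `ℂ[τ^∨ ∩ Ker α]`, where `τ` is the normal cone of `Q` at `x`
(`Linearization.ChartSection.exists_equiv`). The product of two such monomials belongs to a point
in the interior of the segment between the two points, whose normal cone is the intersection of the
two normal cones (`normalCone_combo`, `Linearization.ChartSection.mul`). Hence `D₊(f)` depends only
on `τ`, the charts are compatible with the inclusions of cones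
(`Linearization.ChartSection.affineToricMap_comp_toProj_of_le`), and the chart of an intersection of
cones is the intersection of the charts. Every cone of the normal fan has such a monomial, as it is
the normal cone at a rational point (`Linearization.exists_chartSection`), and the `D₊(f)` cover
`Proj` because the monomials span the irrelevant ideal (`Linearization.exists_mem_basicOpen`). A
scheme with a directed open cover of this kind is the colimit of its charts
(`nonempty_isColimit_of_isOpenImmersion`).
-/
/-! ### Finitely generated cones -/

namespace ToricGIT

section Cones

variable {E : Type*} [AddCommGroup E] [Module ℝ E]

theorem mem_hull_image_iff {ι : Type*} (T : Finset ι) (f : ι → E) (x : E) :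
    x ∈ PointedCone.hull ℝ (f '' T) ↔ ∃ c : ι → ℝ, (∀ i, 0 ≤ c i) ∧ ∑ i ∈ T, c i • f i = x := by
  classical
  rw [PointedCone.hull, Submodule.mem_span_image_finset_iff_exists_fun]
  constructor
  · rintro ⟨c, rfl⟩
    refine ⟨fun i => if h : i ∈ T then (c ⟨i, h⟩ : ℝ) else 0, fun i => ?_, ?_⟩
    · dsimp only
      split_ifs
      · exact (c _).2
      · exact le_rfl
    · rw [← Finset.sum_coe_sort T]
      refine Finset.sum_congr rfl fun i _ => ?_
      simp [i.2]
  · rintro ⟨c, hc, rfl⟩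
    refine ⟨fun i => ⟨c i, hc i⟩, ?_⟩
    rw [← Finset.sum_coe_sort T]
    rfl

theorem mem_hull_finset_iff (S : Finset E) (x : E) :
    x ∈ PointedCone.hull ℝ (S : Set E) ↔
      ∃ c : E → ℝ, (∀ i, 0 ≤ c i) ∧ ∑ i ∈ S, c i • i = x := by
  simpa using mem_hull_image_iff S (id : E → E) x

theorem sum_eq_sum_pos_add_sum_neg_add_sum_zero {ι R : Type*} [AddCommGroup R] (S : Finset ι)
    (h : ι → ℝ) (F : ι → R) :
    ∑ x ∈ S, F x = ∑ x ∈ S with 0 < h x, F x + ∑ x ∈ S with h x < 0, F x +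
      ∑ x ∈ S with h x = 0, F x := by
  rw [Finset.sum_filter, Finset.sum_filter, Finset.sum_filter,
    ← Finset.sum_add_distrib, ← Finset.sum_add_distrib]
  refine Finset.sum_congr rfl fun x _ => ?_
  rcases lt_trichotomy (h x) 0 with h' | h' | h'
  · simp [h', h'.not_gt, h'.ne]
  · simp [h']
  · simp [h', h'.not_gt, h'.ne']

/-- The double description step: cutting a finitely generated cone by a half-space. The subgroup `Λ`
is a lattice on which the half-space is rational, and contains all generators. The new
generators are the old ones in the half-space and, for each pair of generators on opposite sides of
the bounding hyperplane, the point where the plane cone they span meets that hyperplane. -/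
theorem exists_hull_eq_inf_halfSpace (Λ : AddSubgroup E) (h : E →ₗ[ℝ] ℝ)
    (hΛ : ∀ x ∈ Λ, ∃ n : ℤ, h x = n) (S : Finset E) (hS : ∀ x ∈ S, x ∈ Λ) :
    ∃ S' : Finset E, (∀ x ∈ S', x ∈ Λ) ∧ ∀ x, x ∈ PointedCone.hull ℝ (S' : Set E) ↔
      x ∈ PointedCone.hull ℝ (S : Set E) ∧ 0 ≤ h x := by
  classical
  set P := S.filter (fun x => 0 < h x) with hP
  set N := S.filter (fun x => h x < 0) with hN
  set Z := S.filter (fun x => h x = 0) with hZ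
  set C := Finset.image₂ (fun p n => h p • n - h n • p) P N with hC
  refine ⟨P ∪ Z ∪ C, ?_, fun x => ⟨fun hx => ?_, ?_⟩⟩
  · intro x hx
    simp only [Finset.mem_union] at hx
    rcases hx with (hx | hx) | hx
    · exact hS x (Finset.mem_of_mem_filter x hx)
    · exact hS x (Finset.mem_of_mem_filter x hx)
    · obtain ⟨p, hp, n, hn, rfl⟩ := Finset.mem_image₂.1 hx
      have hp' := hS p (Finset.mem_of_mem_filter p hp)
      have hn' := hS n (Finset.mem_of_mem_filter n hn)
      obtain ⟨a, ha⟩ := hΛ p hp'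
      obtain ⟨b, hb⟩ := hΛ n hn'
      rw [ha, hb, Int.cast_smul_eq_zsmul, Int.cast_smul_eq_zsmul]
      exact sub_mem (zsmul_mem hn' a) (zsmul_mem hp' b)
  · have hle : PointedCone.hull ℝ ((P ∪ Z ∪ C : Finset E) : Set E) ≤
        PointedCone.hull ℝ (S : Set E) ⊓ (PointedCone.positive ℝ ℝ).comap h := by
      refine Submodule.span_le.2 fun y hy => ?_
      simp only [Finset.coe_union, Set.mem_union, Finset.mem_coe] at hy
      rcases hy with (hy | hy) | hy
      · obtain ⟨h1, h2⟩ := Finset.mem_filter.1 hy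
        exact ⟨PointedCone.subset_hull h1, h2.le⟩
      · obtain ⟨h1, h2⟩ := Finset.mem_filter.1 hy
        exact ⟨PointedCone.subset_hull h1, h2.ge⟩
      · obtain ⟨p, hp, n, hn, rfl⟩ := Finset.mem_image₂.1 hy
        obtain ⟨h1, h2⟩ := Finset.mem_filter.1 hp
        obtain ⟨h3, h4⟩ := Finset.mem_filter.1 hn
        refine ⟨?_, ?_⟩
        · rw [sub_eq_add_neg, ← neg_smul]
          exact add_mem (PointedCone.smul_mem _ h2.le (PointedCone.subset_hull h3))
            (PointedCone.smul_mem _ (neg_nonneg.2 h4.le) (PointedCone.subset_hull h1))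
        · change 0 ≤ h _
          simp only [map_sub, map_smul, smul_eq_mul]
          linarith [mul_comm (h p) (h n)]
    exact ⟨(hle hx).1, (hle hx).2⟩
  · rintro ⟨hx, hpos⟩
    obtain ⟨c, hc, rfl⟩ := (mem_hull_finset_iff S x).1 hx
    set A := ∑ p ∈ P, c p * h p with hA
    set B := ∑ n ∈ N, c n * h n with hB
    have hAB : 0 ≤ A + B := by
      have hz : ∑ z ∈ Z, c z * h z = 0 :=
        Finset.sum_eq_zero fun z hz => by rw [(Finset.mem_filter.1 hz).2, mul_zero]
      simp only [map_sum, map_smul, smul_eq_mul] at hpos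
      rw [sum_eq_sum_pos_add_sum_neg_add_sum_zero S h, hz, add_zero] at hpos
      exact hpos
    have hA0 : 0 ≤ A := Finset.sum_nonneg fun p hp =>
      mul_nonneg (hc p) (Finset.mem_filter.1 hp).2.le
    have memP : ∀ p ∈ P, p ∈ PointedCone.hull ℝ ((P ∪ Z ∪ C : Finset E) : Set E) := fun p hp =>
      PointedCone.subset_hull (by simp [hp])
    have memZ : ∀ p ∈ Z, p ∈ PointedCone.hull ℝ ((P ∪ Z ∪ C : Finset E) : Set E) := fun p hp =>
      PointedCone.subset_hull (by simp [hp])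
    have memC : ∀ p ∈ P, ∀ n ∈ N,
        h p • n - h n • p ∈ PointedCone.hull ℝ ((P ∪ Z ∪ C : Finset E) : Set E) :=
      fun p hp n hn => PointedCone.subset_hull (by
        simp only [Finset.coe_union, Set.mem_union, Finset.mem_coe]
        exact Or.inr (Finset.mem_image₂_of_mem hp hn))
    rw [sum_eq_sum_pos_add_sum_neg_add_sum_zero S h]
    refine add_mem ?_ (Submodule.sum_mem _ fun z hz => PointedCone.smul_mem _ (hc z) (memZ z hz))
    rcases hA0.eq_or_lt with hA0 | hA0
    · have hB0 : ∀ n ∈ N, c n * h n = 0 := by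
        have hn0 : ∀ n ∈ N, c n * h n ≤ 0 := fun n hn =>
          mul_nonpos_of_nonneg_of_nonpos (hc n) (Finset.mem_filter.1 hn).2.le
        refine (Finset.sum_eq_zero_iff_of_nonpos hn0).1 ?_
        have := Finset.sum_nonpos hn0
        linarith
      have : ∑ n ∈ N, c n • n = 0 := Finset.sum_eq_zero fun n hn => by
        rcases mul_eq_zero.1 (hB0 n hn) with h0 | h0
        · rw [h0, zero_smul]
        · exact absurd h0 (Finset.mem_filter.1 hn).2.ne
      rw [this, add_zero]
      exact Submodule.sum_mem _ fun z hz => PointedCone.smul_mem _ (hc z) (memP z hz)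
    · -- Each negative generator is paired with all positive ones, in proportion to `c p * h p`.
      have hpair : ∑ p ∈ P, c p • p + ∑ n ∈ N, c n • n =
          ((A + B) / A) • ∑ p ∈ P, c p • p +
            ∑ p ∈ P, ∑ n ∈ N, (c p * c n / A) • (h p • n - h n • p) := by
        have e1 : ∑ p ∈ P, ∑ n ∈ N, (c p * c n / A) • h p • n = ∑ n ∈ N, c n • n := by
          rw [Finset.sum_comm]
          refine Finset.sum_congr rfl fun n _ => ?_
          simp only [smul_smul]
          rw [← Finset.sum_smul]
          congr 1
          calc ∑ p ∈ P, c p * c n / A * h p = ∑ p ∈ P, (c p * h p) * (c n / A) :=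
                Finset.sum_congr rfl fun p _ => by ring
            _ = c n := by rw [← Finset.sum_mul, ← hA]; field_simp
        have e2 : ∑ p ∈ P, ∑ n ∈ N, (c p * c n / A) • h n • p = (B / A) • ∑ p ∈ P, c p • p := by
          rw [Finset.smul_sum]
          refine Finset.sum_congr rfl fun p _ => ?_
          simp only [smul_smul]
          rw [← Finset.sum_smul]
          congr 1
          calc ∑ n ∈ N, c p * c n / A * h n = ∑ n ∈ N, (c n * h n) * (c p / A) :=
                Finset.sum_congr rfl fun p _ => by ring
            _ = B / A * c p := by rw [← Finset.sum_mul, ← hB]; ring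
        simp only [smul_sub, Finset.sum_sub_distrib, e1, e2, add_div, div_self hA0.ne', add_smul,
          one_smul]
        abel
      rw [hpair]
      refine add_mem (PointedCone.smul_mem _ (div_nonneg hAB hA0.le) (Submodule.sum_mem _
        fun z hz => PointedCone.smul_mem _ (hc z) (memP z hz))) (Submodule.sum_mem _ fun p hp =>
          Submodule.sum_mem _ fun n hn => PointedCone.smul_mem _
            (div_nonneg (mul_nonneg (hc p) (hc n)) hA0.le) (memC p hp n hn))

/-- A finite intersection of rational half-spaces with a finitely generated rational cone is a
finitely generated rational cone. -/
theorem exists_hull_eq_inf_halfSpaces (Λ : AddSubgroup E) (H : Finset (E →ₗ[ℝ] ℝ))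
    (hΛ : ∀ h ∈ H, ∀ x ∈ Λ, ∃ n : ℤ, h x = n) (S : Finset E) (hS : ∀ x ∈ S, x ∈ Λ) :
    ∃ S' : Finset E, (∀ x ∈ S', x ∈ Λ) ∧ ∀ x, x ∈ PointedCone.hull ℝ (S' : Set E) ↔
      x ∈ PointedCone.hull ℝ (S : Set E) ∧ ∀ h ∈ H, 0 ≤ h x := by
  classical
  induction H using Finset.induction_on with
  | empty => exact ⟨S, hS, by simp⟩
  | insert h H _ ih =>
    obtain ⟨S₁, h₁, e₁⟩ := ih fun g hg => hΛ g (Finset.mem_insert_of_mem hg)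
    obtain ⟨S₂, h₂, e₂⟩ := exists_hull_eq_inf_halfSpace Λ h (hΛ h (Finset.mem_insert_self h H))
      S₁ h₁
    refine ⟨S₂, h₂, fun x => ?_⟩
    rw [e₂, e₁, Finset.forall_mem_insert]
    tauto

/-- Fourier–Motzkin elimination: adding one generator to a finite intersection of half-spaces. -/
theorem exists_dual_add_ray (U : Finset (Module.Dual ℝ E)) (g : E) :
    ∃ U' : Finset (Module.Dual ℝ E), ∀ x,
      (∃ t : ℝ, 0 ≤ t ∧ ∀ u ∈ U, 0 ≤ u (x - t • g)) ↔ ∀ u ∈ U', 0 ≤ u x := by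
  classical
  set P := U.filter (fun u => 0 ≤ u g) with hP
  set N := U.filter (fun u => u g < 0) with hN
  refine ⟨P ∪ Finset.image₂ (fun p n => p g • n - n g • p) P N, fun x => ⟨?_, fun hx => ?_⟩⟩
  · rintro ⟨t, ht, hU⟩ u hu
    simp only [map_sub, map_smul, smul_eq_mul] at hU
    rcases Finset.mem_union.1 hu with hu | hu
    · obtain ⟨h1, h2⟩ := Finset.mem_filter.1 hu
      nlinarith [hU u h1, mul_nonneg ht h2]
    · obtain ⟨p, hp, n, hn, rfl⟩ := Finset.mem_image₂.1 hu
      obtain ⟨h1, h2⟩ := Finset.mem_filter.1 hp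
      obtain ⟨h3, h4⟩ := Finset.mem_filter.1 hn
      simp only [LinearMap.sub_apply, LinearMap.smul_apply, smul_eq_mul]
      nlinarith [mul_nonneg h2 (hU n h3), mul_nonneg (neg_nonneg.2 h4.le) (hU p h1)]
  · have hxP : ∀ p ∈ P, 0 ≤ p x := fun p hp => hx p (Finset.mem_union_left _ hp)
    have hxC : ∀ p ∈ P, ∀ n ∈ N, 0 ≤ p g * n x - n g * p x := fun p hp n hn => by
      simpa using hx _ (Finset.mem_union_right _ (Finset.mem_image₂_of_mem hp hn))
    -- The least admissible `t`.
    set L := insert 0 (N.image fun n => n x / n g) with hL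
    have hLne : L.Nonempty := Finset.insert_nonempty _ _
    have h0 : 0 ≤ L.max' hLne := Finset.le_max' _ _ (Finset.mem_insert_self _ _)
    refine ⟨L.max' hLne, h0, fun u hu => ?_⟩
    simp only [map_sub, map_smul, smul_eq_mul]
    by_cases hug : 0 ≤ u g
    · have huP : u ∈ P := Finset.mem_filter.2 ⟨hu, hug⟩
      rcases Finset.mem_insert.1 (Finset.max'_mem L hLne) with h | h
      · rw [h]; simpa using hxP u huP
      · obtain ⟨n, hn, hn'⟩ := Finset.mem_image.1 h
        rw [← hn']
        have hng := (Finset.mem_filter.1 hn).2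
        have := hxC u huP n hn
        have e : u x - n x / n g * u g = (u g * n x - n g * u x) / (-(n g)) := by
          field_simp [hng.ne]
          ring
        rw [e]
        exact div_nonneg this (neg_nonneg.2 hng.le)
    · push Not at hug
      have huN : u ∈ N := Finset.mem_filter.2 ⟨hu, hug⟩
      have : u x / u g ≤ L.max' hLne :=
        Finset.le_max' L _ (Finset.mem_insert_of_mem
          (Finset.mem_image_of_mem (fun n : Module.Dual ℝ E => n x / n g) huN))
      rw [div_le_iff_of_neg hug] at this
      linarith

/-- A finitely generated cone is a finite intersection of half-spaces. -/
theorem exists_mem_hull_iff_forall_dual [FiniteDimensional ℝ E] (S : Finset E) :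
    ∃ U : Finset (Module.Dual ℝ E), ∀ x,
      x ∈ PointedCone.hull ℝ (S : Set E) ↔ ∀ u ∈ U, 0 ≤ u x := by
  classical
  induction S using Finset.induction_on with
  | empty =>
    let b := Module.finBasis ℝ E
    refine ⟨Finset.univ.image b.coord ∪ Finset.univ.image (fun i => -b.coord i), fun x => ?_⟩
    simp only [Finset.coe_empty, PointedCone.hull, Submodule.span_empty, Submodule.mem_bot]
    constructor
    · rintro rfl; simp
    · intro h
      refine b.ext_elem fun i => ?_
      have h1 := h (b.coord i) (by simp)
      have h2 := h (-b.coord i) (by simp)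
      simp only [Module.Basis.coord_apply, LinearMap.neg_apply] at h1 h2
      rw [map_zero, Finsupp.zero_apply]
      linarith
  | insert g S _ ih =>
    obtain ⟨U, hU⟩ := ih
    obtain ⟨U', hU'⟩ := exists_dual_add_ray U g
    refine ⟨U', fun x => ?_⟩
    rw [← hU', Finset.coe_insert, PointedCone.hull, Submodule.mem_span_insert]
    constructor
    · rintro ⟨a, z, hz, rfl⟩
      refine ⟨a, a.2, (hU _).1 ?_⟩
      have : (a • g + z) - (a : ℝ) • g = z := by
        change (a : ℝ) • g + z - (a : ℝ) • g = z
        abel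
      rwa [this]
    · rintro ⟨t, ht, h⟩
      refine ⟨⟨t, ht⟩, x - t • g, (hU _).2 h, ?_⟩
      change x = t • g + (x - t • g)
      abel

/-- Farkas' lemma. -/
theorem exists_dual_neg_of_notMem_hull [FiniteDimensional ℝ E] {S : Finset E} {x : E}
    (hx : x ∉ PointedCone.hull ℝ (S : Set E)) :
    ∃ u : Module.Dual ℝ E, (∀ y ∈ S, 0 ≤ u y) ∧ u x < 0 := by
  obtain ⟨U, hU⟩ := exists_mem_hull_iff_forall_dual S
  rw [hU] at hx
  push Not at hx
  obtain ⟨u, hu, hux⟩ := hx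
  exact ⟨u, fun y hy => (hU y).1 (PointedCone.subset_hull hy) u hu, hux⟩

end Cones

end ToricGIT

/-! ### Polyhedra given by vertices and rays -/

namespace ToricGIT

section Polyhedra

variable {E : Type*} [AddCommGroup E] [Module ℝ E] {ι κ : Type*}

theorem mem_convexHull_image_iff (T : Finset ι) (f : ι → E) (x : E) :
    x ∈ convexHull ℝ (f '' T) ↔
      ∃ c : ι → ℝ, (∀ i, 0 ≤ c i) ∧ ∑ i ∈ T, c i = 1 ∧ ∑ i ∈ T, c i • f i = x := by
  classical
  constructor
  · intro hx
    refine convexHull_min (s := f '' T)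
      (t := {x | ∃ c : ι → ℝ, (∀ i, 0 ≤ c i) ∧ ∑ i ∈ T, c i = 1 ∧ ∑ i ∈ T, c i • f i = x})
      ?_ ?_ hx
    · rintro _ ⟨i, hi, rfl⟩
      refine ⟨fun j => if j = i then 1 else 0, fun j => ?_, ?_, ?_⟩
      · dsimp only
        split_ifs <;> norm_num
      · simp [Finset.mem_coe.1 hi]
      · simp [Finset.mem_coe.1 hi]
    · rintro _ ⟨c, hc, hc1, rfl⟩ _ ⟨d, hd, hd1, rfl⟩ a b ha hb hab
      refine ⟨fun i => a * c i + b * d i, fun i => ?_, ?_, ?_⟩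
      · have := hc i
        have := hd i
        positivity
      · rw [Finset.sum_add_distrib, ← Finset.mul_sum, ← Finset.mul_sum, hc1, hd1, mul_one, mul_one,
          hab]
      · simp only [add_smul, mul_smul, Finset.sum_add_distrib, Finset.smul_sum]
  · rintro ⟨c, hc, hc1, rfl⟩
    exact (convex_convexHull ℝ _).sum_mem (fun i _ => hc i) hc1
      fun i hi => subset_convexHull ℝ _ ⟨i, hi, rfl⟩

theorem mem_convexHull_add_hull_iff (V : Finset ι) (f : ι → E) (W : Finset κ) (g : κ → E) (x : E) :
    x ∈ convexHull ℝ (f '' V) + (PointedCone.hull ℝ (g '' W) : Set E) ↔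
      ∃ (a : ι → ℝ) (b : κ → ℝ), (∀ i, 0 ≤ a i) ∧ (∀ i, 0 ≤ b i) ∧ ∑ i ∈ V, a i = 1 ∧
        ∑ i ∈ V, a i • f i + ∑ i ∈ W, b i • g i = x := by
  rw [Set.mem_add]
  constructor
  · rintro ⟨y, hy, z, hz, rfl⟩
    obtain ⟨a, ha, ha1, rfl⟩ := (mem_convexHull_image_iff V f y).1 hy
    obtain ⟨b, hb, rfl⟩ := (mem_hull_image_iff W g z).1 hz
    exact ⟨a, b, ha, hb, ha1, rfl⟩
  · rintro ⟨a, b, ha, hb, ha1, rfl⟩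
    exact ⟨_, (mem_convexHull_image_iff V f _).2 ⟨a, ha, ha1, rfl⟩, _,
      (mem_hull_image_iff W g _).2 ⟨b, hb, rfl⟩, rfl⟩

theorem mem_hull_image_union_iff (V : Finset ι) (f : ι → E) (W : Finset κ) (g : κ → E) (x : E) :
    x ∈ PointedCone.hull ℝ (f '' V ∪ g '' W) ↔
      ∃ (a : ι → ℝ) (b : κ → ℝ), (∀ i, 0 ≤ a i) ∧ (∀ i, 0 ≤ b i) ∧
        ∑ i ∈ V, a i • f i + ∑ i ∈ W, b i • g i = x := by
  rw [PointedCone.hull, Submodule.span_union, Submodule.mem_sup]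
  constructor
  · rintro ⟨y, hy, z, hz, rfl⟩
    obtain ⟨a, ha, rfl⟩ := (mem_hull_image_iff V f y).1 hy
    obtain ⟨b, hb, rfl⟩ := (mem_hull_image_iff W g z).1 hz
    exact ⟨a, b, ha, hb, rfl⟩
  · rintro ⟨a, b, ha, hb, rfl⟩
    exact ⟨_, (mem_hull_image_iff V f _).2 ⟨a, ha, rfl⟩, _,
      (mem_hull_image_iff W g _).2 ⟨b, hb, rfl⟩, rfl⟩

/-- A polyhedron is the section at height `1` of the cone over it, generated by its vertices at
height `1` and its rays at height `0`. -/
theorem mem_hull_homogenization_iff (V : Finset ι) (f : ι → E) (W : Finset κ) (g : κ → E) (x : E) :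
    (x, (1 : ℝ)) ∈ PointedCone.hull ℝ
        ((fun i => (f i, (1 : ℝ))) '' V ∪ (fun i => (g i, (0 : ℝ))) '' W) ↔
      x ∈ convexHull ℝ (f '' V) + (PointedCone.hull ℝ (g '' W) : Set E) := by
  rw [mem_hull_image_union_iff, mem_convexHull_add_hull_iff]
  refine exists_congr fun a => exists_congr fun b => and_congr_right fun _ => and_congr_right
    fun _ => ?_
  rw [Prod.ext_iff, and_comm]
  simp [Prod.fst_sum, Prod.snd_sum]

theorem exists_dual_neg_of_notMem_hull_union [FiniteDimensional ℝ E] {V : Finset ι} {f : ι → E}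
    {W : Finset κ} {g : κ → E} {x : E} (hx : x ∉ PointedCone.hull ℝ (f '' V ∪ g '' W)) :
    ∃ u : Module.Dual ℝ E, (∀ i ∈ V, 0 ≤ u (f i)) ∧ (∀ i ∈ W, 0 ≤ u (g i)) ∧ u x < 0 := by
  classical
  have h : x ∉ PointedCone.hull ℝ ((V.image f ∪ W.image g : Finset E) : Set E) := by
    simpa using hx
  obtain ⟨u, hu, hux⟩ := exists_dual_neg_of_notMem_hull h
  exact ⟨u, fun i hi => hu _ (Finset.mem_union_left _ (Finset.mem_image_of_mem _ hi)),
    fun i hi => hu _ (Finset.mem_union_right _ (Finset.mem_image_of_mem _ hi)), hux⟩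

variable {V : Finset ι} {f : ι → E} {W : Finset κ} {g : κ → E} {Q : Set E}

theorem vertex_mem (hQ : Q = convexHull ℝ (f '' V) + (PointedCone.hull ℝ (g '' W) : Set E))
    {i : ι} (hi : i ∈ V) : f i ∈ Q := by
  rw [hQ]
  exact ⟨f i, subset_convexHull ℝ _ ⟨i, hi, rfl⟩, 0, zero_mem _, add_zero _⟩

theorem add_ray_mem (hQ : Q = convexHull ℝ (f '' V) + (PointedCone.hull ℝ (g '' W) : Set E))
    {x y : E} (hx : x ∈ Q) (hy : y ∈ PointedCone.hull ℝ (g '' W)) : x + y ∈ Q := by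
  rw [hQ] at hx ⊢
  obtain ⟨p, hp, q, hq, rfl⟩ := hx
  exact ⟨p, hp, q + y, add_mem hq hy, (add_assoc _ _ _).symm⟩

/-- A linear form attains its minimum over a polyhedron at the point `x` exactly if it attains it at
the vertices, and vanishes on the rays, that occur in a representation of `x`. -/
theorem isMin_iff_of_sum_eq
    (hQ : Q = convexHull ℝ (f '' V) + (PointedCone.hull ℝ (g '' W) : Set E))
    {a : ι → ℝ} {b : κ → ℝ} (ha : ∀ i, 0 ≤ a i) (hb : ∀ i, 0 ≤ b i) (ha1 : ∑ i ∈ V, a i = 1)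
    (u : Module.Dual ℝ E) :
    (∀ z ∈ Q, u (∑ i ∈ V, a i • f i + ∑ i ∈ W, b i • g i) ≤ u z) ↔
      (∀ i ∈ V, 0 < a i → ∀ z ∈ Q, u (f i) ≤ u z) ∧ ∀ i ∈ W, 0 ≤ u (g i) ∧
        (0 < b i → u (g i) = 0) := by
  have hx : ∑ i ∈ V, a i • f i + ∑ i ∈ W, b i • g i ∈ Q := by
    rw [hQ, mem_convexHull_add_hull_iff]
    exact ⟨a, b, ha, hb, ha1, rfl⟩
  have hux : u (∑ i ∈ V, a i • f i + ∑ i ∈ W, b i • g i) =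
      ∑ i ∈ V, a i * u (f i) + ∑ i ∈ W, b i * u (g i) := by
    simp
  constructor
  · intro h
    have hW : ∀ i ∈ W, 0 ≤ u (g i) := fun i hi => by
      have := h _ (add_ray_mem hQ hx (PointedCone.subset_hull ⟨i, hi, rfl⟩))
      have := map_add u (∑ i ∈ V, a i • f i + ∑ i ∈ W, b i • g i) (g i)
      linarith
    set M := u (∑ i ∈ V, a i • f i + ∑ i ∈ W, b i • g i) with hM
    have h1 : ∀ i ∈ V, 0 ≤ a i * (u (f i) - M) := fun i hi =>
      mul_nonneg (ha i) (sub_nonneg.2 (h _ (vertex_mem hQ hi)))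
    have h2 : ∀ i ∈ W, 0 ≤ b i * u (g i) := fun i hi => mul_nonneg (hb i) (hW i hi)
    have h3 : ∑ i ∈ V, a i * (u (f i) - M) + ∑ i ∈ W, b i * u (g i) = 0 := by
      simp only [mul_sub, Finset.sum_sub_distrib, ← Finset.sum_mul, ha1]
      linarith
    have h4 := Finset.sum_nonneg h1
    have h5 := Finset.sum_nonneg h2
    have h6 := (Finset.sum_eq_zero_iff_of_nonneg h1).1 (by linarith)
    have h7 := (Finset.sum_eq_zero_iff_of_nonneg h2).1 (by linarith)
    refine ⟨fun i hi hai z hz => ?_, fun i hi => ⟨hW i hi, fun hbi => ?_⟩⟩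
    · have := (mul_eq_zero.1 (h6 i hi)).resolve_left hai.ne'
      have := h z hz
      linarith
    · exact (mul_eq_zero.1 (h7 i hi)).resolve_left hbi.ne'
  · rintro ⟨h1, h2⟩ z hz
    rw [hux, Finset.sum_eq_zero (s := W), add_zero]
    · calc ∑ i ∈ V, a i * u (f i) ≤ ∑ i ∈ V, a i * u z := Finset.sum_le_sum fun i hi => by
            rcases (ha i).eq_or_lt with h0 | h0
            · simp [← h0]
            · exact mul_le_mul_of_nonneg_left (h1 i hi h0 z hz) h0.le
        _ = u z := by rw [← Finset.sum_mul, ha1, one_mul]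
    · intro i hi
      rcases (hb i).eq_or_lt with h0 | h0
      · simp [← h0]
      · rw [(h2 i hi).2 h0, mul_zero]

/-- Each normal cone is contained in the normal cone at a vertex. -/
theorem exists_vertex_of_mem
    (hQ : Q = convexHull ℝ (f '' V) + (PointedCone.hull ℝ (g '' W) : Set E)) {x : E} (hx : x ∈ Q) :
    ∃ i ∈ V, ∀ u : Module.Dual ℝ E, (∀ z ∈ Q, u x ≤ u z) → ∀ z ∈ Q, u (f i) ≤ u z := by
  have hx' := hx
  rw [hQ, mem_convexHull_add_hull_iff] at hx'
  obtain ⟨a, b, ha, hb, ha1, rfl⟩ := hx'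
  obtain ⟨i, hi, hai⟩ : ∃ i ∈ V, 0 < a i := by
    by_contra! h
    have := Finset.sum_nonpos h
    rw [ha1] at this
    norm_num at this
  exact ⟨i, hi, fun u hu => ((isMin_iff_of_sum_eq hQ ha hb ha1 u).1 hu).1 i hi hai⟩

/-- The relative interior of each face contains the sum of a barycentre of vertices and of some
rays. -/
theorem exists_barycentre_of_mem
    (hQ : Q = convexHull ℝ (f '' V) + (PointedCone.hull ℝ (g '' W) : Set E)) {x : E} (hx : x ∈ Q) :
    ∃ (V' : Finset ι) (W' : Finset κ), V'.Nonempty ∧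
      (V'.card : ℝ)⁻¹ • ∑ i ∈ V', f i + ∑ i ∈ W', g i ∈ Q ∧ ∀ u : Module.Dual ℝ E,
        (∀ z ∈ Q, u ((V'.card : ℝ)⁻¹ • ∑ i ∈ V', f i + ∑ i ∈ W', g i) ≤ u z) ↔
          ∀ z ∈ Q, u x ≤ u z := by
  classical
  rw [hQ, mem_convexHull_add_hull_iff] at hx
  obtain ⟨a, b, ha, hb, ha1, rfl⟩ := hx
  set V' := V.filter fun i => 0 < a i with hV'
  set W' := W.filter fun i => 0 < b i with hW'
  have hne : V'.Nonempty := by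
    rw [Finset.filter_nonempty_iff]
    by_contra! h
    have := Finset.sum_nonpos h
    rw [ha1] at this
    norm_num at this
  have hcard : (0 : ℝ) < V'.card := Nat.cast_pos.2 hne.card_pos
  -- All positive coefficients may be replaced by others without changing the minimizing forms.
  set a' : ι → ℝ := fun i => if 0 < a i then (V'.card : ℝ)⁻¹ else 0 with ha'
  set b' : κ → ℝ := fun i => if 0 < b i then 1 else 0 with hb'
  have ha'0 : ∀ i, 0 ≤ a' i := fun i => by
    rw [ha']; dsimp only; split_ifs <;> positivity
  have hb'0 : ∀ i, 0 ≤ b' i := fun i => by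
    rw [hb']; dsimp only; split_ifs <;> positivity
  have ha'1 : ∑ i ∈ V, a' i = 1 := by
    rw [ha', ← Finset.sum_filter, Finset.sum_const, nsmul_eq_mul, mul_inv_cancel₀ hcard.ne']
  have e : (V'.card : ℝ)⁻¹ • ∑ i ∈ V', f i + ∑ i ∈ W', g i =
      ∑ i ∈ V, a' i • f i + ∑ i ∈ W, b' i • g i := by
    simp only [ha', hb', ite_smul, zero_smul, one_smul]
    rw [← Finset.sum_filter, ← Finset.sum_filter, Finset.smul_sum]
  refine ⟨V', W', hne, ?_, fun u => ?_⟩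
  · rw [hQ, mem_convexHull_add_hull_iff]
    exact ⟨a', b', ha'0, hb'0, ha'1, e.symm⟩
  · have h1 : ∀ i, 0 < a' i ↔ 0 < a i := fun i => by
      rw [ha']; dsimp only; split_ifs with h <;> simp [h, hcard]
    have h2 : ∀ i, 0 < b' i ↔ 0 < b i := fun i => by
      rw [hb']; dsimp only; split_ifs with h <;> simp [h]
    rw [e, isMin_iff_of_sum_eq hQ ha'0 hb'0 ha'1, isMin_iff_of_sum_eq hQ ha hb ha1]
    simp only [h1, h2]

/-- A point outside a polyhedron is separated from it by a linear form whose minimum is attained at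
a vertex. -/
theorem exists_separating_of_notMem [FiniteDimensional ℝ E]
    (hQ : Q = convexHull ℝ (f '' V) + (PointedCone.hull ℝ (g '' W) : Set E)) (hV : V.Nonempty)
    {x : E} (hx : x ∉ Q) :
    ∃ i ∈ V, ∃ u : Module.Dual ℝ E, (∀ z ∈ Q, u (f i) ≤ u z) ∧ u x < u (f i) := by
  rw [hQ, ← mem_hull_homogenization_iff] at hx
  obtain ⟨U, hU1, hU2, hU3⟩ := exists_dual_neg_of_notMem_hull_union hx
  have hU : ∀ (y : E) (t : ℝ), U (y, t) = U (y, 0) + t * U (0, 1) := fun y t => by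
    have : ((y, t) : E × ℝ) = (y, 0) + t • (0, 1) := by simp
    rw [this, map_add, map_smul, smul_eq_mul]
  obtain ⟨i, hi, hmin⟩ := V.exists_min_image (fun i => U (f i, 0)) hV
  refine ⟨i, hi, U.comp (LinearMap.inl ℝ E ℝ), fun z hz => ?_, ?_⟩
  · rw [hQ, mem_convexHull_add_hull_iff] at hz
    obtain ⟨a, b, ha, hb, ha1, rfl⟩ := hz
    set u := U.comp (LinearMap.inl ℝ E ℝ) with hu
    have h1 : ∀ j ∈ V, u (f i) ≤ u (f j) := fun j hj => hmin j hj
    have h2 : 0 ≤ ∑ j ∈ W, b j * u (g j) :=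
      Finset.sum_nonneg fun j hj => mul_nonneg (hb j) (hU2 j hj)
    have h3 : u (f i) ≤ ∑ j ∈ V, a j * u (f j) := by
      calc u (f i) = ∑ j ∈ V, a j * u (f i) := by rw [← Finset.sum_mul, ha1, one_mul]
        _ ≤ _ := Finset.sum_le_sum fun j hj => mul_le_mul_of_nonneg_left (h1 j hj) (ha j)
    simp only [map_add, map_sum, map_smul, smul_eq_mul]
    linarith
  · have h1 := hU1 i hi
    change U (x, 0) < U (f i, 0)
    rw [hU] at h1 hU3
    linarith

/-- The tangent cone of a polyhedron at a point is dual to the normal cone. -/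
theorem exists_add_smul_mem [FiniteDimensional ℝ E]
    (hQ : Q = convexHull ℝ (f '' V) + (PointedCone.hull ℝ (g '' W) : Set E)) {x q : E} (hx : x ∈ Q)
    (hq : ∀ u : Module.Dual ℝ E, (∀ z ∈ Q, u x ≤ u z) → 0 ≤ u q) :
    ∃ ε : ℝ, 0 < ε ∧ ∀ t, 0 ≤ t → t ≤ ε → x + t • q ∈ Q := by
  by_cases hmem : q ∈ PointedCone.hull ℝ ((fun i => f i - x) '' V ∪ g '' W)
  · -- Mix `(1 - t s)` times the representation of `x` with `t` times that of `q`.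
    obtain ⟨a, b, ha, hb, rfl⟩ := (mem_hull_image_union_iff _ _ _ _ _).1 hmem
    rw [hQ, mem_convexHull_add_hull_iff] at hx
    obtain ⟨a₀, b₀, ha₀, hb₀, ha1, hx⟩ := hx
    set s := ∑ i ∈ V, a i with hs
    have hs0 : 0 ≤ s := Finset.sum_nonneg fun i _ => ha i
    refine ⟨(s + 1)⁻¹, by positivity, fun t ht0 ht => ?_⟩
    have hts : t * s ≤ 1 := by
      calc t * s ≤ (s + 1)⁻¹ * (s + 1) := by gcongr; linarith
        _ = 1 := inv_mul_cancel₀ (by positivity)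
    rw [hQ, mem_convexHull_add_hull_iff]
    refine ⟨fun i => (1 - t * s) * a₀ i + t * a i, fun i => (1 - t * s) * b₀ i + t * b i,
      fun i => add_nonneg (mul_nonneg (by linarith) (ha₀ i)) (mul_nonneg ht0 (ha i)),
      fun i => add_nonneg (mul_nonneg (by linarith) (hb₀ i)) (mul_nonneg ht0 (hb i)), ?_, ?_⟩
    · rw [Finset.sum_add_distrib, ← Finset.mul_sum, ← Finset.mul_sum, ha1, ← hs]
      ring
    · simp only [add_smul, mul_smul, smul_sub, Finset.sum_add_distrib, ← Finset.smul_sum,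
        Finset.sum_sub_distrib, ← Finset.sum_smul, smul_add]
      rw [← hs]
      have : ∑ i ∈ V, a₀ i • f i = x - ∑ i ∈ W, b₀ i • g i := by rw [← hx]; abel
      rw [this]
      module
  · -- Otherwise Farkas' lemma gives a form in the normal cone at `x` that is negative at `q`.
    obtain ⟨u, h1, h2, h3⟩ := exists_dual_neg_of_notMem_hull_union hmem
    refine absurd (hq u fun z hz => ?_) (not_le.2 h3)
    rw [hQ, mem_convexHull_add_hull_iff] at hz
    obtain ⟨a, b, ha, hb, ha1, rfl⟩ := hz
    have h4 : 0 ≤ ∑ j ∈ W, b j * u (g j) :=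
      Finset.sum_nonneg fun j hj => mul_nonneg (hb j) (h2 j hj)
    have h5 : u x ≤ ∑ j ∈ V, a j * u (f j) := by
      calc u x = ∑ j ∈ V, a j * u x := by rw [← Finset.sum_mul, ha1, one_mul]
        _ ≤ _ := Finset.sum_le_sum fun j hj => mul_le_mul_of_nonneg_left
          (by simpa [map_sub] using h1 j hj) (ha j)
    simp only [map_add, map_sum, map_smul, smul_eq_mul]
    linarith

theorem convex_of_eq (hQ : Q = convexHull ℝ (f '' V) + (PointedCone.hull ℝ (g '' W) : Set E)) :
    Convex ℝ Q := by
  rw [hQ]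
  exact (convex_convexHull ℝ _).add (PointedCone.convex _)

end Polyhedra

end ToricGIT

/-! ### Lattice points and rational points -/

namespace ToricGIT

section Lattice

variable {M MG : Type} [AddCommGroup M] [AddCommGroup MG]

theorem pt_add (a b : M) : pt (a + b) = pt a + pt b := TensorProduct.tmul_add _ _ _

theorem pt_zero : pt (0 : M) = 0 := TensorProduct.tmul_zero _ _

theorem pt_sub (a b : M) : pt (a - b) = pt a - pt b := TensorProduct.tmul_sub _ _ _

theorem pt_neg (a : M) : pt (-a) = -pt a := TensorProduct.tmul_neg _ _

/-- The inclusion of the lattice in the real vector space it spans. -/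
def ptHom (M : Type) [AddCommGroup M] : M →+ MR M where
  toFun := pt
  map_zero' := pt_zero
  map_add' := pt_add

theorem pt_zsmul (n : ℤ) (a : M) : pt (n • a) = (n : ℝ) • pt a := by
  rw [Int.cast_smul_eq_zsmul]
  exact map_zsmul (ptHom M) n a

theorem pt_nsmul (n : ℕ) (a : M) : pt (n • a) = (n : ℝ) • pt a := by
  rw [Nat.cast_smul_eq_nsmul]
  exact map_nsmul (ptHom M) n a

theorem pt_sum {ι : Type*} (T : Finset ι) (f : ι → M) : pt (∑ i ∈ T, f i) = ∑ i ∈ T, pt (f i) :=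
  map_sum (ptHom M) f T

theorem smul_pt (r : ℝ) (m : M) : r • pt m = r ⊗ₜ[ℤ] m := by
  rw [pt, TensorProduct.smul_tmul', smul_eq_mul, mul_one]

theorem pt_injective [Module.Free ℤ M] : Function.Injective (pt : M → MR M) := by
  refine (injective_iff_map_eq_zero (ptHom M)).2 fun m hm => ?_
  have hflat : Function.Injective ((Int.castAddHom ℝ).toIntLinearMap.rTensor M) :=
    Module.Flat.rTensor_preserves_injective_linearMap _ Int.cast_injective
  have h : (Int.castAddHom ℝ).toIntLinearMap.rTensor M ((1 : ℤ) ⊗ₜ[ℤ] m) = 0 := by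
    rw [LinearMap.rTensor_tmul]
    simpa [ptHom, pt] using hm
  have := (map_eq_zero_iff _ hflat).1 h
  simpa using congrArg (TensorProduct.lid ℤ M) this

theorem dualPt_pt (u : Module.Dual ℤ M) (m : M) : dualPt u (pt m) = (u m : ℝ) := by
  simp [dualPt, pt]

theorem baseChange_pt (α : M →ₗ[ℤ] MG) (m : M) : α.baseChange ℝ (pt m) = pt (α m) := by
  simp [pt]

theorem kerInclusion_pt (α : M →ₗ[ℤ] MG) (m : LinearMap.ker α) :
    kerInclusion α (pt m) = pt (m : M) := by
  simp [kerInclusion, pt]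

theorem kerInclusion_injective [Module.Free ℤ M] (α : M →ₗ[ℤ] MG) :
    Function.Injective (kerInclusion α) := by
  have : Function.Injective ((LinearMap.ker α).subtype.lTensor ℝ) :=
    Module.Flat.lTensor_preserves_injective_linearMap _ Subtype.val_injective
  exact this

theorem exists_kerInclusion_eq (α : M →ₗ[ℤ] MG) (hα : Function.Surjective α) {x : MR M}
    (hx : α.baseChange ℝ x = 0) : ∃ y, kerInclusion α y = x := by
  have h : Function.Exact ((LinearMap.ker α).subtype.lTensor ℝ) (α.lTensor ℝ) :=
    lTensor_exact ℝ (LinearMap.exact_subtype_ker_map α) hα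
  exact (h x).1 hx

theorem baseChange_kerInclusion (α : M →ₗ[ℤ] MG) (y : MR (LinearMap.ker α)) :
    α.baseChange ℝ (kerInclusion α y) = 0 := by
  induction y using TensorProduct.induction_on with
  | zero => simp
  | tmul r m => simp [kerInclusion]
  | add a b ha hb => rw [map_add, map_add, ha, hb, add_zero]

theorem ratToReal_tmul (q : ℚ) (m : M) : ratToReal M (q ⊗ₜ m) = (q : ℝ) • pt m := by
  rw [smul_pt]
  exact LinearMap.rTensor_tmul _ _ _ _

theorem baseChange_ratToReal (α : M →ₗ[ℤ] MG) (x : ℚ ⊗[ℤ] M) :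
    α.baseChange ℝ (ratToReal M x) = ratToReal MG (α.lTensor ℚ x) := by
  induction x using TensorProduct.induction_on with
  | zero => simp
  | tmul q m => simp [ratToReal_tmul, baseChange_pt]
  | add a b ha hb => simp only [map_add, ha, hb]

/-- Every point of `M ⊗ ℚ` has a common denominator. -/
theorem exists_eq_inv_tmul (x : ℚ ⊗[ℤ] M) : ∃ (d : ℕ+) (m : M), x = (1 / (d : ℚ)) ⊗ₜ[ℤ] m := by
  induction x using TensorProduct.induction_on with
  | zero => exact ⟨1, 0, by simp⟩
  | tmul q m =>
    refine ⟨⟨q.den, q.den_pos⟩, q.num • m, ?_⟩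
    rw [← TensorProduct.smul_tmul]
    congr 1
    rw [zsmul_eq_mul, PNat.mk_coe]
    conv_lhs => rw [← Rat.num_div_den q]
    ring
  | add x y hx hy =>
    obtain ⟨d, m, rfl⟩ := hx
    obtain ⟨e, n, rfl⟩ := hy
    refine ⟨d * e, (e : ℕ) • m + (d : ℕ) • n, ?_⟩
    have hd : (d : ℚ) ≠ 0 := by exact_mod_cast d.ne_zero
    have he : (e : ℚ) ≠ 0 := by exact_mod_cast e.ne_zero
    rw [TensorProduct.tmul_add, ← TensorProduct.smul_tmul, ← TensorProduct.smul_tmul]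
    congr 2
    · rw [nsmul_eq_mul, PNat.mul_coe]
      push_cast
      field_simp
    · rw [nsmul_eq_mul, PNat.mul_coe]
      push_cast
      field_simp

theorem inv_tmul_eq_iff [Module.Free ℤ M] (d e : ℕ+) (m n : M) :
    (1 / (d : ℚ)) ⊗ₜ[ℤ] m = (1 / (e : ℚ)) ⊗ₜ[ℤ] n ↔ (e : ℕ) • m = (d : ℕ) • n := by
  have hd : (d : ℚ) ≠ 0 := by exact_mod_cast d.ne_zero
  have he : (e : ℚ) ≠ 0 := by exact_mod_cast e.ne_zero
  have key : ∀ (d e : ℕ+) (m : M),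
      (1 / (d : ℚ)) ⊗ₜ[ℤ] m = (1 / ((d * e : ℕ+) : ℚ)) ⊗ₜ[ℤ] ((e : ℕ) • m) := by
    intro d e m
    have hd : (d : ℚ) ≠ 0 := by exact_mod_cast d.ne_zero
    have he : (e : ℚ) ≠ 0 := by exact_mod_cast e.ne_zero
    rw [← TensorProduct.smul_tmul]
    congr 1
    rw [nsmul_eq_mul, PNat.mul_coe]
    push_cast
    field_simp
  constructor
  · intro h
    have h' := congrArg (ratToReal M) h
    simp only [ratToReal_tmul] at h'
    apply pt_injective
    rw [pt_nsmul, pt_nsmul]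
    have hd' : (d : ℝ) ≠ 0 := by exact_mod_cast d.ne_zero
    have he' : (e : ℝ) ≠ 0 := by exact_mod_cast e.ne_zero
    have h2 := congrArg (fun z => ((d : ℝ) * e) • z) h'
    simp only [smul_smul] at h2
    push_cast at h2
    have e1 : (d : ℝ) * e * (1 / d) = e := by field_simp
    have e2 : (d : ℝ) * e * (1 / e) = d := by field_simp
    rwa [e1, e2] at h2
  · intro h
    rw [key d e m, key e d n, h, mul_comm]

end Lattice

end ToricGIT

/-! ### The polyhedra of the quotient problem -/

namespace ToricGIT

section RationalPolyhedra

variable {M MG : Type} [AddCommGroup M] [AddCommGroup MG]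

/-- `M_ℝ` is itself a finitely generated rational cone. -/
theorem exists_finset_hull_eq_top [Module.Finite ℤ M] :
    ∃ G : Finset (MR M), (∀ x ∈ G, x ∈ (ptHom M).range) ∧
      ∀ x, x ∈ PointedCone.hull ℝ (G : Set (MR M)) := by
  classical
  obtain ⟨B, hB⟩ := Module.Finite.fg_top (R := ℤ) (M := M)
  refine ⟨B.image pt ∪ B.image (fun m => -pt m), ?_, fun x => ?_⟩
  · intro x hx
    rcases Finset.mem_union.1 hx with hx | hx
    · obtain ⟨m, -, rfl⟩ := Finset.mem_image.1 hx
      exact ⟨m, rfl⟩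
    · obtain ⟨m, -, rfl⟩ := Finset.mem_image.1 hx
      exact ⟨-m, pt_neg m⟩
  · set C := PointedCone.hull ℝ
      ((B.image pt ∪ B.image (fun m => -pt m) : Finset (MR M)) : Set (MR M)) with hC
    have hM : ∀ m : M, pt m ∈ C ∧ -pt m ∈ C := by
      intro m
      have hm : m ∈ Submodule.span ℤ (B : Set M) := by rw [hB]; trivial
      induction hm using Submodule.span_induction with
      | mem m hm =>
        have hm : m ∈ B := hm
        refine ⟨PointedCone.subset_hull ?_, PointedCone.subset_hull ?_⟩
        · exact Finset.mem_coe.2 (Finset.mem_union_left _ (Finset.mem_image_of_mem _ hm))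
        · exact Finset.mem_coe.2 (Finset.mem_union_right _
            (Finset.mem_image_of_mem (fun m : M => -pt m) hm))
      | zero => simp [pt_zero]
      | add a b _ _ ha hb =>
        rw [pt_add, neg_add]
        exact ⟨add_mem ha.1 hb.1, add_mem ha.2 hb.2⟩
      | smul n a _ ha =>
        rw [pt_zsmul]
        rcases le_total 0 (n : ℝ) with h | h
        · rw [← smul_neg]
          exact ⟨PointedCone.smul_mem _ h ha.1, PointedCone.smul_mem _ h ha.2⟩
        · have h' : (0 : ℝ) ≤ -n := by linarith
          rw [← neg_smul, ← neg_smul_neg]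
          exact ⟨PointedCone.smul_mem _ h' ha.2, PointedCone.smul_mem _ h' ha.1⟩
    induction x using TensorProduct.induction_on with
    | zero => exact zero_mem _
    | tmul r m =>
      rw [← smul_pt]
      rcases le_total 0 r with h | h
      · exact PointedCone.smul_mem _ h (hM m).1
      · rw [← neg_smul_neg]
        exact PointedCone.smul_mem _ (neg_nonneg.2 h) (hM m).2
    | add a b ha hb => exact add_mem ha hb

theorem mem_dualCone_hull_iff {S : Set (Module.Dual ℤ M)} {x : MR M} :
    x ∈ dualCone (PointedCone.hull ℝ (dualPt '' S)) ↔ ∀ u ∈ S, 0 ≤ dualPt u x := by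
  rw [dualCone, PointedCone.dual_hull, PointedCone.mem_dual]
  simp

/-- The dual of a rational polyhedral cone is spanned by finitely many lattice points. -/
theorem exists_dualCone_eq_hull [Module.Finite ℤ M] {σ : PointedCone ℝ (NR M)}
    (hσ : IsRationalCone σ) :
    ∃ S : Finset M, dualCone σ = PointedCone.hull ℝ (pt '' (S : Set M)) := by
  classical
  obtain ⟨U, hU, rfl⟩ := hσ
  obtain ⟨G, hG1, hG2⟩ := exists_finset_hull_eq_top (M := M)
  obtain ⟨S, hS1, hS2⟩ := exists_hull_eq_inf_halfSpaces (ptHom M).range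
    (hU.toFinset.image dualPt) (by
      intro h hh
      obtain ⟨u, -, rfl⟩ := Finset.mem_image.1 hh
      rintro _ ⟨m, rfl⟩
      exact ⟨u m, dualPt_pt u m⟩) G hG1
  obtain ⟨T, -, rfl⟩ := (Finset.subset_set_image_iff (s := Set.univ) (f := (pt : M → MR M))).1
    (fun x hx => by
      obtain ⟨m, rfl⟩ := hS1 x hx
      exact ⟨m, trivial, rfl⟩)
  refine ⟨T, SetLike.ext fun x => ?_⟩
  rw [mem_dualCone_hull_iff, ← Finset.coe_image, hS2]
  simp [hG2]

theorem polyhedron_eq [Module.Finite ℤ M] {σ : PointedCone ℝ (NR M)} (hσ : IsRationalCone σ)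
    {s : ℕ} (m' : Fin s → M) :
    ∃ (V S : Finset M), (V : Set M) = insert 0 (Set.range m') ∧
      dualCone σ = PointedCone.hull ℝ (pt '' (S : Set M)) ∧
      polyhedron σ m' =
        convexHull ℝ (pt '' (V : Set M)) +
          (PointedCone.hull ℝ (pt '' (S : Set M)) : Set (MR M)) := by
  classical
  obtain ⟨S, hS⟩ := exists_dualCone_eq_hull hσ
  refine ⟨insert 0 (Finset.univ.image m'), S, by simp, hS, ?_⟩
  rw [polyhedron, hS]
  congr 2
  rw [Finset.coe_insert, Finset.coe_image, Finset.coe_univ, Set.image_univ, Set.image_insert_eq,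
    pt_zero, ← Set.range_comp]
  rfl

theorem zero_mem_polyhedron (σ : PointedCone ℝ (NR M)) {s : ℕ} (m' : Fin s → M) :
    (0 : MR M) ∈ polyhedron σ m' :=
  ⟨0, subset_convexHull ℝ _ (Set.mem_insert 0 _), 0, zero_mem _, add_zero 0⟩

theorem mem_kerSlice_iff {α : M →ₗ[ℤ] MG} {P : Set (MR M)} {b : ℚ ⊗[ℤ] MG} {x₀ : ℚ ⊗[ℤ] M}
    (hx₀ : α.lTensor ℚ x₀ = -b) (y : MR (LinearMap.ker α)) :
    y ∈ kerSlice α P b x₀ ↔ kerInclusion α y + ratToReal M x₀ ∈ P := by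
  simp [kerSlice, slice, baseChange_kerInclusion, baseChange_ratToReal, hx₀]

theorem bijOn_kerSlice [Module.Free ℤ M] {α : M →ₗ[ℤ] MG} (hα : Function.Surjective α)
    (P : Set (MR M)) {b : ℚ ⊗[ℤ] MG} {x₀ : ℚ ⊗[ℤ] M} (hx₀ : α.lTensor ℚ x₀ = -b) :
    Set.BijOn (fun y => kerInclusion α y + ratToReal M x₀) (kerSlice α P b x₀) (slice α P b) := by
  refine ⟨fun y hy => hy, fun y _ z _ h => ?_, fun x hx => ?_⟩
  · exact kerInclusion_injective α (add_right_cancel h)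
  · obtain ⟨y, hy⟩ := exists_kerInclusion_eq α hα (x := x - ratToReal M x₀) (by
      have : α.baseChange ℝ x = -ratToReal MG b := hx.2
      rw [map_sub, this, baseChange_ratToReal, hx₀, map_neg, sub_self])
    have e : kerInclusion α y + ratToReal M x₀ = x := by rw [hy, sub_add_cancel]
    refine ⟨y, ?_, e⟩
    change kerInclusion α y + ratToReal M x₀ ∈ slice α P b
    rwa [e]

end RationalPolyhedra

end ToricGIT

/-! ### Fractional lattice polyhedra -/

namespace ToricGIT

section FractionalPolyhedra

variable {M MG : Type} [AddCommGroup M] [AddCommGroup MG]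

theorem exists_common_multiple {ι : Type*} (G : Finset ι) (n : ι → ℤ) (hn : ∀ g ∈ G, 0 < n g) :
    ∃ (D : ℕ) (e : ι → ℕ), 0 < D ∧ ∀ g ∈ G, (e g : ℝ) * n g = D := by
  classical
  refine ⟨∏ g ∈ G, (n g).toNat, fun g => (∏ g ∈ G, (n g).toNat) / (n g).toNat,
    Finset.prod_pos fun g hg => by have := hn g hg; omega, fun g hg => ?_⟩
  have h1 : ((n g).toNat : ℤ) = n g := Int.toNat_of_nonneg (hn g hg).le
  have h2 : (n g : ℝ) = ((n g).toNat : ℝ) := by exact_mod_cast h1.symm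
  rw [h2]
  exact_mod_cast Nat.div_mul_cancel (Finset.dvd_prod_of_mem (fun g => (n g).toNat) hg)

/-- The slice of the polyhedron by a rational affine subspace is a fractional lattice polyhedron.
The cone over the polyhedron is cut by the rational hyperplanes `⟨β, α(x) - t α(m₀)⟩ = 0`, where
`m₀ = d x₀` and `β` runs over the coordinates of `M_G`; the generators `(m, t)` of the result yield
the vertices (`t > 0`) and the rays (`t = 0`) of a multiple of the slice. -/
theorem isFractionalLatticePolyhedron_kerSlice [Module.Free ℤ M] [Module.Finite ℤ M]
    [Module.Free ℤ MG] [Module.Finite ℤ MG] {α : M →ₗ[ℤ] MG}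
    {σ : PointedCone ℝ (NR M)} (hσ : IsRationalCone σ)
    (hσ' : (dualCone σ : ConvexCone ℝ (MR M)).Salient) {s : ℕ} (m' : Fin s → M)
    {b : ℚ ⊗[ℤ] MG} {x₀ : ℚ ⊗[ℤ] M} (hx₀ : α.lTensor ℚ x₀ = -b) :
    IsFractionalLatticePolyhedron (kerSlice α (polyhedron σ m') b x₀) := by
  classical
  obtain ⟨V, S, -, hS, hP⟩ := polyhedron_eq hσ m'
  obtain ⟨d, m₀, rfl⟩ := exists_eq_inv_tmul x₀
  have hd : (0 : ℝ) < d := by exact_mod_cast d.pos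
  -- Scaling by `d` turns the translation by `x₀` into the translation by the lattice point `m₀`.
  set T : Set (MR M × ℝ) :=
    (fun v : M => ((d : ℝ) • pt v, (1 : ℝ))) '' V ∪ (fun r : M => (pt r, (0 : ℝ))) '' S with hT
  have hTchar : ∀ (x : MR M) (t : ℝ), (x, t) ∈ PointedCone.hull ℝ T ↔ ∃ a b : M → ℝ,
      (∀ i, 0 ≤ a i) ∧ (∀ i, 0 ≤ b i) ∧ ∑ v ∈ V, a v = t ∧
        ∑ v ∈ V, a v • (d : ℝ) • pt v + ∑ r ∈ S, b r • pt r = x := by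
    intro x t
    rw [hT, mem_hull_image_union_iff]
    refine exists_congr fun a => exists_congr fun b => and_congr_right fun _ =>
      and_congr_right fun _ => ?_
    rw [Prod.ext_iff, and_comm]
    simp [Prod.fst_sum, Prod.snd_sum]
  have hTP : ∀ x : MR M, x ∈ polyhedron σ m' ↔ ((d : ℝ) • x, (1 : ℝ)) ∈ PointedCone.hull ℝ T := by
    intro x
    rw [hTchar, hP, mem_convexHull_add_hull_iff]
    constructor
    · rintro ⟨a, b, ha, hb, ha1, rfl⟩
      refine ⟨a, fun i => d * b i, ha, fun i => mul_nonneg hd.le (hb i), ha1, ?_⟩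
      simp only [smul_add, Finset.smul_sum, smul_smul]
      simp only [mul_comm]
    · rintro ⟨a, b, ha, hb, ha1, h⟩
      refine ⟨a, fun i => (d : ℝ)⁻¹ * b i, ha, fun i => mul_nonneg (inv_nonneg.2 hd.le) (hb i),
        ha1, ?_⟩
      rw [← inv_smul_smul₀ hd.ne' x, ← h]
      simp only [smul_add, Finset.smul_sum, smul_smul]
      congr 1
      refine Finset.sum_congr rfl fun i _ => ?_
      congr 1
      field_simp
  set Λ : AddSubgroup (MR M × ℝ) := ((ptHom M).prodMap (Int.castAddHom ℝ)).range with hΛ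
  let β := Module.Free.chooseBasis ℤ MG
  -- The equations of the slice, homogenized.
  let h : Module.Free.ChooseBasisIndex ℤ MG → (MR M × ℝ) →ₗ[ℝ] ℝ := fun i =>
    (dualPt (β.coord i) ∘ₗ α.baseChange ℝ) ∘ₗ LinearMap.fst ℝ (MR M) ℝ -
      ((β.coord i (α m₀) : ℤ) : ℝ) • LinearMap.snd ℝ (MR M) ℝ
  have hpt : ∀ i (m : M) (n : ℤ),
      h i (pt m, (n : ℝ)) = ((β.coord i (α m - n • α m₀) : ℤ) : ℝ) := by
    intro i m n
    simp only [h, LinearMap.sub_apply, LinearMap.comp_apply, LinearMap.fst_apply, baseChange_pt,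
      dualPt_pt, LinearMap.smul_apply, LinearMap.snd_apply, map_sub, map_smul]
    push_cast
    simp [mul_comm]
  obtain ⟨S', hS'1, hS'2⟩ := exists_hull_eq_inf_halfSpaces Λ
    (Finset.univ.image h ∪ Finset.univ.image fun i => -h i) (by
      intro f hf
      rintro _ ⟨⟨m, n⟩, rfl⟩
      have e : (ptHom M).prodMap (Int.castAddHom ℝ) (m, n) = (pt m, (n : ℝ)) := rfl
      rw [e]
      rcases Finset.mem_union.1 hf with hf | hf
      · obtain ⟨i, -, rfl⟩ := Finset.mem_image.1 hf
        exact ⟨_, hpt i m n⟩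
      · obtain ⟨i, -, rfl⟩ := Finset.mem_image.1 hf
        exact ⟨-_, by rw [LinearMap.neg_apply, hpt i m n, Int.cast_neg]⟩)
    (V.image (fun v : M => ((d : ℝ) • pt v, (1 : ℝ))) ∪ S.image (fun r : M => (pt r, (0 : ℝ)))) (by
      intro x hx
      rcases Finset.mem_union.1 hx with hx | hx
      · obtain ⟨v, -, rfl⟩ := Finset.mem_image.1 hx
        refine ⟨((d : ℕ) • v, 1), ?_⟩
        change (pt ((d : ℕ) • v), ((1 : ℤ) : ℝ)) = _
        rw [pt_nsmul, Int.cast_one]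
      · obtain ⟨r, -, rfl⟩ := Finset.mem_image.1 hx
        refine ⟨(r, 0), ?_⟩
        change (pt r, ((0 : ℤ) : ℝ)) = _
        rw [Int.cast_zero])
  replace hS'2 : ∀ x, x ∈ PointedCone.hull ℝ (S' : Set (MR M × ℝ)) ↔
      x ∈ PointedCone.hull ℝ T ∧ ∀ i, h i x = 0 := by
    intro x
    rw [hS'2, hT, Finset.coe_union, Finset.coe_image, Finset.coe_image]
    refine and_congr_right fun _ => ⟨fun hx i => ?_, fun hx f hf => ?_⟩
    · have h1 := hx (h i) (by simp)
      have h2 := hx (-h i) (by simp)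
      rw [LinearMap.neg_apply] at h2
      linarith
    · rcases Finset.mem_union.1 hf with hf | hf
      · obtain ⟨i, -, rfl⟩ := Finset.mem_image.1 hf
        exact (hx i).ge
      · obtain ⟨i, -, rfl⟩ := Finset.mem_image.1 hf
        rw [LinearMap.neg_apply, hx i, neg_zero]
  obtain ⟨G, -, rfl⟩ := (Finset.subset_set_image_iff (s := Set.univ)
    (f := fun g : M × ℤ => (pt g.1, (g.2 : ℝ)))).1 (fun x hx => by
      obtain ⟨g, rfl⟩ := hS'1 x hx
      exact ⟨g, trivial, rfl⟩)
  have hG : ∀ g ∈ G, (pt g.1, (g.2 : ℝ)) ∈ PointedCone.hull ℝ T ∧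
      ∀ i, h i (pt g.1, (g.2 : ℝ)) = 0 := fun g hg =>
    (hS'2 _).1 (PointedCone.subset_hull (Finset.mem_coe.2 (Finset.mem_image_of_mem _ hg)))
  have hG0 : ∀ g ∈ G, 0 ≤ g.2 := fun g hg => by
    obtain ⟨a, b, ha, -, hab, -⟩ := (hTchar _ _).1 (hG g hg).1
    have : (0 : ℝ) ≤ g.2 := hab ▸ Finset.sum_nonneg fun v _ => ha v
    exact_mod_cast this
  have hGα : ∀ g ∈ G, g.1 - g.2 • m₀ ∈ LinearMap.ker α := fun g hg => by
    rw [LinearMap.mem_ker, map_sub, map_smul]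
    refine β.ext_elem fun i => ?_
    have := (hG g hg).2 i
    rw [hpt, Int.cast_eq_zero] at this
    simpa using this
  -- A generator `(m, t)` of the cone over the slice gives the lattice point `m - t m₀` of `Ker α`.
  let κ : M × ℤ → LinearMap.ker α := fun g =>
    if hg : g.1 - g.2 • m₀ ∈ LinearMap.ker α then ⟨g.1 - g.2 • m₀, hg⟩ else 0
  have hκ : ∀ g ∈ G, kerInclusion α (pt (κ g)) = pt g.1 - (g.2 : ℝ) • pt m₀ := fun g hg => by
    rw [kerInclusion_pt, ← pt_zsmul, ← pt_sub]
    simp only [κ]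
    rw [dif_pos (hGα g hg)]
  -- The generators at height `t > 0` stand for the points `(m - t m₀) / t` of `d` times the slice;
  -- multiplication by the common multiple `D` of the heights makes them lattice points.
  obtain ⟨D, e, hD, he⟩ := exists_common_multiple (G.filter fun g => 0 < g.2) (fun g => g.2)
    fun g hg => (Finset.mem_filter.1 hg).2
  have hD' : (0 : ℝ) < D := Nat.cast_pos.2 hD
  have hG' : ∀ F : M × ℤ → MR M, ∑ g ∈ G, F g =
      ∑ g ∈ G with 0 < g.2, F g + ∑ g ∈ G with ¬ 0 < g.2, F g := fun F =>
    (Finset.sum_filter_add_sum_filter_not G _ F).symm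
  have hneg : ∀ g ∈ G.filter (fun g => ¬ 0 < g.2), g.2 = 0 := fun g hg => by
    obtain ⟨h1, h2⟩ := Finset.mem_filter.1 hg
    have := hG0 g h1
    omega
  have hx₀' : ratToReal M ((1 / (d : ℚ)) ⊗ₜ[ℤ] m₀) = (d : ℝ)⁻¹ • pt m₀ := by
    rw [ratToReal_tmul]
    norm_num
  refine ⟨D * d, Nat.mul_pos hD d.pos,
    ((G.filter fun g => 0 < g.2).image fun g => e g • κ g : Finset (LinearMap.ker α)),
    ((G.filter fun g => ¬ 0 < g.2).image κ : Finset (LinearMap.ker α)),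
    Finset.finite_toSet _, Finset.finite_toSet _, ?_, ?_⟩
  · -- The rays lie in the strongly convex cone `σ^∨`.
    have hle : ∀ y ∈ PointedCone.hull ℝ
        (pt '' (((G.filter fun g => ¬ 0 < g.2).image κ : Finset (LinearMap.ker α)) :
          Set (LinearMap.ker α))), kerInclusion α y ∈ dualCone σ := by
      intro y hy
      have : PointedCone.hull ℝ (pt '' (((G.filter fun g => ¬ 0 < g.2).image κ :
          Finset (LinearMap.ker α)) : Set (LinearMap.ker α))) ≤
          (dualCone σ).comap (kerInclusion α) := by
        refine Submodule.span_le.2 ?_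
        rintro _ ⟨x, hx, rfl⟩
        obtain ⟨g, hg, rfl⟩ := Finset.mem_image.1 (Finset.mem_coe.1 hx)
        have hgG := (Finset.mem_filter.1 hg).1
        change kerInclusion α (pt (κ g)) ∈ dualCone σ
        obtain ⟨a, b, ha, hb, hab, hg'⟩ := (hTchar _ _).1 (hG g hgG).1
        rw [hneg g hg, Int.cast_zero] at hab
        have ha0 := (Finset.sum_eq_zero_iff_of_nonneg fun v _ => ha v).1 hab
        rw [hκ g hgG, hneg g hg, Int.cast_zero, zero_smul, sub_zero, ← hg', hS,
          Finset.sum_eq_zero fun v hv => by rw [ha0 v hv, zero_smul], zero_add]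
        exact (mem_hull_image_iff S pt _).2 ⟨b, hb, rfl⟩
      exact this hy
    intro y hy hy0 hy'
    refine hσ' (kerInclusion α y) (hle y hy) ?_ ?_
    · exact fun h0 => hy0 (kerInclusion_injective α (h0.trans (map_zero _).symm))
    · rw [← map_neg]
      exact hle _ hy'
  · -- A point `y` of `D d` times the slice is the point `(y / D + m₀, 1)` of the cone over it.
    have hDd : ((D * (d : ℕ) : ℕ) : ℝ) ≠ 0 := by
      push_cast
      positivity
    ext y
    rw [Set.mem_smul_set_iff_inv_smul_mem₀ hDd, mem_kerSlice_iff hx₀, hTP, hx₀']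
    have e1 : (d : ℝ) • (kerInclusion α (((D * (d : ℕ) : ℕ) : ℝ)⁻¹ • y) + (d : ℝ)⁻¹ • pt m₀) =
        (D : ℝ)⁻¹ • kerInclusion α y + pt m₀ := by
      rw [map_smul, smul_add, smul_smul, smul_smul, mul_inv_cancel₀ hd.ne', one_smul]
      congr 2
      push_cast
      field_simp
    have e2 : ∀ i, h i ((D : ℝ)⁻¹ • kerInclusion α y + pt m₀, 1) = 0 := by
      intro i
      simp [h, baseChange_kerInclusion, baseChange_pt, dualPt_pt]
    have e3 := hS'2 ((D : ℝ)⁻¹ • kerInclusion α y + pt m₀, 1)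
    rw [e1, ← and_iff_left (a := _ ∈ PointedCone.hull ℝ T) e2, ← e3, Finset.coe_image,
      mem_hull_image_iff, Finset.coe_image, Finset.coe_image, Set.image_image, Set.image_image,
      mem_convexHull_add_hull_iff]
    constructor
    · rintro ⟨c, hc, hcy⟩
      have hc1 : ∑ g ∈ G, c g • pt g.1 = (D : ℝ)⁻¹ • kerInclusion α y + pt m₀ := by
        simpa [Prod.fst_sum] using congrArg Prod.fst hcy
      have hc2 : ∑ g ∈ G, c g * g.2 = 1 := by
        simpa [Prod.snd_sum] using congrArg Prod.snd hcy
      refine ⟨fun g => if 0 < g.2 then c g * g.2 else 0, fun g => D * c g, fun g => ?_,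
        fun g => mul_nonneg hD'.le (hc g), ?_, kerInclusion_injective α ?_⟩
      · dsimp only
        split_ifs with hg
        · exact mul_nonneg (hc g) (by exact_mod_cast hg.le)
        · exact le_rfl
      · rw [← hc2, Finset.sum_filter]
        refine Finset.sum_congr rfl fun g hg => ?_
        by_cases h0 : 0 < g.2
        · simp [h0]
        · have : g.2 = 0 := hneg g (Finset.mem_filter.2 ⟨hg, h0⟩)
          simp [this]
      · have hsum : ∑ g ∈ G, (D * c g) • (pt g.1 - (g.2 : ℝ) • pt m₀) = kerInclusion α y := by
          simp only [smul_sub, Finset.sum_sub_distrib, mul_smul, ← Finset.smul_sum, hc1]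
          simp only [smul_smul, ← Finset.sum_smul]
          rw [smul_add, smul_smul, mul_inv_cancel₀ hD'.ne', one_smul, hc2, mul_one,
            add_sub_cancel_right]
        rw [← hsum, hG', map_add, map_sum, map_sum]
        congr 1
        · refine Finset.sum_congr rfl fun g hg => ?_
          dsimp only
          rw [if_pos (Finset.mem_filter.1 hg).2, map_smul, pt_nsmul, map_smul,
            hκ g (Finset.mem_filter.1 hg).1, smul_smul, ← he g hg]
          congr 1
          ring
        · refine Finset.sum_congr rfl fun g hg => ?_
          rw [map_smul, hκ g (Finset.mem_filter.1 hg).1]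
    · rintro ⟨a, b, ha, hb, ha1, rfl⟩
      refine ⟨fun g => if 0 < g.2 then a g / g.2 else b g / D, fun g => ?_, ?_⟩
      · dsimp only
        split_ifs with hg
        · exact div_nonneg (ha g) (by exact_mod_cast hg.le)
        · exact div_nonneg (hb g) hD'.le
      · have hn : ∑ g ∈ G, (if 0 < g.2 then a g / g.2 else b g / D) * (g.2 : ℝ) = 1 := by
          rw [← ha1, Finset.sum_filter]
          refine Finset.sum_congr rfl fun g hg => ?_
          by_cases h0 : 0 < g.2
          · have : (g.2 : ℝ) ≠ 0 := by exact_mod_cast h0.ne'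
            simp [h0, this]
          · have : g.2 = 0 := hneg g (Finset.mem_filter.2 ⟨hg, h0⟩)
            simp [this]
        have hm : ∑ g ∈ G, (if 0 < g.2 then a g / g.2 else b g / D) •
            (pt g.1 - (g.2 : ℝ) • pt m₀) = (D : ℝ)⁻¹ • kerInclusion α
            (∑ g ∈ G with 0 < g.2, a g • pt (e g • κ g) +
              ∑ g ∈ G with ¬ 0 < g.2, b g • pt (κ g)) := by
          rw [hG', map_add, map_sum, map_sum, smul_add, Finset.smul_sum, Finset.smul_sum]
          congr 1
          · refine Finset.sum_congr rfl fun g hg => ?_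
            have h0 := (Finset.mem_filter.1 hg).2
            have h0' : (g.2 : ℝ) ≠ 0 := by exact_mod_cast h0.ne'
            rw [if_pos h0, map_smul, pt_nsmul, map_smul, hκ g (Finset.mem_filter.1 hg).1,
              smul_smul, smul_smul]
            congr 1
            rw [← he g hg]
            have : (e g : ℝ) ≠ 0 := by
              rintro h00
              have := he g hg
              rw [h00, zero_mul] at this
              exact hD'.ne this
            field_simp
          · refine Finset.sum_congr rfl fun g hg => ?_
            rw [if_neg (Finset.mem_filter.1 hg).2, map_smul, hκ g (Finset.mem_filter.1 hg).1,
              smul_smul]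
            congr 1
            ring
        simp only [smul_sub, Finset.sum_sub_distrib] at hm
        simp only [smul_smul, ← Finset.sum_smul] at hm
        rw [hn, one_smul, sub_eq_iff_eq_add] at hm
        refine Prod.ext ?_ ?_
        · simp only [Prod.fst_sum, Prod.smul_fst]
          rw [hm]
        · rw [Prod.snd_sum]
          simpa only [Prod.smul_snd, smul_eq_mul] using hn

theorem IsFractionalLatticePolyhedron.exists_eq {Q : Set (MR M)}
    (hQ : IsFractionalLatticePolyhedron Q) :
    ∃ (d : ℕ) (V S : Finset M), 0 < d ∧ Q = convexHull ℝ ((fun v => (d : ℝ)⁻¹ • pt v) '' V) +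
      (PointedCone.hull ℝ (pt '' (S : Set M)) : Set (MR M)) := by
  obtain ⟨d, hd, V, S, hV, hS, -, h⟩ := hQ
  have hd' : (0 : ℝ) < d := Nat.cast_pos.2 hd
  refine ⟨d, hV.toFinset, hS.toFinset, hd, Set.ext fun x => ?_⟩
  rw [← Set.smul_mem_smul_set_iff₀ hd'.ne' Q x, h]
  conv_lhs => rw [← hV.coe_toFinset, ← hS.coe_toFinset]
  rw [mem_convexHull_add_hull_iff, mem_convexHull_add_hull_iff]
  constructor
  · rintro ⟨a, b, ha, hb, ha1, hx⟩
    refine ⟨a, fun i => (d : ℝ)⁻¹ * b i, ha, fun i => mul_nonneg (inv_nonneg.2 hd'.le) (hb i), ha1,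
      ?_⟩
    rw [← inv_smul_smul₀ hd'.ne' x, ← hx]
    simp only [smul_add, Finset.smul_sum, smul_smul, mul_comm]
  · rintro ⟨a, b, ha, hb, ha1, rfl⟩
    refine ⟨a, fun i => d * b i, ha, fun i => mul_nonneg hd'.le (hb i), ha1, ?_⟩
    simp only [smul_add, Finset.smul_sum, smul_smul]
    congr 1
    refine Finset.sum_congr rfl fun i _ => ?_
    congr 1
    field_simp

theorem IsFractionalLatticePolyhedron.convex {Q : Set (MR M)}
    (hQ : IsFractionalLatticePolyhedron Q) : Convex ℝ Q := by
  obtain ⟨d, V, S, -, h⟩ := hQ.exists_eq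
  exact convex_of_eq h

theorem mem_normalCone_iff {Q : Set (MR M)} {x : MR M} {u : NR M} :
    u ∈ normalCone Q x ↔ ∀ y ∈ Q, u x ≤ u y :=
  Iff.rfl

/-- Every normal cone of a fractional lattice polyhedron is the normal cone at a rational point. -/
theorem IsFractionalLatticePolyhedron.exists_rational_point {Q : Set (MR M)}
    (hQ : IsFractionalLatticePolyhedron Q) {x : MR M} (hx : x ∈ Q) :
    ∃ (n : ℕ) (κ : M), 0 < n ∧ (n : ℝ)⁻¹ • pt κ ∈ Q ∧
      normalCone Q ((n : ℝ)⁻¹ • pt κ) = normalCone Q x := by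
  obtain ⟨d, V, S, hd, h⟩ := hQ.exists_eq
  obtain ⟨V', S', hV', hmem, hmin⟩ := exists_barycentre_of_mem h hx
  have hd' : (d : ℝ) ≠ 0 := Nat.cast_ne_zero.2 hd.ne'
  have hc' : (V'.card : ℝ) ≠ 0 := Nat.cast_ne_zero.2 hV'.card_pos.ne'
  have e : (V'.card : ℝ)⁻¹ • ∑ i ∈ V', (d : ℝ)⁻¹ • pt i + ∑ i ∈ S', pt i =
      ((V'.card * d : ℕ) : ℝ)⁻¹ • pt (∑ i ∈ V', i + (V'.card * d) • ∑ i ∈ S', i) := by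
    rw [pt_add, pt_nsmul, pt_sum, pt_sum, ← Finset.smul_sum, smul_smul, smul_add, smul_smul,
      inv_mul_cancel₀ (by push_cast; positivity), one_smul]
    congr 2
    push_cast
    rw [mul_inv]
  rw [e] at hmem hmin
  exact ⟨_, _, Nat.mul_pos hV'.card_pos hd, hmem, SetLike.ext fun u => hmin u⟩

/-- The tangent cone at a point is dual to the normal cone. -/
theorem IsFractionalLatticePolyhedron.exists_add_smul_mem [Module.Finite ℤ M] {Q : Set (MR M)}
    (hQ : IsFractionalLatticePolyhedron Q) {x q : MR M} (hx : x ∈ Q)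
    (hq : q ∈ dualCone (normalCone Q x)) :
    ∃ ε : ℝ, 0 < ε ∧ ∀ t, 0 ≤ t → t ≤ ε → x + t • q ∈ Q := by
  obtain ⟨d, V, S, -, h⟩ := hQ.exists_eq
  exact ToricGIT.exists_add_smul_mem h hx fun u hu => hq hu

/-- The normal cone at an interior point of a segment is the intersection of the normal cones at the
end points. -/
theorem normalCone_combo {Q : Set (MR M)} {x y : MR M} (hx : x ∈ Q) (hy : y ∈ Q) {a b : ℝ}
    (ha : 0 < a) (hb : 0 < b) (hab : a + b = 1) :
    normalCone Q (a • x + b • y) = normalCone Q x ⊓ normalCone Q y := by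
  ext u
  rw [Submodule.mem_inf, mem_normalCone_iff, mem_normalCone_iff, mem_normalCone_iff]
  simp only [map_add, map_smul, smul_eq_mul]
  constructor
  · intro h
    have h1 := h x hx
    have h2 := h y hy
    have hxy : u x = u y := by
      obtain rfl : a = 1 - b := by linarith
      apply le_antisymm
      · by_contra! h3
        nlinarith
      · by_contra! h3
        nlinarith
    rw [hxy, ← add_mul, hab, one_mul] at h
    exact ⟨hxy ▸ h, h⟩
  · rintro ⟨h1, h2⟩ z hz
    have := mul_le_mul_of_nonneg_left (h1 z hz) ha.le
    have := mul_le_mul_of_nonneg_left (h2 z hz) hb.le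
    calc _ ≤ a * u z + b * u z := by linarith
      _ = u z := by rw [← add_mul, hab, one_mul]

end FractionalPolyhedra

end ToricGIT

/-! ### Monomials in the section rings -/

namespace ToricGIT

section Sections

variable {M MG : Type} [AddCommGroup M] [AddCommGroup MG]

theorem chi_mul_chi (a b : M) : (chi a * chi b : AddMonoidAlgebra ℂ M) = chi (a + b) := by
  simp [chi, AddMonoidAlgebra.single_mul_single]

theorem chi_zero : (chi 0 : AddMonoidAlgebra ℂ M) = 1 := rfl

theorem eq_sum_smul_chi (f : AddMonoidAlgebra ℂ M) :
    f = ∑ m ∈ f.coeff.support, f.coeff m • chi m := by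
  apply AddMonoidAlgebra.coeff_injective
  conv_lhs => rw [← Finsupp.sum_single f.coeff]
  simp [Finsupp.sum, chi]

theorem mem_span_chi_iff (A : Set M) (f : AddMonoidAlgebra ℂ M) :
    f ∈ Submodule.span ℂ (chi '' A) ↔ ∀ m, f.coeff m ≠ 0 → m ∈ A := by
  constructor
  · intro hf
    induction hf using Submodule.span_induction with
    | mem x hx =>
      obtain ⟨a, ha, rfl⟩ := hx
      intro m hm
      by_cases h : a = m
      · exact h ▸ ha
      · simp [chi, h] at hm
    | zero => simp
    | add x y _ _ hx hy =>
      intro m hm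
      by_cases h : x.coeff m = 0
      · exact hy m fun h' => hm (by simp [h, h'])
      · exact hx m h
    | smul c x _ hx =>
      intro m hm
      exact hx m fun h => hm (by simp [h])
  · intro h
    rw [eq_sum_smul_chi f]
    exact Submodule.sum_mem _ fun m hm => Submodule.smul_mem _ _
      (Submodule.subset_span ⟨m, h m (Finsupp.mem_support_iff.1 hm), rfl⟩)

theorem chi_mem_span_chi_iff (A : Set M) (m : M) :
    chi m ∈ Submodule.span ℂ (chi '' A) ↔ m ∈ A := by
  rw [mem_span_chi_iff]
  refine ⟨fun h => h m (by simp [chi]), fun h n hn => ?_⟩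
  by_cases e : m = n
  · exact e ▸ h
  · simp [chi, e] at hn

theorem mem_chartMonoid_iff {τ : PointedCone ℝ (NR M)} {m : M} :
    m ∈ chartMonoid τ ↔ ∀ u ∈ τ, 0 ≤ u (pt m) :=
  Iff.rfl

/-- The exponents of the monomials in `Γ(U_τ, L^{⊗n})`, where `v` is a vertex at which all the
linear forms in `τ` attain their minimum. -/
theorem sections_eq {s : ℕ} {m' : Fin s → M} {τ : PointedCone ℝ (NR M)} {v : M}
    (hv : v ∈ insert 0 (Set.range m'))
    (hτ : ∀ w ∈ insert 0 (Set.range m'), w - v ∈ chartMonoid τ) (n : ℕ) :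
    sections m' τ n = Submodule.span ℂ (chi '' {m | m - n • v ∈ chartMonoid τ}) := by
  have hcoord : coordinates m' = Submodule.span ℂ (chi '' insert 0 (Set.range m')) := by
    rw [coordinates, Set.image_insert_eq, chi_zero, ← Set.range_comp]
    rfl
  have hmul : ∀ A B : Set M, Submodule.span ℂ (chi '' A) * Submodule.span ℂ (chi '' B) =
      Submodule.span ℂ (chi '' (A + B)) := by
    intro A B
    rw [Submodule.span_mul_span]
    congr 1
    ext x
    constructor
    · rintro ⟨_, ⟨a, ha, rfl⟩, _, ⟨b, hb, rfl⟩, rfl⟩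
      exact ⟨a + b, Set.add_mem_add ha hb, (chi_mul_chi a b).symm⟩
    · rintro ⟨_, ⟨a, ha, b, hb, rfl⟩, rfl⟩
      exact ⟨_, ⟨a, ha, rfl⟩, _, ⟨b, hb, rfl⟩, chi_mul_chi a b⟩
  rw [sections, hcoord]
  induction n with
  | zero => simp [functions, functions.eq_1]
  | succ n ih =>
    rw [pow_succ, ← mul_assoc, ih, hmul]
    congr 2
    ext m
    constructor
    · rintro ⟨a, ha, b, hb, rfl⟩
      have : a + b - (n + 1) • v = (a - n • v) + (b - v) := by rw [succ_nsmul]; abel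
      change a + b - (n + 1) • v ∈ chartMonoid τ
      rw [this]
      exact add_mem ha (hτ b hb)
    · intro hm
      refine ⟨m - v, ?_, v, hv, sub_add_cancel m v⟩
      change m - v - n • v ∈ chartMonoid τ
      have : m - v - n • v = m - (n + 1) • v := by rw [succ_nsmul]; abel
      rw [this]
      exact hm

theorem exists_vertex_of_mem_normalFan [Module.Finite ℤ M] {σ : PointedCone ℝ (NR M)}
    (hσ : IsRationalCone σ) {s : ℕ} {m' : Fin s → M} {τ : PointedCone ℝ (NR M)}
    (hτ : τ ∈ normalFan (polyhedron σ m')) :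
    ∃ v ∈ insert 0 (Set.range m'), τ ≤ normalCone (polyhedron σ m') (pt v) := by
  obtain ⟨V, S, hV, -, hP⟩ := polyhedron_eq hσ m'
  obtain ⟨x, hx, rfl⟩ := hτ
  obtain ⟨v, hv, h⟩ := exists_vertex_of_mem hP hx
  exact ⟨v, hV ▸ hv, h⟩

theorem pt_mem_polyhedron (σ : PointedCone ℝ (NR M)) {s : ℕ} {m' : Fin s → M} {v : M}
    (hv : v ∈ insert 0 (Set.range m')) : pt v ∈ polyhedron σ m' := by
  refine ⟨pt v, subset_convexHull ℝ _ ?_, 0, zero_mem _, add_zero _⟩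
  rcases hv with rfl | ⟨i, rfl⟩
  · exact Or.inl pt_zero
  · exact Or.inr ⟨i, rfl⟩

theorem sub_mem_chartMonoid_of_le {σ : PointedCone ℝ (NR M)} {s : ℕ} {m' : Fin s → M}
    {τ : PointedCone ℝ (NR M)} {v : M} (hτ : τ ≤ normalCone (polyhedron σ m') (pt v)) {w : M}
    (hw : w ∈ insert 0 (Set.range m')) : w - v ∈ chartMonoid τ := by
  rw [mem_chartMonoid_iff]
  intro u hu
  rw [pt_sub, map_sub, sub_nonneg]
  exact hτ hu _ (pt_mem_polyhedron σ hw)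

theorem sections_eq_of_le {σ : PointedCone ℝ (NR M)} {s : ℕ} {m' : Fin s → M}
    {τ : PointedCone ℝ (NR M)} {v : M} (hv : v ∈ insert 0 (Set.range m'))
    (hτ : τ ≤ normalCone (polyhedron σ m') (pt v)) (n : ℕ) :
    sections m' τ n = Submodule.span ℂ (chi '' {m | m - n • v ∈ chartMonoid τ}) :=
  sections_eq hv (fun _ hw => sub_mem_chartMonoid_of_le hτ hw) n

/-- The sections over each chart have a basis of monomials. -/
theorem sections_eq_span [Module.Finite ℤ M] {σ : PointedCone ℝ (NR M)} (hσ : IsRationalCone σ)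
    {s : ℕ} {m' : Fin s → M} {τ : PointedCone ℝ (NR M)} (hτ : τ ∈ normalFan (polyhedron σ m'))
    (n : ℕ) : sections m' τ n = Submodule.span ℂ (chi '' {m | chi m ∈ sections m' τ n}) := by
  obtain ⟨v, hv, h⟩ := exists_vertex_of_mem_normalFan hσ hτ
  rw [sections_eq_of_le hv h]
  congr 2
  ext m
  rw [Set.mem_ofPred_eq, Set.mem_ofPred_eq, chi_mem_span_chi_iff, Set.mem_ofPred_eq]

/-- `χ^m` is a global section of `L^{⊗n}` if and only if `m` lies in the polyhedron `n P̃`. -/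
theorem forall_chi_mem_sections_iff [Module.Finite ℤ M] {σ : PointedCone ℝ (NR M)}
    (hσ : IsRationalCone σ) {s : ℕ} {m' : Fin s → M} {n : ℕ} (hn : 0 < n) (m : M) :
    (∀ τ ∈ normalFan (polyhedron σ m'), chi m ∈ sections m' τ n) ↔
      (n : ℝ)⁻¹ • pt m ∈ polyhedron σ m' := by
  have hn' : (0 : ℝ) < n := Nat.cast_pos.2 hn
  constructor
  · intro h
    obtain ⟨V, S, hV, -, hP⟩ := polyhedron_eq hσ m'
    by_contra hm
    obtain ⟨v, hv, u, hu, hum⟩ := exists_separating_of_notMem hP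
      ⟨0, by rw [← Finset.mem_coe, hV]; exact Set.mem_insert 0 _⟩ hm
    have hv' : v ∈ insert 0 (Set.range m') := hV ▸ hv
    have h1 := h _ ⟨pt v, pt_mem_polyhedron σ hv', rfl⟩
    rw [sections_eq_of_le hv' le_rfl, chi_mem_span_chi_iff, Set.mem_ofPred_eq,
      mem_chartMonoid_iff] at h1
    have h2 := h1 u hu
    rw [pt_sub, pt_nsmul, map_sub, map_smul, smul_eq_mul] at h2
    rw [map_smul, smul_eq_mul, inv_mul_lt_iff₀ hn'] at hum
    linarith
  · intro hm τ hτ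
    obtain ⟨v, hv, h⟩ := exists_vertex_of_mem_normalFan hσ hτ
    rw [sections_eq_of_le hv h, chi_mem_span_chi_iff, Set.mem_ofPred_eq, mem_chartMonoid_iff]
    intro u hu
    have := h hu _ hm
    rw [map_smul, smul_eq_mul, le_inv_mul_iff₀ hn'] at this
    rw [pt_sub, pt_nsmul, map_sub, map_smul, smul_eq_mul]
    linarith

/-- The monomial `χ^m T^j` as a function on the total space over `U_τ`. -/
noncomputable def totalMonomial {s : ℕ} (m' : Fin s → M) (k : ℕ) (τ : PointedCone ℝ (NR M))
    (j : ℕ) (m : M) (h : chi m ∈ sections m' τ (k * j)) : totalRing m' k τ :=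
  ⟨Polynomial.monomial j (chi m), fun i => by
    rw [Polynomial.coeff_monomial]
    split_ifs with e
    · exact e ▸ h
    · exact zero_mem _⟩

theorem coeff_monomial_mem {s : ℕ} {m' : Fin s → M} {k : ℕ} {τ : PointedCone ℝ (NR M)} {j : ℕ}
    {m : M} (f : totalRing m' k τ)
    (hf : (f : Polynomial (AddMonoidAlgebra ℂ M)) = Polynomial.monomial j (chi m)) :
    chi m ∈ sections m' τ (k * j) := by
  have := f.2 j
  rwa [hf, Polynomial.coeff_monomial, if_pos rfl] at this

theorem span_totalMonomial [Module.Finite ℤ M] {σ : PointedCone ℝ (NR M)} (hσ : IsRationalCone σ)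
    {s : ℕ} (m' : Fin s → M) (k : ℕ) {τ : PointedCone ℝ (NR M)}
    (hτ : τ ∈ normalFan (polyhedron σ m')) :
    Submodule.span ℂ {f : totalRing m' k τ | ∃ (j : ℕ) (m : M)
      (h : chi m ∈ sections m' τ (k * j)), f = totalMonomial m' k τ j m h} = ⊤ := by
  rw [eq_top_iff]
  rintro f -
  set S := {f : totalRing m' k τ | ∃ (j : ℕ) (m : M)
      (h : chi m ∈ sections m' τ (k * j)), f = totalMonomial m' k τ j m h} with hS
  let N : Submodule ℂ (Polynomial (AddMonoidAlgebra ℂ M)) :=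
    (Submodule.span ℂ S).map (totalRing m' k τ).val.toLinearMap
  have hN : f.1 ∈ N := by
    rw [f.1.as_sum_support]
    refine Submodule.sum_mem _ fun j _ => ?_
    have hj := f.2 j
    rw [sections_eq_span hσ hτ, mem_span_chi_iff] at hj
    rw [eq_sum_smul_chi (f.1.coeff j), map_sum]
    refine Submodule.sum_mem _ fun m hm => ?_
    rw [← Polynomial.smul_monomial]
    exact Submodule.smul_mem _ _ ⟨totalMonomial m' k τ j m (hj m (Finsupp.mem_support_iff.1 hm)),
      Submodule.subset_span ⟨j, m, _, rfl⟩, rfl⟩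
  obtain ⟨x, hx, hxf⟩ := hN
  exact (Subtype.ext hxf : x = f) ▸ hx

/-- Linear maps on the functions on the total space are determined by their values on monomials. -/
theorem totalRing_linearMap_ext [Module.Finite ℤ M] {σ : PointedCone ℝ (NR M)}
    (hσ : IsRationalCone σ) {s : ℕ} {m' : Fin s → M} {k : ℕ} {τ : PointedCone ℝ (NR M)}
    (hτ : τ ∈ normalFan (polyhedron σ m')) {A : Type*} [AddCommMonoid A] [Module ℂ A]
    {F G : totalRing m' k τ →ₗ[ℂ] A}
    (h : ∀ (j : ℕ) (m : M) (hm : chi m ∈ sections m' τ (k * j)),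
      F (totalMonomial m' k τ j m hm) = G (totalMonomial m' k τ j m hm)) : F = G := by
  refine LinearMap.ext_on (span_totalMonomial hσ m' k hτ) ?_
  rintro _ ⟨j, m, hm, rfl⟩
  exact h j m hm

end Sections

end ToricGIT

/-! ### Coactions of the group algebra -/

namespace ToricGIT

section Coactions

variable {MG : Type}

/-- A lattice can be ordered: it embeds into `ℤⁿ` with the lexicographic order. -/
theorem exists_injective_lex (M : Type) [AddCommGroup M] [Module.Free ℤ M] [Module.Finite ℤ M] :
    ∃ (n : ℕ) (l : M →+ Lex (Fin n → ℤ)), Function.Injective l := by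
  let b := Module.finBasis ℤ M
  exact ⟨_, (AddMonoidHom.mk' toLex fun _ _ => rfl).comp b.equivFun.toLinearMap.toAddMonoidHom,
    toLex.injective.comp b.equivFun.injective⟩

theorem isDomain_addMonoidAlgebra (M : Type) [AddCommGroup M] [Module.Free ℤ M]
    [Module.Finite ℤ M] : IsDomain (AddMonoidAlgebra ℂ M) := by
  obtain ⟨n, l, hl⟩ := exists_injective_lex M
  have : UniqueSums M := UniqueSums.of_injective_addHom l.toAddHom hl inferInstance
  infer_instance

/-- The component of weight `w` of an element of `A ⊗ ℂ[M_G]`. -/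
noncomputable def weightPart (A : Type) [AddCommMonoid A] [Module ℂ A] (w : MG) :
    A ⊗[ℂ] AddMonoidAlgebra ℂ MG →ₗ[ℂ] A :=
  (TensorProduct.rid ℂ A).toLinearMap ∘ₗ
    ((Finsupp.lapply w).comp (AddMonoidAlgebra.coeffLinearEquiv ℂ).toLinearMap).lTensor A

section

variable {A : Type} [AddCommMonoid A] [Module ℂ A]

theorem weightPart_tmul (w : MG) (a : A) (h : AddMonoidAlgebra ℂ MG) :
    weightPart A w (a ⊗ₜ h) = h.coeff w • a := by
  simp [weightPart]

open Classical in
theorem weightPart_tmul_chi [AddCommGroup MG] (w v : MG) (a : A) :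
    weightPart A w (a ⊗ₜ chi v) = if v = w then a else 0 := by
  rw [weightPart_tmul]
  split_ifs with h
  · simp [chi, h]
  · simp [chi, h]

theorem weightPart_rTensor {B : Type} [AddCommMonoid B] [Module ℂ B] (F : A →ₗ[ℂ] B) (w : MG)
    (z : A ⊗[ℂ] AddMonoidAlgebra ℂ MG) :
    weightPart B w (F.rTensor _ z) = F (weightPart A w z) := by
  induction z using TensorProduct.induction_on with
  | zero => simp
  | tmul a h => rw [LinearMap.rTensor_tmul, weightPart_tmul, weightPart_tmul, map_smul]
  | add x y hx hy => rw [map_add, map_add, map_add, map_add, hx, hy]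

variable [AddCommGroup MG]

/-- An element of `A ⊗ ℂ[M_G]` is the sum of its components. -/
theorem exists_sum_weightPart (z : A ⊗[ℂ] AddMonoidAlgebra ℂ MG) :
    ∃ s : Finset MG, (∀ w ∉ s, weightPart A w z = 0) ∧ z = ∑ w ∈ s, weightPart A w z ⊗ₜ chi w := by
  classical
  suffices h : ∃ s : Finset MG, (∀ w ∉ s, weightPart A w z = 0) ∧
      ∀ t, s ⊆ t → z = ∑ w ∈ t, weightPart A w z ⊗ₜ chi w by
    obtain ⟨s, hs0, hs⟩ := h
    exact ⟨s, hs0, hs s subset_rfl⟩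
  induction z using TensorProduct.induction_on with
  | zero => exact ⟨∅, by simp⟩
  | tmul a h =>
    refine ⟨h.coeff.support, fun w hw => ?_, fun t ht => ?_⟩
    · rw [weightPart_tmul, Finsupp.notMem_support_iff.1 hw, zero_smul]
    · conv_lhs => rw [eq_sum_smul_chi h, TensorProduct.tmul_sum]
      rw [Finset.sum_subset ht fun m _ hm => by rw [Finsupp.notMem_support_iff.1 hm]; simp]
      refine Finset.sum_congr rfl fun w _ => ?_
      rw [weightPart_tmul, TensorProduct.smul_tmul]
  | add x y hx hy =>
    obtain ⟨s, hs0, hs⟩ := hx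
    obtain ⟨t, ht0, ht⟩ := hy
    refine ⟨s ∪ t, fun w hw => ?_, fun r hr => ?_⟩
    · rw [Finset.mem_union, not_or] at hw
      rw [map_add, hs0 w hw.1, ht0 w hw.2, add_zero]
    · conv_lhs => rw [hs r (Finset.union_subset_left hr), ht r (Finset.union_subset_right hr)]
      rw [← Finset.sum_add_distrib]
      refine Finset.sum_congr rfl fun w _ => ?_
      rw [map_add, TensorProduct.add_tmul]

/-- The components of an element under a coaction are semi-invariant. -/
theorem coaction_weightPart (δ : A →ₗ[ℂ] A ⊗[ℂ] AddMonoidAlgebra ℂ MG)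
    (coassoc : ∀ f, TensorProduct.assoc ℂ _ _ _ (δ.rTensor _ (δ f)) =
      (Coalgebra.comul (R := ℂ) (A := AddMonoidAlgebra ℂ MG)).lTensor _ (δ f)) (f : A) (w : MG) :
    δ (weightPart A w (δ f)) = weightPart A w (δ f) ⊗ₜ chi w := by
  have h1 : ∀ z : A ⊗[ℂ] AddMonoidAlgebra ℂ MG,
      ((weightPart (AddMonoidAlgebra ℂ MG) w).lTensor A)
        ((Coalgebra.comul (R := ℂ) (A := AddMonoidAlgebra ℂ MG)).lTensor A z) =
        weightPart A w z ⊗ₜ chi w := by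
    intro z
    obtain ⟨s, hs0, hs⟩ := exists_sum_weightPart z
    have h2 : ∀ (a : A) (v : MG), ((weightPart (AddMonoidAlgebra ℂ MG) w).lTensor A)
        ((Coalgebra.comul (R := ℂ) (A := AddMonoidAlgebra ℂ MG)).lTensor A (a ⊗ₜ chi v)) =
        weightPart A w (a ⊗ₜ chi v) ⊗ₜ chi w := by
      intro a v
      rw [LinearMap.lTensor_tmul, LinearMap.lTensor_tmul, AddMonoidAlgebra.comul_single,
        CommSemiring.comul_apply, TensorProduct.map_tmul]
      change a ⊗ₜ weightPart _ w (chi v ⊗ₜ chi v) = _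
      rw [weightPart_tmul_chi, weightPart_tmul_chi]
      split_ifs with h
      · rw [h]
      · simp
    conv_lhs => rw [hs]
    conv_rhs => rw [hs]
    simp only [map_sum, TensorProduct.sum_tmul, h2]
  have h3 : ∀ y : (A ⊗[ℂ] AddMonoidAlgebra ℂ MG) ⊗[ℂ] AddMonoidAlgebra ℂ MG,
      ((weightPart (AddMonoidAlgebra ℂ MG) w).lTensor A) (TensorProduct.assoc ℂ _ _ _ y) =
        weightPart (A ⊗[ℂ] AddMonoidAlgebra ℂ MG) w y := by
    intro y
    induction y using TensorProduct.induction_on with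
    | zero => simp
    | tmul z h =>
      induction z using TensorProduct.induction_on with
      | zero => simp
      | tmul a g =>
        rw [TensorProduct.assoc_tmul, LinearMap.lTensor_tmul, weightPart_tmul, weightPart_tmul,
          TensorProduct.tmul_smul]
      | add x y hx hy => simp only [TensorProduct.add_tmul, map_add, hx, hy]
    | add x y hx hy => simp only [map_add, hx, hy]
  rw [← h1, ← coassoc, h3, weightPart_rTensor]

theorem sum_weightPart_of_counit (δ : A →ₗ[ℂ] A ⊗[ℂ] AddMonoidAlgebra ℂ MG)
    (counit : ∀ f, TensorProduct.rid ℂ _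
      ((Coalgebra.counit (R := ℂ) (A := AddMonoidAlgebra ℂ MG)).lTensor _ (δ f)) = f) (f : A) :
    ∃ s : Finset MG, (∀ w ∉ s, weightPart A w (δ f) = 0) ∧
      δ f = ∑ w ∈ s, weightPart A w (δ f) ⊗ₜ chi w ∧ ∑ w ∈ s, weightPart A w (δ f) = f := by
  obtain ⟨s, hs0, hs⟩ := exists_sum_weightPart (δ f)
  refine ⟨s, hs0, hs, ?_⟩
  have h := counit f
  rw [hs] at h
  simpa [chi, AddMonoidAlgebra.counit_single] using h

end

end Coactions

end ToricGIT

/-! ### The weight of a linearization -/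

namespace ToricGIT

section Weights

variable {M MG : Type} [AddCommGroup M] [AddCommGroup MG]

/-- The normal cone at the midpoint of two points is the intersection of their normal cones. -/
theorem inf_mem_normalFan {P : Set (MR M)} (hP : Convex ℝ P) {τ τ' : PointedCone ℝ (NR M)}
    (hτ : τ ∈ normalFan P) (hτ' : τ' ∈ normalFan P) : τ ⊓ τ' ∈ normalFan P := by
  obtain ⟨x, hx, rfl⟩ := hτ
  obtain ⟨y, hy, rfl⟩ := hτ'
  exact ⟨(1 / 2 : ℝ) • x + (1 / 2 : ℝ) • y,
    hP hx hy (by norm_num) (by norm_num) (by norm_num),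
    (normalCone_combo hx hy (by norm_num) (by norm_num) (by norm_num)).symm⟩

/-- Let `T = ∑ T_w` be the decomposition of `T` into components of weight `w`, and `T_w = h_w T`.
Then only one `T_w` is nonzero. The hypothesis `hmul` says that `h_w T` is homogeneous of weight
`w`. With respect to a linear order on the weights, its top weight is the sum of the top degree of `h_w`
and the top weight of `T`, and likewise for the bottom ones; as these sums agree, so do the top and
the bottom weight of `T`. -/
theorem eq_of_ne_zero_of_sum_mul [Module.Free ℤ M] [Module.Finite ℤ M] [Module.Free ℤ MG]
    [Module.Finite ℤ MG] (α : M →ₗ[ℤ] MG) (s : Finset MG) (h : MG → AddMonoidAlgebra ℂ M)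
    (hs : ∀ w ∉ s, h w = 0)
    (hmul : ∀ w z, w ≠ z → ∑ m ∈ (h w).coeff.support, (h w).coeff m • (chi m * h (z - α m)) = 0)
    {w w' : MG} (hw : h w ≠ 0) (hw' : h w' ≠ 0) : w = w' := by
  classical
  have := isDomain_addMonoidAlgebra M
  obtain ⟨n, l, hl⟩ := exists_injective_lex MG
  -- For `l` and for `-l` alike, `w₁` being the top weight and `t` the top `α`-degree in `h w`.
  have key : ∀ (l : MG → Lex (Fin n → ℤ)), (∀ a b, l (a + b) = l a + l b) →
      Function.Injective l → ∀ w, h w ≠ 0 → ∃ w₁, h w₁ ≠ 0 ∧ (∀ v, h v ≠ 0 → l v ≤ l w₁) ∧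
        ∃ m₁, (h w).coeff m₁ ≠ 0 ∧ (∀ m, (h w).coeff m ≠ 0 → l (α m) ≤ l (α m₁)) ∧
          α m₁ + w₁ = w := by
    intro l hadd hl w hw
    have hne : (s.filter fun v => h v ≠ 0).Nonempty :=
      ⟨w, Finset.mem_filter.2 ⟨by by_contra hws; exact hw (hs w hws), hw⟩⟩
    obtain ⟨w₁, hw₁, hmax⟩ := Finset.exists_max_image _ l hne
    have hmax' : ∀ v, h v ≠ 0 → l v ≤ l w₁ := fun v hv =>
      hmax v (Finset.mem_filter.2 ⟨by by_contra hws; exact hv (hs v hws), hv⟩)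
    have hsupp : (h w).coeff.support.Nonempty := by
      rw [Finsupp.support_nonempty_iff]
      simpa using hw
    obtain ⟨m₁, hm₁, hmmax⟩ := Finset.exists_max_image _ (fun m => l (α m)) hsupp
    refine ⟨w₁, (Finset.mem_filter.1 hw₁).2, hmax', m₁, Finsupp.mem_support_iff.1 hm₁,
      fun m hm => hmmax m (Finsupp.mem_support_iff.2 hm), ?_⟩
    by_contra hne
    have hsum := hmul w (α m₁ + w₁) (Ne.symm hne)
    -- The part of `h w` of top degree.
    set t := ∑ m ∈ (h w).coeff.support with α m = α m₁, (h w).coeff m • chi m with ht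
    have ht0 : t ≠ 0 := by
      intro h0
      have := congrArg (fun f => AddMonoidAlgebra.coeff f m₁) h0
      simp only [ht, AddMonoidAlgebra.coeff_sum, AddMonoidAlgebra.coeff_smul, chi,
        AddMonoidAlgebra.coeff_single, Finsupp.coe_finsetSum, Finset.sum_apply, Finsupp.smul_apply,
        smul_eq_mul, AddMonoidAlgebra.coeff_zero, Finsupp.zero_apply] at this
      rw [Finset.sum_eq_single m₁] at this
      · simp at this
        exact (Finsupp.mem_support_iff.1 hm₁) this
      · intro m _ hm
        simp [hm]
      · intro hm
        exact absurd (by rw [Finset.mem_filter]; exact ⟨hm₁, rfl⟩) hm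
    have hprod : t * h w₁ = 0 := by
      rw [← hsum, ht, Finset.sum_mul, Finset.sum_filter]
      refine Finset.sum_congr rfl fun m hm => ?_
      split_ifs with e
      · rw [smul_mul_assoc, e, add_sub_cancel_left]
      · by_cases hz : h (α m₁ + w₁ - α m) = 0
        · simp [hz]
        · exfalso
          have h1 := hmax' _ hz
          have h2 := hmmax m hm
          have h3 : l (α m₁ + w₁ - α m) + l (α m) = l (α m₁) + l w₁ := by
            rw [← hadd, ← hadd, sub_add_cancel]
          have h4 : l (α m) < l (α m₁) := lt_of_le_of_ne h2 fun h => e (hl h)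
          have h5 := add_lt_add_of_le_of_lt h1 h4
          rw [h3, add_comm] at h5
          exact lt_irrefl _ h5
    exact (mul_ne_zero ht0 (Finset.mem_filter.1 hw₁).2) hprod
  obtain ⟨w₁, hw₁, hmax, m₁, hm₁, hmmax, e₁⟩ := key l (map_add l) hl w hw
  obtain ⟨w₂, hw₂, hmin, m₂, hm₂, hmmin, e₂⟩ := key (fun x => -l x)
    (fun a b => by rw [map_add, neg_add]) (fun a b hab => hl (neg_injective hab)) w hw
  have h1 := hmmax m₂ hm₂
  have h2 : l (α m₁) + l w₁ = l (α m₂) + l w₂ := by rw [← map_add, ← map_add, e₁, e₂]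
  have h3 : l w₁ ≤ l w₂ := by
    by_contra! h3
    exact absurd h2 (add_lt_add_of_le_of_lt h1 h3).ne'
  have h4 : ∀ v, h v ≠ 0 → l v = l w₁ := fun v hv =>
    le_antisymm (hmax v hv) (h3.trans (neg_le_neg_iff.1 (hmin v hv)))
  exact hl ((h4 w hw).trans (h4 w' hw').symm)

/-- An element `T` whose components under a coaction are multiples of `T` is semi-invariant. Here
`q` takes the coefficient of `T`, with values in `ℂ[M]`, and `C m` is the element `χ^m` of `A`. -/
theorem exists_coaction_eq_tmul_chi [Module.Free ℤ M] [Module.Finite ℤ M] [Module.Free ℤ MG]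
    [Module.Finite ℤ MG] (α : M →ₗ[ℤ] MG) {A : Type} [Semiring A] [Algebra ℂ A]
    (δ : A →ₐ[ℂ] A ⊗[ℂ] AddMonoidAlgebra ℂ MG)
    (coassoc : ∀ f, TensorProduct.assoc ℂ _ _ _ (δ.toLinearMap.rTensor _ (δ f)) =
      (Coalgebra.comul (R := ℂ) (A := AddMonoidAlgebra ℂ MG)).lTensor _ (δ f))
    (counit : ∀ f, TensorProduct.rid ℂ _
      ((Coalgebra.counit (R := ℂ) (A := AddMonoidAlgebra ℂ MG)).lTensor _ (δ f)) = f)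
    {T : A} (hT : T ≠ 0) (q : A →ₗ[ℂ] AddMonoidAlgebra ℂ M) (C : M → A)
    (hq : ∀ w, q (weightPart A w (δ T)) = 0 → weightPart A w (δ T) = 0)
    (hC : ∀ w, ∀ m ∈ (q (weightPart A w (δ T))).coeff.support, δ (C m) = C m ⊗ₜ chi (α m) ∧
      ∀ a, q (C m * a) = chi m * q a)
    (hdec : ∀ w, weightPart A w (δ T) = (∑ m ∈ (q (weightPart A w (δ T))).coeff.support,
      (q (weightPart A w (δ T))).coeff m • C m) * T) :
    ∃ c : MG, δ T = T ⊗ₜ chi c := by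
  obtain ⟨S, hS0, hS, hS1⟩ := sum_weightPart_of_counit δ.toLinearMap counit T
  have hsemi := coaction_weightPart δ.toLinearMap coassoc T
  simp only [AlgHom.toLinearMap_apply] at hS0 hS hS1 hsemi
  obtain ⟨g, hg⟩ : ∃ g : MG → A, ∀ w, weightPart A w (δ T) = g w := ⟨_, fun _ => rfl⟩
  simp only [hg] at hS0 hS hS1 hsemi hq hC hdec
  have hone : ∀ w w', q (g w) ≠ 0 → q (g w') ≠ 0 → w = w' := by
    intro w w' hw hw'
    refine eq_of_ne_zero_of_sum_mul α S (fun w => q (g w)) (fun w hw => ?_) (fun w z hwz => ?_)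
      hw hw'
    · rw [hS0 w hw, map_zero]
    · have h1 : δ ((∑ m ∈ (q (g w)).coeff.support, (q (g w)).coeff m • C m) * T) =
          g w ⊗ₜ chi w := by rw [← hdec w, hsemi w]
      rw [map_mul, map_sum, hS, Finset.sum_mul] at h1
      have h2 := congrArg (fun x => q (weightPart A z x)) h1
      simp only [weightPart_tmul_chi, if_neg hwz, map_zero] at h2
      refine Eq.trans ?_ h2
      rw [map_sum, map_sum]
      refine Finset.sum_congr rfl fun m hm => ?_
      obtain ⟨hm1, hm2⟩ := hC w m hm
      rw [map_smul, hm1, smul_mul_assoc, map_smul, map_smul, Finset.mul_sum, map_sum]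
      simp only [Algebra.TensorProduct.tmul_mul_tmul, chi_mul_chi, weightPart_tmul_chi]
      congr 1
      rw [Finset.sum_eq_single (z - α m)]
      · rw [if_pos (by abel), hm2]
      · intro v _ hv
        rw [if_neg fun e => hv (by rw [← e]; abel)]
      · intro hz
        rw [hS0 _ hz, mul_zero, ite_self]
  obtain ⟨c, hcS, hc⟩ : ∃ c ∈ S, g c ≠ 0 := by
    by_contra! h0
    exact hT (hS1 ▸ Finset.sum_eq_zero h0)
  have hother : ∀ w ∈ S, w ≠ c → g w = 0 := fun w _ hwc => by
    by_contra hgw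
    exact hwc (hone w c (fun h0 => hgw (hq w h0)) (fun h0 => hc (hq c h0)))
  have hgc : g c = T := by
    rw [← hS1]
    exact (Finset.sum_eq_single c hother fun h0 => absurd hcS h0).symm
  refine ⟨c, ?_⟩
  rw [hS, Finset.sum_eq_single c]
  · rw [hgc]
  · intro w hw hwc
    rw [hother w hw hwc, TensorProduct.zero_tmul]
  · exact fun h0 => absurd hcS h0

variable {α : M →ₗ[ℤ] MG} {σ : PointedCone ℝ (NR M)} {s : ℕ} {m' : Fin s → M} {k : ℕ}

theorem convex_polyhedron (σ : PointedCone ℝ (NR M)) {s : ℕ} (m' : Fin s → M) :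
    Convex ℝ (polyhedron σ m') :=
  (convex_convexHull ℝ _).add (PointedCone.convex _)

theorem polyhedron_normalCone_zero_mem (σ : PointedCone ℝ (NR M)) {s : ℕ} (m' : Fin s → M) :
    normalCone (polyhedron σ m') 0 ∈ normalFan (polyhedron σ m') :=
  ⟨0, zero_mem_polyhedron σ m', rfl⟩

theorem sections_eq_functions {τ : PointedCone ℝ (NR M)}
    (hτ : τ ≤ normalCone (polyhedron σ m') 0) (n : ℕ) : sections m' τ n = functions τ := by
  rw [sections_eq_of_le (v := 0) (Set.mem_insert 0 _) (by rwa [pt_zero])]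
  simp [functions]

/-- The generator `T` of the total space over the chart `U_τ`, where `L` is trivialized by its
section `1`. -/
noncomputable def totalGenerator (m' : Fin s → M) (k : ℕ) {τ : PointedCone ℝ (NR M)}
    (hτ : τ ≤ normalCone (polyhedron σ m') 0) : totalRing m' k τ :=
  totalMonomial m' k τ 1 0 (by
    rw [sections_eq_functions hτ]
    exact one_mem_functions τ)

/-- The functions on `U_τ` as functions on the total space. -/
noncomputable def totalConst (m' : Fin s → M) (k : ℕ) (τ : PointedCone ℝ (NR M))
    (f : AddMonoidAlgebra ℂ M) (hf : f ∈ functions τ) : totalRing m' k τ :=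
  ⟨Polynomial.C f, fun j => by
    rw [Polynomial.coeff_C]
    split_ifs with h
    · subst h
      simpa [sections] using hf
    · exact zero_mem _⟩

/-- The coefficient of `T^j` of a function on the total space. -/
noncomputable def totalCoeff (m' : Fin s → M) (k : ℕ) (τ : PointedCone ℝ (NR M)) (j : ℕ) :
    totalRing m' k τ →ₗ[ℂ] AddMonoidAlgebra ℂ M :=
  ((Polynomial.lcoeff (AddMonoidAlgebra ℂ M) j).restrictScalars ℂ) ∘ₗ
    (totalRing m' k τ).val.toLinearMap

theorem totalCoeff_totalConst_mul {τ : PointedCone ℝ (NR M)} {f : AddMonoidAlgebra ℂ M}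
    (hf : f ∈ functions τ) (j : ℕ) (a : totalRing m' k τ) :
    totalCoeff m' k τ j (totalConst m' k τ f hf * a) = f * totalCoeff m' k τ j a :=
  Polynomial.coeff_C_mul _

theorem chi_mem_functions {τ : PointedCone ℝ (NR M)} {m : M} (hm : m ∈ chartMonoid τ) :
    chi m ∈ functions τ :=
  Submodule.subset_span ⟨m, hm, rfl⟩

theorem component_eq_totalConst_mul {τ : PointedCone ℝ (NR M)}
    (hτ : τ ≤ normalCone (polyhedron σ m') 0) (f : totalRing m' k τ)
    (hf : totalCoeff m' k τ 1 f ∈ functions τ) :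
    component m' k τ 1 f = totalConst m' k τ (totalCoeff m' k τ 1 f) hf *
      totalGenerator m' k hτ := by
  apply Subtype.ext
  change Polynomial.monomial 1 (totalCoeff m' k τ 1 f) =
    Polynomial.C (totalCoeff m' k τ 1 f) * Polynomial.monomial 1 (chi 0)
  rw [Polynomial.C_mul_monomial, chi_zero, mul_one]

theorem component_totalGenerator {τ : PointedCone ℝ (NR M)}
    (hτ : τ ≤ normalCone (polyhedron σ m') 0) :
    component m' k τ 1 (totalGenerator m' k hτ) = totalGenerator m' k hτ := by
  apply Subtype.ext
  change Polynomial.monomial 1 ((Polynomial.monomial 1 (chi (0 : M))).coeff 1) = _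
  rw [Polynomial.coeff_monomial, if_pos rfl]
  rfl

theorem totalGenerator_ne_zero {τ : PointedCone ℝ (NR M)}
    (hτ : τ ≤ normalCone (polyhedron σ m') 0) : totalGenerator m' k hτ ≠ 0 := by
  intro h0
  have := congrArg (totalCoeff m' k τ 1) h0
  change (Polynomial.monomial 1 (chi (0 : M))).coeff 1 = _ at this
  rw [Polynomial.coeff_monomial, if_pos rfl, map_zero] at this
  exact one_ne_zero this

open Classical in
/-- The function `χ^m` on the total space if `m` lies in the semigroup of the chart, and zero
otherwise. -/
noncomputable def totalChi (m' : Fin s → M) (k : ℕ) (τ : PointedCone ℝ (NR M)) (m : M) :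
    totalRing m' k τ :=
  if hm : m ∈ chartMonoid τ then totalConst m' k τ (chi m) (chi_mem_functions hm) else 0

theorem totalConst_eq_sum_totalChi {τ : PointedCone ℝ (NR M)} (f : AddMonoidAlgebra ℂ M)
    (hf : f ∈ functions τ) :
    totalConst m' k τ f hf = ∑ m ∈ f.coeff.support, f.coeff m • totalChi m' k τ m := by
  apply Subtype.ext
  rw [AddSubmonoidClass.coe_finsetSum]
  change Polynomial.C f = _
  conv_lhs => rw [eq_sum_smul_chi f, map_sum]
  refine Finset.sum_congr rfl fun m hm => ?_
  have hm' : m ∈ chartMonoid τ := (mem_span_chi_iff _ f).1 hf m (Finsupp.mem_support_iff.1 hm)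
  rw [totalChi, dif_pos hm', ← Polynomial.smul_C]
  rfl

theorem totalCoeff_mem_functions {τ : PointedCone ℝ (NR M)}
    (hτ : τ ≤ normalCone (polyhedron σ m') 0) (f : totalRing m' k τ) (j : ℕ) :
    totalCoeff m' k τ j f ∈ functions τ :=
  sections_eq_functions hτ (k * j) ▸ f.2 j

/-- If a coaction preserves the degree, the components of a homogeneous element have its degree. -/
theorem map_weightPart_of_map_eq {MG : Type} (A : Type) [AddCommMonoid A] [Module ℂ A]
    (π : A →ₗ[ℂ] A) (δ : A →ₗ[ℂ] A ⊗[ℂ] AddMonoidAlgebra ℂ MG) (T : A) (hT : π T = T)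
    (h : δ (π T) = π.rTensor _ (δ T)) (w : MG) :
    π (weightPart A w (δ T)) = weightPart A w (δ T) := by
  rw [← weightPart_rTensor, ← h, hT]

theorem totalChi_of_mem {τ : PointedCone ℝ (NR M)} {m : M} (hm : m ∈ chartMonoid τ) :
    totalChi m' k τ m = totalConst m' k τ (chi m) (chi_mem_functions hm) := by
  rw [totalChi, dif_pos hm]

theorem eq_sum_totalChi_mul_totalGenerator {τ : PointedCone ℝ (NR M)}
    (hτ : τ ≤ normalCone (polyhedron σ m') 0) (f : totalRing m' k τ)
    (hf : component m' k τ 1 f = f) :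
    f = (∑ m ∈ (totalCoeff m' k τ 1 f).coeff.support, (totalCoeff m' k τ 1 f).coeff m •
      totalChi m' k τ m) * totalGenerator m' k hτ := by
  rw [← totalConst_eq_sum_totalChi _ (totalCoeff_mem_functions hτ f 1),
    ← component_eq_totalConst_mul hτ, hf]

theorem eq_zero_of_totalCoeff_eq_zero {τ : PointedCone ℝ (NR M)} (f : totalRing m' k τ)
    (hf : component m' k τ 1 f = f) (h0 : totalCoeff m' k τ 1 f = 0) : f = 0 := by
  rw [← hf]
  apply Subtype.ext
  change Polynomial.monomial 1 (totalCoeff m' k τ 1 f) = 0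
  rw [h0, map_zero]

theorem Linearization.coact_totalChi (F : Set (PointedCone ℝ (NR M)))
    (ρ : Linearization α F m' k) (τ : F) {m : M} (hm : m ∈ chartMonoid τ.1) :
    ρ.coact τ (totalChi m' k τ.1 m) = totalChi m' k τ.1 m ⊗ₜ chi (α m) := by
  rw [totalChi_of_mem hm]
  exact ρ.coact_function τ m _ rfl

/-- The group acts on the trivializing section by a character. -/
theorem Linearization.exists_coact_totalGenerator [Module.Free ℤ M] [Module.Finite ℤ M]
    [Module.Free ℤ MG] [Module.Finite ℤ MG] {F : Set (PointedCone ℝ (NR M))}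
    (ρ : Linearization α F m' k) (τ : F) (hτ : τ.1 ≤ normalCone (polyhedron σ m') 0) :
    ∃ c : MG, ρ.coact τ (totalGenerator m' k hτ) = totalGenerator m' k hτ ⊗ₜ chi c := by
  have hcomp : ∀ w, component m' k τ.1 1
      (weightPart _ w (ρ.coact τ (totalGenerator m' k hτ))) =
        weightPart _ w (ρ.coact τ (totalGenerator m' k hτ)) :=
    map_weightPart_of_map_eq _ (component m' k τ.1 1) (ρ.coact τ).toLinearMap _
      (component_totalGenerator hτ) (ρ.coact_component τ 1 _)
  have hq : ∀ w, totalCoeff m' k τ.1 1 (weightPart _ w (ρ.coact τ (totalGenerator m' k hτ))) = 0 →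
      weightPart _ w (ρ.coact τ (totalGenerator m' k hτ)) = 0 := fun w hw =>
    eq_zero_of_totalCoeff_eq_zero _ (hcomp w) hw
  have hdec := fun w => eq_sum_totalChi_mul_totalGenerator hτ _ (hcomp w)
  refine exists_coaction_eq_tmul_chi α (ρ.coact τ) (ρ.coassoc τ) (ρ.counit τ)
    (totalGenerator_ne_zero hτ) (totalCoeff m' k τ.1 1) (totalChi m' k τ.1) hq
    (fun w m hm => ?_) hdec
  have hm' : m ∈ chartMonoid τ.1 := (mem_span_chi_iff _ _).1 (totalCoeff_mem_functions hτ _ 1) m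
      (Finsupp.mem_support_iff.1 hm)
  refine ⟨ρ.coact_totalChi F τ hm', fun a => ?_⟩
  rw [totalChi_of_mem hm']
  exact totalCoeff_totalConst_mul _ 1 a

theorem Linearization.coact_monomial_of_le {F : Set (PointedCone ℝ (NR M))}
    (ρ : Linearization α F m' k) (τ : F) (hτ : τ.1 ≤ normalCone (polyhedron σ m') 0) {c : MG}
    (hc : ρ.coact τ (totalGenerator m' k hτ) = totalGenerator m' k hτ ⊗ₜ chi c) (m : M) (j : ℕ)
    (f : totalRing m' k τ.1)
    (hf : (f : Polynomial (AddMonoidAlgebra ℂ M)) = Polynomial.monomial j (chi m)) :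
    ρ.coact τ f = f ⊗ₜ chi (α m + j • c) := by
  have hm : m ∈ chartMonoid τ.1 := by
    have := coeff_monomial_mem f hf
    rw [sections_eq_functions hτ] at this
    exact (chi_mem_span_chi_iff _ m).1 this
  have hfe : f = totalChi m' k τ.1 m * totalGenerator m' k hτ ^ j := by
    rw [totalChi_of_mem hm]
    apply Subtype.ext
    rw [hf]
    change _ = Polynomial.C (chi m) * (Polynomial.monomial 1 (chi 0)) ^ j
    rw [Polynomial.monomial_pow, Polynomial.C_mul_monomial, chi_zero, one_pow, mul_one, one_mul]
  have hp : (chi c : AddMonoidAlgebra ℂ MG) ^ j = chi (j • c) := by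
    simp [chi, AddMonoidAlgebra.single_pow]
  rw [hfe, map_mul, map_pow, hc, ρ.coact_totalChi F τ hm, Algebra.TensorProduct.tmul_pow,
    Algebra.TensorProduct.tmul_mul_tmul, hp, chi_mul_chi]

/-- Being semi-invariant of a given weight can be checked after an injective map. -/
theorem eq_tmul_chi_of_rTensor_eq {A B : Type} [AddCommMonoid A] [Module ℂ A] [AddCommMonoid B]
    [Module ℂ B] (i : A →ₗ[ℂ] B) (hi : Function.Injective i) {a : A} {w : MG}
    {z : A ⊗[ℂ] AddMonoidAlgebra ℂ MG} (h : i.rTensor _ z = i a ⊗ₜ chi w) : z = a ⊗ₜ chi w := by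
  classical
  have hz : ∀ v, weightPart A v z = if w = v then a else 0 := by
    intro v
    apply hi
    rw [← weightPart_rTensor, h, weightPart_tmul_chi]
    split_ifs <;> simp
  obtain ⟨s, hs0, hs⟩ := exists_sum_weightPart z
  rw [hs, Finset.sum_eq_single w]
  · rw [hz, if_pos rfl]
  · intro v _ hv
    rw [hz, if_neg (Ne.symm hv), TensorProduct.zero_tmul]
  · intro hw
    rw [hs0 w hw, TensorProduct.zero_tmul]

/-- The weight of a section can be computed on a smaller chart. -/
theorem Linearization.coact_eq_of_restrict {F : Set (PointedCone ℝ (NR M))}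
    (ρ : Linearization α F m' k) (τ τ' : F) (h : τ'.1 ≤ τ.1) {f : totalRing m' k τ.1} {w : MG}
    (hf : ρ.coact τ' (Subalgebra.inclusion (totalRing_anti m' k h) f) =
      Subalgebra.inclusion (totalRing_anti m' k h) f ⊗ₜ chi w) : ρ.coact τ f = f ⊗ₜ chi w := by
  rw [ρ.coact_restrict τ' τ h] at hf
  exact eq_tmul_chi_of_rTensor_eq (Subalgebra.inclusion (totalRing_anti m' k h)).toLinearMap
    (Subalgebra.inclusion_injective (totalRing_anti m' k h)) hf

theorem inclusion_totalGenerator {τ τ' : PointedCone ℝ (NR M)} (h : τ ≤ τ')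
    (h' : τ' ≤ normalCone (polyhedron σ m') 0) :
    Subalgebra.inclusion (totalRing_anti m' k h) (totalGenerator m' k h') =
      totalGenerator m' k (h.trans h') :=
  rfl

theorem Linearization.coact_totalGenerator_of_le {F : Set (PointedCone ℝ (NR M))}
    (ρ : Linearization α F m' k) (τ τ' : F) (h : τ.1 ≤ τ'.1)
    (h' : τ'.1 ≤ normalCone (polyhedron σ m') 0) {c : MG}
    (hc : ρ.coact τ' (totalGenerator m' k h') = totalGenerator m' k h' ⊗ₜ chi c) :
    ρ.coact τ (totalGenerator m' k (h.trans h')) = totalGenerator m' k (h.trans h') ⊗ₜ chi c := by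
  have h1 := ρ.coact_restrict τ τ' h (totalGenerator m' k h')
  rw [hc, LinearMap.rTensor_tmul, AlgHom.toLinearMap_apply, inclusion_totalGenerator h h'] at h1
  exact h1

/-- Every linearization has a weight. -/
theorem Linearization.exists_hasWeight [Module.Free ℤ M] [Module.Finite ℤ M]
    [Module.Free ℤ MG] [Module.Finite ℤ MG]
    (ρ : Linearization α (normalFan (polyhedron σ m')) m' k) : ∃ c : MG, ρ.HasWeight c := by
  obtain ⟨τ₀, hτ₀⟩ : ∃ τ₀ : normalFan (polyhedron σ m'), τ₀.1 = normalCone (polyhedron σ m') 0 :=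
    ⟨⟨_, polyhedron_normalCone_zero_mem σ m'⟩, rfl⟩
  obtain ⟨c, hc⟩ := ρ.exists_coact_totalGenerator τ₀ hτ₀.le
  refine ⟨c, fun τ m j f hf => ?_⟩
  -- Restrict to the chart of the intersection with the cone at the vertex `0`.
  obtain ⟨τ', h, h'⟩ : ∃ τ' : normalFan (polyhedron σ m'), τ'.1 ≤ τ.1 ∧ τ'.1 ≤ τ₀.1 :=
    ⟨⟨τ.1 ⊓ τ₀.1, inf_mem_normalFan (convex_polyhedron σ m') τ.2 τ₀.2⟩, inf_le_left, inf_le_right⟩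
  exact ρ.coact_eq_of_restrict τ τ' h (ρ.coact_monomial_of_le τ' (h'.trans hτ₀.le)
    (ρ.coact_totalGenerator_of_le τ' τ₀ h' hτ₀.le hc) m j
      _ ((Subalgebra.coe_inclusion (totalRing_anti m' k h) f).trans hf))

theorem tmul_chi_right_injective {A : Type} [AddCommMonoid A] [Module ℂ A] {a : A} (ha : a ≠ 0)
    {w w' : MG} (h : (a ⊗ₜ chi w : A ⊗[ℂ] AddMonoidAlgebra ℂ MG) = a ⊗ₜ chi w') : w = w' := by
  by_contra hne
  have := congrArg (weightPart A w) h
  rw [weightPart_tmul_chi, weightPart_tmul_chi, if_pos rfl, if_neg (Ne.symm hne)] at this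
  exact ha this

theorem Linearization.HasWeight.eq {ρ : Linearization α (normalFan (polyhedron σ m')) m' k}
    {c c' : MG} (h : ρ.HasWeight c) (h' : ρ.HasWeight c') : c = c' := by
  -- Compare on the trivializing section.
  have h1 := h ⟨_, polyhedron_normalCone_zero_mem σ m'⟩ 0 1 (totalGenerator m' k le_rfl) rfl
  have h2 := h' ⟨_, polyhedron_normalCone_zero_mem σ m'⟩ 0 1 (totalGenerator m' k le_rfl) rfl
  have := tmul_chi_right_injective (totalGenerator_ne_zero le_rfl) (h1.symm.trans h2)
  simpa using this

/-- A linearization is determined by its weight. -/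
theorem Linearization.eq_of_hasWeight [Module.Finite ℤ M] (hσ : IsRationalCone σ)
    {ρ ρ' : Linearization α (normalFan (polyhedron σ m')) m' k}
    {c : MG} (h : ρ.HasWeight c) (h' : ρ'.HasWeight c) : ρ = ρ' := by
  have hco : ρ.coact = ρ'.coact := by
    funext τ
    apply AlgHom.toLinearMap_injective
    refine totalRing_linearMap_ext hσ τ.2 fun j m hm => ?_
    exact (h τ m j _ rfl).trans (h' τ m j _ rfl).symm
  cases ρ
  cases ρ'
  congr

/-! ### The linearization with a given weight -/

theorem coassoc_of_eq_tmul_chi {A : Type} [Semiring A] [Algebra ℂ A]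
    (δ : A →ₐ[ℂ] A ⊗[ℂ] AddMonoidAlgebra ℂ MG) {a : A} {w : MG} (h : δ a = a ⊗ₜ chi w) :
    TensorProduct.assoc ℂ _ _ _ (δ.toLinearMap.rTensor _ (δ a)) =
      (Coalgebra.comul (R := ℂ) (A := AddMonoidAlgebra ℂ MG)).lTensor _ (δ a) := by
  rw [h, LinearMap.rTensor_tmul, AlgHom.toLinearMap_apply, h, TensorProduct.assoc_tmul,
    LinearMap.lTensor_tmul, AddMonoidAlgebra.comul_single, CommSemiring.comul_apply,
    TensorProduct.map_tmul]
  rfl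

theorem counit_of_eq_tmul_chi {A : Type} [Semiring A] [Algebra ℂ A]
    (δ : A →ₐ[ℂ] A ⊗[ℂ] AddMonoidAlgebra ℂ MG) {a : A} {w : MG} (h : δ a = a ⊗ₜ chi w) :
    TensorProduct.rid ℂ _
      ((Coalgebra.counit (R := ℂ) (A := AddMonoidAlgebra ℂ MG)).lTensor _ (δ a)) = a := by
  rw [h, LinearMap.lTensor_tmul]
  simp [chi]

/-- The coaction `χ^m T^j ↦ χ^m T^j ⊗ χ^(α(m) + jc)` on `ℂ[M][T]`. -/
noncomputable def weightCoaction (α : M →ₗ[ℤ] MG) (c : MG) :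
    Polynomial (AddMonoidAlgebra ℂ M) →ₐ[ℂ]
      Polynomial (AddMonoidAlgebra ℂ M) ⊗[ℂ] AddMonoidAlgebra ℂ MG :=
  Polynomial.eval₂AlgHom
    (AddMonoidAlgebra.lift ℂ (Polynomial (AddMonoidAlgebra ℂ M) ⊗[ℂ] AddMonoidAlgebra ℂ MG) M
      { toFun := fun m => Polynomial.C (chi m.toAdd) ⊗ₜ chi (α m.toAdd)
        map_one' := by
          rw [toAdd_one, map_zero, chi_zero, chi_zero, map_one]
          rfl
        map_mul' := fun a b => by
          rw [Algebra.TensorProduct.tmul_mul_tmul, ← map_mul, chi_mul_chi, chi_mul_chi, toAdd_mul,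
            map_add] })
    (Polynomial.X ⊗ₜ chi c) (fun _ =>
      Commute.all (S := Polynomial (AddMonoidAlgebra ℂ M) ⊗[ℂ] AddMonoidAlgebra ℂ MG) _ _)

theorem weightCoaction_monomial (α : M →ₗ[ℤ] MG) (c : MG) (j : ℕ) (m : M) :
    weightCoaction α c (Polynomial.monomial j (chi m)) =
      Polynomial.monomial j (chi m) ⊗ₜ chi (α m + j • c) := by
  have hp : (chi c : AddMonoidAlgebra ℂ MG) ^ j = chi (j • c) := by
    simp [chi, AddMonoidAlgebra.single_pow]
  rw [weightCoaction]
  change Polynomial.eval₂ _ _ _ = _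
  rw [Polynomial.eval₂_monomial]
  rw [Algebra.TensorProduct.tmul_pow, hp]
  change (AddMonoidAlgebra.lift ℂ _ M _ (chi m)) * _ = _
  rw [AddMonoidAlgebra.lift_single, one_smul]
  change (Polynomial.C (chi m) ⊗ₜ chi (α m)) * _ = _
  rw [Algebra.TensorProduct.tmul_mul_tmul, chi_mul_chi, Polynomial.C_mul_X_pow_eq_monomial]

/-- Restriction of a coaction to a subalgebra. -/
theorem exists_restrict_coaction {R H : Type} [CommRing R] [Algebra ℂ R] [CommRing H]
    [Algebra ℂ H] (Ψ : R →ₐ[ℂ] R ⊗[ℂ] H) (A : Subalgebra ℂ R)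
    (hA : ∀ a : A, Ψ a ∈ (Algebra.TensorProduct.map A.val (AlgHom.id ℂ H)).range) :
    ∃ δ : A →ₐ[ℂ] A ⊗[ℂ] H, ∀ (a : A) (h : H), Ψ a = (a : R) ⊗ₜ h → δ a = a ⊗ₜ h := by
  have hinj : Function.Injective (Algebra.TensorProduct.map A.val (AlgHom.id ℂ H)) :=
    Module.Flat.rTensor_preserves_injective_linearMap (M := H) A.val.toLinearMap
      Subtype.val_injective
  refine ⟨(AlgEquiv.ofInjective _ hinj).symm.toAlgHom.comp
    ((Ψ.comp A.val).codRestrict _ hA), fun a h e => hinj ?_⟩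
  have h1 : (AlgEquiv.ofInjective _ hinj) ((AlgEquiv.ofInjective _ hinj).symm
      ((Ψ.comp A.val).codRestrict _ hA a)) = (Ψ.comp A.val).codRestrict _ hA a :=
    AlgEquiv.apply_symm_apply _ _
  exact (congrArg Subtype.val h1).trans e

/-- The coaction of weight `c` on `ℂ[M][T]` restricts to the total space over each chart, whose
functions are spanned by monomials. -/
theorem exists_totalRing_coaction [Module.Finite ℤ M] (hσ : IsRationalCone σ) (α : M →ₗ[ℤ] MG)
    (m' : Fin s → M) (k : ℕ) (c : MG) {τ : PointedCone ℝ (NR M)}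
    (hτ : τ ∈ normalFan (polyhedron σ m')) :
    ∃ δ : totalRing m' k τ →ₐ[ℂ] totalRing m' k τ ⊗[ℂ] AddMonoidAlgebra ℂ MG,
      ∀ (m : M) (j : ℕ) (f : totalRing m' k τ),
        (f : Polynomial (AddMonoidAlgebra ℂ M)) = Polynomial.monomial j (chi m) →
          δ f = f ⊗ₜ chi (α m + j • c) := by
  obtain ⟨δ, hδ⟩ := exists_restrict_coaction (weightCoaction α c) (totalRing m' k τ) (by
    intro f
    have hf : f ∈ (⊤ : Submodule ℂ (totalRing m' k τ)) := trivial
    rw [← span_totalMonomial hσ m' k hτ] at hf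
    induction hf using Submodule.span_induction with
    | mem f hf =>
      obtain ⟨j, m, h, rfl⟩ := hf
      exact ⟨totalMonomial m' k τ j m h ⊗ₜ chi (α m + j • c),
        (weightCoaction_monomial α c j m).symm⟩
    | zero => exact (map_zero (weightCoaction α c)).symm ▸ zero_mem _
    | add f g _ _ hf hg =>
      exact (map_add (weightCoaction α c) f.1 g.1).symm ▸ add_mem hf hg
    | smul a f _ hf =>
      exact (map_smul (weightCoaction α c) a f.1).symm ▸ Subalgebra.smul_mem _ hf a)
  refine ⟨δ, fun m j f hf => hδ f _ ?_⟩
  rw [hf, weightCoaction_monomial]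

theorem component_totalMonomial (τ : PointedCone ℝ (NR M)) (i j : ℕ) (m : M)
    (h : chi m ∈ sections m' τ (k * j)) : component m' k τ i (totalMonomial m' k τ j m h) =
      if j = i then totalMonomial m' k τ j m h else 0 := by
  apply Subtype.ext
  change Polynomial.monomial i ((Polynomial.monomial j (chi m)).coeff i) = _
  rw [Polynomial.coeff_monomial]
  split_ifs with e
  · subst e
    rfl
  · rw [map_zero]
    rfl

/-- There is a linearization of any given weight. -/
theorem exists_linearization_hasWeight [Module.Finite ℤ M] (hσ : IsRationalCone σ)
    (α : M →ₗ[ℤ] MG) (m' : Fin s → M) (k : ℕ) (c : MG) :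
    ∃ ρ : Linearization α (normalFan (polyhedron σ m')) m' k, ρ.HasWeight c := by
  choose δ hδ using fun τ : normalFan (polyhedron σ m') =>
    exists_totalRing_coaction hσ α m' k c τ.2
  refine ⟨⟨δ, fun τ f => ?_, fun τ f => ?_, fun τ m f hf => ?_, fun τ j f => ?_,
    fun τ τ' h f => ?_⟩, hδ⟩
  · refine LinearMap.congr_fun (f := (TensorProduct.assoc ℂ _ _ _).toLinearMap ∘ₗ
      (δ τ).toLinearMap.rTensor _ ∘ₗ (δ τ).toLinearMap) (g := (Coalgebra.comul (R := ℂ)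
        (A := AddMonoidAlgebra ℂ MG)).lTensor _ ∘ₗ (δ τ).toLinearMap)
      (totalRing_linearMap_ext hσ τ.2 fun j m hm => ?_) f
    exact coassoc_of_eq_tmul_chi (δ τ) (hδ τ m j _ rfl)
  · refine LinearMap.congr_fun (f := (TensorProduct.rid ℂ _).toLinearMap ∘ₗ
      (Coalgebra.counit (R := ℂ) (A := AddMonoidAlgebra ℂ MG)).lTensor _ ∘ₗ (δ τ).toLinearMap)
      (g := LinearMap.id) (totalRing_linearMap_ext hσ τ.2 fun j m hm => ?_) f
    exact counit_of_eq_tmul_chi (δ τ) (hδ τ m j _ rfl)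
  · rw [hδ τ m 0 f hf, zero_smul, add_zero]
  · refine LinearMap.congr_fun (f := (δ τ).toLinearMap ∘ₗ component m' k τ.1 j)
      (g := (component m' k τ.1 j).rTensor _ ∘ₗ (δ τ).toLinearMap)
      (totalRing_linearMap_ext hσ τ.2 fun i m hm => ?_) f
    rw [LinearMap.comp_apply, LinearMap.comp_apply, AlgHom.toLinearMap_apply,
      AlgHom.toLinearMap_apply, hδ τ m i (totalMonomial m' k τ.1 i m hm) rfl,
      LinearMap.rTensor_tmul, component_totalMonomial]
    split_ifs with e
    · rw [hδ τ m i _ rfl]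
    · rw [map_zero, TensorProduct.zero_tmul]
  · refine LinearMap.congr_fun
      (f := (δ τ).toLinearMap ∘ₗ (Subalgebra.inclusion (totalRing_anti m' k h)).toLinearMap)
      (g := (Subalgebra.inclusion (totalRing_anti m' k h)).toLinearMap.rTensor _ ∘ₗ
        (δ τ').toLinearMap)
      (totalRing_linearMap_ext hσ τ'.2 fun i m hm => ?_) f
    rw [LinearMap.comp_apply, LinearMap.comp_apply, AlgHom.toLinearMap_apply,
      AlgHom.toLinearMap_apply]
    have h1 := hδ τ' m i (totalMonomial m' k τ'.1 i m hm) rfl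
    rw [AlgHom.toLinearMap_apply, h1, LinearMap.rTensor_tmul]
    exact hδ τ m i _ rfl

end Weights

end ToricGIT

/-! ### Fractional linearizations -/

namespace ToricGIT

section Fractional

variable {M MG : Type} [AddCommGroup M] [AddCommGroup MG]
variable {α : M →ₗ[ℤ] MG} {σ : PointedCone ℝ (NR M)} {s : ℕ} {m' : Fin s → M}

theorem coe_veronese_monomial {k p : ℕ+} {τ : PointedCone ℝ (NR M)} {j : ℕ} {m : M}
    (f : totalRing m' (k * p : ℕ+) τ)
    (hf : (f : Polynomial (AddMonoidAlgebra ℂ M)) = Polynomial.monomial j (chi m)) :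
    (veronese m' k p τ f : Polynomial (AddMonoidAlgebra ℂ M)) =
      Polynomial.monomial (j * p) (chi m) := by
  change Polynomial.expand (AddMonoidAlgebra ℂ M) p f.1 = _
  rw [hf, Polynomial.expand_monomial]

theorem isTensorPower_of_hasWeight [Module.Finite ℤ M] (hσ : IsRationalCone σ) {k p : ℕ+}
    {ρ : Linearization α (normalFan (polyhedron σ m')) m' k}
    {ρ' : Linearization α (normalFan (polyhedron σ m')) m' (k * p : ℕ+)} {c : MG}
    (h : ρ.HasWeight c) (h' : ρ'.HasWeight ((p : ℕ) • c)) : IsTensorPower ρ ρ' := by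
  intro τ f
  refine LinearMap.congr_fun (f := (ρ.coact τ).toLinearMap ∘ₗ (veronese m' k p τ.1).toLinearMap)
    (g := (veronese m' k p τ.1).toLinearMap.rTensor _ ∘ₗ (ρ'.coact τ).toLinearMap)
    (totalRing_linearMap_ext hσ τ.2 fun j m hm => ?_) f
  rw [LinearMap.comp_apply, LinearMap.comp_apply, AlgHom.toLinearMap_apply,
    AlgHom.toLinearMap_apply, AlgHom.toLinearMap_apply]
  rw [h' τ m j (totalMonomial m' (k * p : ℕ+) τ.1 j m hm) rfl, LinearMap.rTensor_tmul,
    AlgHom.toLinearMap_apply, h τ m (j * p) _ (coe_veronese_monomial _ rfl), mul_smul]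

theorem veronese_totalGenerator_ne_zero {k p : ℕ+} {τ : PointedCone ℝ (NR M)}
    (hτ : τ ≤ normalCone (polyhedron σ m') 0) :
    veronese m' k p τ (totalGenerator m' (k * p : ℕ+) hτ) ≠ 0 := by
  intro h0
  have h1 := congrArg Subtype.val h0
  rw [coe_veronese_monomial _ (j := 1) (m := 0) rfl] at h1
  exact one_ne_zero ((Polynomial.monomial_eq_zero_iff _ _).1 h1)

theorem IsTensorPower.hasWeight [Module.Free ℤ M] [Module.Finite ℤ M]
    [Module.Free ℤ MG] [Module.Finite ℤ MG] {k p : ℕ+}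
    {ρ : Linearization α (normalFan (polyhedron σ m')) m' k}
    {ρ' : Linearization α (normalFan (polyhedron σ m')) m' (k * p : ℕ+)} {c : MG}
    (hρ : IsTensorPower ρ ρ') (h : ρ.HasWeight c) : ρ'.HasWeight ((p : ℕ) • c) := by
  obtain ⟨c', hc'⟩ := ρ'.exists_hasWeight
  suffices e : c' = (p : ℕ) • c from e ▸ hc'
  obtain ⟨τ, hτ⟩ : ∃ τ : normalFan (polyhedron σ m'), τ.1 = normalCone (polyhedron σ m') 0 :=
    ⟨⟨_, polyhedron_normalCone_zero_mem σ m'⟩, rfl⟩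
  have h1 := hρ τ (totalGenerator m' (k * p : ℕ+) hτ.le)
  rw [hc' τ 0 1 _ rfl, LinearMap.rTensor_tmul, AlgHom.toLinearMap_apply,
    h τ 0 (1 * p) _ (coe_veronese_monomial _ rfl)] at h1
  have := tmul_chi_right_injective (veronese_totalGenerator_ne_zero hτ.le) h1
  simpa using this.symm

/-- The weight of a linearization. -/
noncomputable def Linearization.weight [Module.Free ℤ M] [Module.Finite ℤ M]
    [Module.Free ℤ MG] [Module.Finite ℤ MG] {k : ℕ}
    (ρ : Linearization α (normalFan (polyhedron σ m')) m' k) : MG :=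
  ρ.exists_hasWeight.choose

theorem Linearization.hasWeight_weight [Module.Free ℤ M] [Module.Finite ℤ M]
    [Module.Free ℤ MG] [Module.Finite ℤ MG] {k : ℕ}
    (ρ : Linearization α (normalFan (polyhedron σ m')) m' k) : ρ.HasWeight ρ.weight :=
  ρ.exists_hasWeight.choose_spec

theorem sigma_eq_of_hasWeight [Module.Finite ℤ M] (hσ : IsRationalCone σ) {k l : ℕ+} (h : k = l)
    {ρ : Linearization α (normalFan (polyhedron σ m')) m' k}
    {ρ' : Linearization α (normalFan (polyhedron σ m')) m' l} {c : MG}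
    (hρ : ρ.HasWeight c) (hρ' : ρ'.HasWeight c) :
    (⟨k, ρ⟩ : Σ k : ℕ+, Linearization α (normalFan (polyhedron σ m')) m' k) = ⟨l, ρ'⟩ := by
  subst h
  rw [Linearization.eq_of_hasWeight hσ hρ hρ']

/-- Fractional linearizations correspond to rational weights. -/
theorem exists_fractionalLinearization_equiv [Module.Free ℤ M] [Module.Finite ℤ M]
    [Module.Free ℤ MG] [Module.Finite ℤ MG] (hσ : IsRationalCone σ) (α : M →ₗ[ℤ] MG)
    (m' : Fin s → M) :
    ∃ e : FractionalLinearization α (normalFan (polyhedron σ m')) m' ≃ ℚ ⊗[ℤ] MG,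
      ∀ (k : ℕ+) (ρ : Linearization α (normalFan (polyhedron σ m')) m' k) (c : MG),
        ρ.HasWeight c → e ρ.toFractional = (1 / (k : ℚ)) ⊗ₜ[ℤ] c := by
  let f : FractionalLinearization α (normalFan (polyhedron σ m')) m' → ℚ ⊗[ℤ] MG :=
    Quot.lift (fun x => (1 / ((x.1 : ℕ) : ℚ)) ⊗ₜ[ℤ] x.2.weight) (by
      rintro _ _ ⟨k, p, ρ, ρ', h⟩
      have h1 := (h.hasWeight ρ.hasWeight_weight).eq ρ'.hasWeight_weight
      change (1 / ((k : ℕ) : ℚ)) ⊗ₜ[ℤ] ρ.weight = (1 / (((k * p : ℕ+) : ℕ) : ℚ)) ⊗ₜ[ℤ] ρ'.weight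
      rw [inv_tmul_eq_iff, ← h1, PNat.mul_coe, mul_smul])
  have hf : ∀ (k : ℕ+) (ρ : Linearization α (normalFan (polyhedron σ m')) m' k) (c : MG),
      ρ.HasWeight c → f ρ.toFractional = (1 / (k : ℚ)) ⊗ₜ[ℤ] c := by
    intro k ρ c h
    rw [h.eq ρ.hasWeight_weight]
    rfl
  refine ⟨Equiv.ofBijective f ⟨?_, ?_⟩, hf⟩
  · rintro ⟨k, ρ⟩ ⟨l, ρ'⟩ h
    have h1 := hf k ρ _ ρ.hasWeight_weight
    have h2 := hf l ρ' _ ρ'.hasWeight_weight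
    have h3 := h1.symm.trans (h.trans h2)
    rw [inv_tmul_eq_iff] at h3
    -- Compare both linearizations with their powers of exponent `kl`.
    obtain ⟨ρ₁, hρ₁⟩ := exists_linearization_hasWeight hσ α m' (k * l : ℕ+) ((l : ℕ) • ρ.weight)
    obtain ⟨ρ₂, hρ₂⟩ := exists_linearization_hasWeight hσ α m' (l * k : ℕ+) ((k : ℕ) • ρ'.weight)
    have e₁ := Quot.sound (FracRel.power k l ρ ρ₁
      (isTensorPower_of_hasWeight hσ ρ.hasWeight_weight hρ₁))
    have e₂ := Quot.sound (FracRel.power l k ρ' ρ₂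
      (isTensorPower_of_hasWeight hσ ρ'.hasWeight_weight hρ₂))
    exact e₁.trans ((congrArg _ (sigma_eq_of_hasWeight hσ (mul_comm k l) hρ₁ (h3 ▸ hρ₂))).trans
      e₂.symm)
  · intro b
    obtain ⟨d, m, rfl⟩ := exists_eq_inv_tmul b
    obtain ⟨ρ, hρ⟩ := exists_linearization_hasWeight hσ α m' d m
    exact ⟨ρ.toFractional, hf d ρ m hρ⟩

end Fractional

end ToricGIT

/-! ### Invariant monomials -/

namespace ToricGIT

section Invariants

variable {M MG : Type} [AddCommGroup M] [AddCommGroup MG]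
variable {α : M →ₗ[ℤ] MG} {σ : PointedCone ℝ (NR M)} {s : ℕ} {m' : Fin s → M} {k : ℕ}

/-- The coefficient of `χ^m T^j` of a function on the total space. -/
noncomputable def monomialCoeff (m' : Fin s → M) (k : ℕ) (τ : PointedCone ℝ (NR M)) (j : ℕ)
    (m : M) : totalRing m' k τ →ₗ[ℂ] ℂ :=
  ((Finsupp.lapply m).comp (AddMonoidAlgebra.coeffLinearEquiv ℂ).toLinearMap) ∘ₗ
    totalCoeff m' k τ j

theorem monomialCoeff_apply {τ : PointedCone ℝ (NR M)} (j : ℕ) (m : M) (f : totalRing m' k τ) :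
    monomialCoeff m' k τ j m f = ((f : Polynomial (AddMonoidAlgebra ℂ M)).coeff j).coeff m :=
  rfl

theorem chi_ne_zero (m : M) : (chi m : AddMonoidAlgebra ℂ M) ≠ 0 := by
  intro h
  have := congrArg (fun f => AddMonoidAlgebra.coeff f m) h
  simp [chi] at this

open Classical in
theorem coeff_coeff_monomial_chi (i j : ℕ) (m n : M) :
    ((Polynomial.monomial i (chi m : AddMonoidAlgebra ℂ M)).coeff j).coeff n =
      if i = j ∧ m = n then 1 else 0 := by
  rw [Polynomial.coeff_monomial]
  by_cases h : i = j
  · by_cases h' : m = n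
    · simp [h, h', chi]
    · simp [h, h', chi]
  · simp [h]

/-- Taking the coefficient of `χ^m T^j` is semi-invariant, of the weight of that monomial. -/
theorem Linearization.HasWeight.rTensor_monomialCoeff [Module.Finite ℤ M] (hσ : IsRationalCone σ)
    {ρ : Linearization α (normalFan (polyhedron σ m')) m' k} {c : MG} (h : ρ.HasWeight c)
    (τ : normalFan (polyhedron σ m')) (j : ℕ) (m : M) (f : totalRing m' k τ.1) :
    (monomialCoeff m' k τ.1 j m).rTensor _ (ρ.coact τ f) =
      monomialCoeff m' k τ.1 j m f ⊗ₜ chi (α m + j • c) := by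
  classical
  refine LinearMap.congr_fun
    (f := (monomialCoeff m' k τ.1 j m).rTensor _ ∘ₗ (ρ.coact τ).toLinearMap)
    (g := (TensorProduct.mk ℂ ℂ (AddMonoidAlgebra ℂ MG)).flip (chi (α m + j • c)) ∘ₗ
      monomialCoeff m' k τ.1 j m) (totalRing_linearMap_ext hσ τ.2 fun i n hn => ?_) f
  rw [LinearMap.comp_apply, LinearMap.comp_apply, AlgHom.toLinearMap_apply,
    h τ n i (totalMonomial m' k τ.1 i n hn) rfl, LinearMap.rTensor_tmul, LinearMap.flip_apply,
    TensorProduct.mk_apply, monomialCoeff_apply]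
  change ((Polynomial.monomial i (chi n : AddMonoidAlgebra ℂ M)).coeff j).coeff m ⊗ₜ _ =
    ((Polynomial.monomial i (chi n : AddMonoidAlgebra ℂ M)).coeff j).coeff m ⊗ₜ _
  rw [coeff_coeff_monomial_chi]
  split_ifs with e
  · rw [e.1, e.2]
  · rw [TensorProduct.zero_tmul, TensorProduct.zero_tmul]

/-- `χ^m T^j` is invariant if and only if it is a global section of weight `0`. -/
theorem Linearization.HasWeight.monomial_mem_invariants_iff
    {ρ : Linearization α (normalFan (polyhedron σ m')) m' k} {c : MG}
    (h : ρ.HasWeight c) (j : ℕ) (m : M) :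
    Polynomial.monomial j (chi m) ∈ ρ.invariants ↔
      (∀ τ ∈ normalFan (polyhedron σ m'), chi m ∈ sections m' τ (k * j)) ∧ α m + j • c = 0 := by
  constructor
  · intro hf
    refine ⟨fun τ hτ => ?_, ?_⟩
    · obtain ⟨h1, -⟩ := hf ⟨τ, hτ⟩
      exact coeff_monomial_mem ⟨_, h1⟩ rfl
    · obtain ⟨h1, h2⟩ := hf ⟨_, polyhedron_normalCone_zero_mem σ m'⟩
      rw [h _ m j ⟨_, h1⟩ rfl] at h2
      refine tmul_chi_right_injective (fun h0 => ?_) h2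
      exact chi_ne_zero m ((Polynomial.monomial_eq_zero_iff _ _).1 (congrArg Subtype.val h0))
  · rintro ⟨h1, h2⟩ τ
    refine ⟨(totalMonomial m' k τ.1 j m (h1 _ τ.2)).2, ?_⟩
    have h3 := h τ m j (totalMonomial m' k τ.1 j m (h1 _ τ.2)) rfl
    rw [h2] at h3
    exact h3

/-- The monomials that occur in an invariant are invariants. -/
theorem Linearization.HasWeight.monomial_mem_of_mem [Module.Finite ℤ M]
    (hσ : IsRationalCone σ) {ρ : Linearization α (normalFan (polyhedron σ m')) m' k} {c : MG}
    (h : ρ.HasWeight c) {f : Polynomial (AddMonoidAlgebra ℂ M)} (hf : f ∈ ρ.invariants) {j : ℕ}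
    {m : M} (hm : (f.coeff j).coeff m ≠ 0) : Polynomial.monomial j (chi m) ∈ ρ.invariants := by
  rw [h.monomial_mem_invariants_iff]
  refine ⟨fun τ hτ => ?_, ?_⟩
  · obtain ⟨h1, -⟩ := hf ⟨τ, hτ⟩
    have h2 := h1 j
    rw [sections_eq_span hσ hτ, mem_span_chi_iff] at h2
    exact h2 m hm
  · obtain ⟨h1, h2⟩ := hf ⟨_, polyhedron_normalCone_zero_mem σ m'⟩
    have h3 := h.rTensor_monomialCoeff hσ _ j m ⟨f, h1⟩
    rw [h2, LinearMap.rTensor_tmul] at h3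
    exact (tmul_chi_right_injective (w := 0) hm h3).symm

/-- The invariants of a linearization are spanned by monomials, and the invariant monomials of
degree `j > 0` are the lattice points of the polyhedron `kj (Q + x₀)`. -/
structure Linearization.HasMonomialInvariants {F : Set (PointedCone ℝ (NR M))}
    (ρ : Linearization α F m' k) (x₀ : ℚ ⊗[ℤ] M) (Q : Set (MR (LinearMap.ker α))) : Prop where
  pos : 0 < k
  /-- The monomials that occur in an invariant are invariant. -/
  monomial_mem {f : Polynomial (AddMonoidAlgebra ℂ M)} (hf : f ∈ ρ.invariants) {j : ℕ} {m : M}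
    (hm : (f.coeff j).coeff m ≠ 0) : Polynomial.monomial j (chi m) ∈ ρ.invariants
  /-- In positive degree, the invariant monomials are lattice points of a polyhedron. -/
  mem_iff {j : ℕ} (hj : 0 < j) (m : M) : Polynomial.monomial j (chi m) ∈ ρ.invariants ↔
    ∃ y ∈ Q, pt m = ((k * j : ℕ) : ℝ) • (kerInclusion α y + ratToReal M x₀)

theorem Linearization.HasWeight.hasMonomialInvariants [Module.Free ℤ M] [Module.Finite ℤ M]
    [Module.Free ℤ MG] (hα : Function.Surjective α)
    (hσ : IsRationalCone σ) {k : ℕ+} {ρ : Linearization α (normalFan (polyhedron σ m')) m' k}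
    {c : MG} (h : ρ.HasWeight c) {x₀ : ℚ ⊗[ℤ] M}
    (hx₀ : α.lTensor ℚ x₀ = -((1 / (k : ℚ)) ⊗ₜ[ℤ] c)) :
    ρ.HasMonomialInvariants x₀ (kerSlice α (polyhedron σ m') ((1 / (k : ℚ)) ⊗ₜ[ℤ] c) x₀) where
  pos := k.pos
  monomial_mem hf _ _ hm := h.monomial_mem_of_mem hσ hf hm
  mem_iff {j} hj m := by
    have hn : 0 < (k : ℕ) * j := mul_pos k.pos hj
    have hn' : (((k : ℕ) * j : ℕ) : ℝ) ≠ 0 := Nat.cast_ne_zero.2 hn.ne'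
    have hk' : ((k : ℕ) : ℝ) ≠ 0 := Nat.cast_ne_zero.2 k.pos.ne'
    have hb := bijOn_kerSlice hα (polyhedron σ m') hx₀
    have e : ((((k : ℕ) * j : ℕ) : ℝ)) • ratToReal MG ((1 / (k : ℚ)) ⊗ₜ[ℤ] c) = pt (j • c) := by
      rw [ratToReal_tmul, smul_smul, pt_nsmul]
      congr 1
      push_cast
      field_simp
    rw [h.monomial_mem_invariants_iff, forall_chi_mem_sections_iff hσ hn]
    constructor
    · rintro ⟨h1, h2⟩
      obtain ⟨y, hy, hy'⟩ := hb.surjOn (show _ ∈ slice α (polyhedron σ m') _ from ⟨h1, by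
        change α.baseChange ℝ _ = _
        rw [map_smul, baseChange_pt, eq_neg_of_add_eq_zero_left h2, pt_neg, ← e, smul_neg,
          inv_smul_smul₀ hn']⟩)
      refine ⟨y, hy, ?_⟩
      change kerInclusion α y + ratToReal M x₀ = _ at hy'
      rw [hy', smul_inv_smul₀ hn']
    · rintro ⟨y, hy, hy'⟩
      have h1 := hb.mapsTo hy
      rw [hy', inv_smul_smul₀ hn']
      refine ⟨h1.1, ?_⟩
      have h2 : α.baseChange ℝ (kerInclusion α y + ratToReal M x₀) = _ := h1.2
      apply pt_injective
      rw [pt_zero, pt_add, ← baseChange_pt, hy', map_smul, h2, smul_neg, e, neg_add_cancel]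

end Invariants

end ToricGIT

/-! ### Affine charts of the quotient -/

namespace ToricGIT

section AwayEval

variable {A B : Type} [CommRing A] [Algebra ℂ A] (𝒜 : ℕ → Submodule ℂ A) [GradedAlgebra 𝒜]
  [CommRing B] (ev : A →+* B)

/-- The evaluation of fractions of degree zero with denominators the powers of `f`, where a ring
homomorphism `ev` sends `f` to a unit. -/
noncomputable def awayEval {f : A} (hf : IsUnit (ev f)) :
    HomogeneousLocalization.Away 𝒜 f →+* B :=
  (IsLocalization.Away.lift (S := Localization.Away f) f hf).comp
    (algebraMap (HomogeneousLocalization.Away 𝒜 f) (Localization.Away f))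

theorem awayEval_apply {f : A} (hf : IsUnit (ev f)) (z : HomogeneousLocalization.Away 𝒜 f) :
    awayEval 𝒜 ev hf z = IsLocalization.Away.lift (S := Localization.Away f) f hf z.val :=
  rfl

theorem awayEval_mk {f : A} (hf : IsUnit (ev f)) {j : ℕ} (hfj : f ∈ 𝒜 j) (i : ℕ) (g : A)
    (hg : g ∈ 𝒜 (i • j)) :
    awayEval 𝒜 ev hf (HomogeneousLocalization.Away.mk 𝒜 hfj i g hg) * ev f ^ i = ev g := by
  rw [awayEval_apply, HomogeneousLocalization.Away.val_mk, ← map_pow,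
    ← IsLocalization.Away.lift_eq (S := Localization.Away f) f hf (f ^ i),
    ← IsLocalization.Away.lift_eq (S := Localization.Away f) f hf g, ← map_mul,
    Localization.mk_eq_mk']
  exact congrArg _ (IsLocalization.mk'_spec (Localization.Away f) g
    (⟨f ^ i, i, rfl⟩ : Submonoid.powers f))

theorem awayEval_awayMap {f g x : A} {e : ℕ} (hg : g ∈ 𝒜 e) (hx : x = f * g)
    (hf : IsUnit (ev f)) (hx' : IsUnit (ev x)) (z : HomogeneousLocalization.Away 𝒜 f) :
    awayEval 𝒜 ev hx' (HomogeneousLocalization.awayMap 𝒜 hg hx z) = awayEval 𝒜 ev hf z := by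
  rw [awayEval_apply, awayEval_apply, HomogeneousLocalization.val_awayMap]
  refine RingHom.congr_fun (f := (IsLocalization.Away.lift (S := Localization.Away x) x hx').comp
    (Localization.awayLift _ _ _)) (g := IsLocalization.Away.lift _ hf) ?_ z.val
  refine IsLocalization.ringHom_ext (Submonoid.powers f) (RingHom.ext fun a => ?_)
  simp [Localization.awayLift, IsLocalization.Away.lift_eq]

theorem awayEval_fromZeroRingHom {f : A} (hf : IsUnit (ev f)) (a : 𝒜 0) :
    awayEval 𝒜 ev hf (HomogeneousLocalization.fromZeroRingHom 𝒜 _ a) = ev a := by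
  rw [awayEval_apply]
  change IsLocalization.Away.lift (S := Localization.Away f) f hf (Localization.mk (a : A) 1) = _
  rw [Localization.mk_one_eq_algebraMap, IsLocalization.Away.lift_eq]

end AwayEval

/-- Injective ring homomorphisms with the same range have isomorphic sources. -/
theorem exists_ringEquiv_of_range_eq {A B C : Type} [CommRing A] [CommRing B] [CommRing C]
    (ψ : A →+* C) (ι : B →+* C) (hψ : Function.Injective ψ) (hι : Function.Injective ι)
    (h1 : ∀ a, ∃ b, ι b = ψ a) (h2 : ∀ b, ∃ a, ψ a = ι b) :
    ∃ φ : A ≃+* B, ∀ a, ι (φ a) = ψ a := by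
  choose φ hφ using h1
  let φ' : A →+* B :=
    { toFun := φ
      map_one' := hι (by rw [hφ, map_one, map_one])
      map_mul' := fun a b => hι (by rw [hφ, map_mul, map_mul, hφ, hφ])
      map_zero' := hι (by rw [hφ, map_zero, map_zero])
      map_add' := fun a b => hι (by rw [hφ, map_add, map_add, hφ, hφ]) }
  refine ⟨RingEquiv.ofBijective φ' ⟨fun a b hab => hψ ?_, fun b => ?_⟩, hφ⟩
  · rw [← hφ, ← hφ]
    exact congrArg ι hab
  · obtain ⟨a, ha⟩ := h2 b
    exact ⟨a, hι ((hφ a).trans ha)⟩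

section Charts

variable {M MG : Type} [AddCommGroup M] [AddCommGroup MG]
variable {α : M →ₗ[ℤ] MG} {F : Set (PointedCone ℝ (NR M))} {s : ℕ} {m' : Fin s → M} {k : ℕ}

theorem isUnit_chi (m : M) : IsUnit (chi m : AddMonoidAlgebra ℂ M) :=
  .of_mul_eq_one (chi (-m)) (by rw [chi_mul_chi, add_neg_cancel, chi_zero])

theorem chi_pow (m : M) (i : ℕ) : (chi m : AddMonoidAlgebra ℂ M) ^ i = chi (i • m) := by
  simp [chi, AddMonoidAlgebra.single_pow]

/-- The inclusion `ℂ[τ^∨ ∩ Ker α] ⊆ ℂ[M]`. -/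
noncomputable def chartInclusion (α : M →ₗ[ℤ] MG) (τ : PointedCone ℝ (NR (LinearMap.ker α))) :
    AddMonoidAlgebra ℂ (chartMonoid τ) →+* AddMonoidAlgebra ℂ M :=
  AddMonoidAlgebra.mapDomainRingHom ℂ
    ((LinearMap.ker α).subtype.toAddMonoidHom.comp (chartMonoid τ).subtype)

theorem mapDomain_eq_chartInclusion (τ : PointedCone ℝ (NR (LinearMap.ker α)))
    (f : AddMonoidAlgebra ℂ (chartMonoid τ)) :
    AddMonoidAlgebra.mapDomain (fun p : chartMonoid τ => ((p : LinearMap.ker α) : M)) f =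
      chartInclusion α τ f :=
  rfl

theorem chartInclusion_single (τ : PointedCone ℝ (NR (LinearMap.ker α))) (p : chartMonoid τ)
    (a : ℂ) : chartInclusion α τ (AddMonoidAlgebra.single p a) =
      AddMonoidAlgebra.single ((p : LinearMap.ker α) : M) a := by
  simp [chartInclusion]

theorem chartInclusion_injective (τ : PointedCone ℝ (NR (LinearMap.ker α))) :
    Function.Injective (chartInclusion α τ) :=
  AddMonoidAlgebra.mapDomain_injective
    (Subtype.val_injective.comp Subtype.val_injective)

theorem exists_chartInclusion_eq (τ : PointedCone ℝ (NR (LinearMap.ker α)))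
    (f : AddMonoidAlgebra ℂ M)
    (hf : ∀ m, f.coeff m ≠ 0 → ∃ p : chartMonoid τ, ((p : LinearMap.ker α) : M) = m) :
    ∃ g, chartInclusion α τ g = f := by
  rw [eq_sum_smul_chi f]
  have h : ∀ m ∈ f.coeff.support, f.coeff m • chi m ∈ (chartInclusion α τ).range := by
    intro m hm
    obtain ⟨p, rfl⟩ := hf m (Finsupp.mem_support_iff.1 hm)
    refine ⟨AddMonoidAlgebra.single p (f.coeff ((p : LinearMap.ker α) : M)), ?_⟩
    rw [chartInclusion_single]
    simp [chi]
  exact sum_mem h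

theorem chartInclusion_mapDomain_inclusion {τ τ' : PointedCone ℝ (NR (LinearMap.ker α))}
    (h : τ ≤ τ') (f : AddMonoidAlgebra ℂ (chartMonoid τ')) :
    chartInclusion α τ (AddMonoidAlgebra.mapDomainRingHom ℂ
      (AddSubmonoid.inclusion (chartMonoid_anti h)) f) = chartInclusion α τ' f := by
  rw [chartInclusion, chartInclusion, ← RingHom.comp_apply,
    ← AddMonoidAlgebra.mapDomainRingHom_comp]
  rfl

/-- The value of an invariant at `T = 1`. -/
noncomputable def Linearization.evalOne (ρ : Linearization α F m' k) :
    ρ.InvariantRing →+* AddMonoidAlgebra ℂ M :=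
  (Polynomial.evalRingHom 1).comp ρ.toPolynomial.toRingHom

theorem Linearization.toPolynomial_eq_monomial {ρ : Linearization α F m' k} {j : ℕ}
    {g : ρ.InvariantRing} (hg : g ∈ ρ.grading j) :
    ρ.toPolynomial g = Polynomial.monomial j ((ρ.toPolynomial g).coeff j) := by
  ext1 i
  rw [Polynomial.coeff_monomial]
  split_ifs with h
  · rw [h]
  · exact hg i (Ne.symm h)

theorem Linearization.evalOne_of_mem {ρ : Linearization α F m' k} {j : ℕ}
    {g : ρ.InvariantRing} (hg : g ∈ ρ.grading j) :
    ρ.evalOne g = (ρ.toPolynomial g).coeff j := by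
  change Polynomial.eval 1 (ρ.toPolynomial g) = _
  rw [toPolynomial_eq_monomial hg, Polynomial.eval_monomial, one_pow, mul_one,
    Polynomial.coeff_monomial, if_pos rfl]

theorem Linearization.eq_zero_of_evalOne_eq_zero {ρ : Linearization α F m' k} {j : ℕ}
    {g : ρ.InvariantRing} (hg : g ∈ ρ.grading j) (h : ρ.evalOne g = 0) : g = 0 := by
  apply ρ.toPolynomial_injective
  rw [toPolynomial_eq_monomial hg, ← evalOne_of_mem hg, h, map_zero, map_zero]

/-- A monomial invariant `χ^m T^j`, `j > 0`, where `m = kj(x + x₀)` for a point `x` of `Q` with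
normal cone `τ`. -/
structure Linearization.ChartSection (ρ : Linearization α F m' k) (x₀ : ℚ ⊗[ℤ] M)
    (Q : Set (MR (LinearMap.ker α))) (τ : PointedCone ℝ (NR (LinearMap.ker α))) where
  /-- The point of the polyhedron. -/
  x : MR (LinearMap.ker α)
  mem : x ∈ Q
  cone_eq : τ = normalCone Q x
  /-- The degree. -/
  j : ℕ
  pos : 0 < j
  /-- The exponent. -/
  m : M
  /-- The invariant. -/
  f : ρ.InvariantRing
  f_mem : f ∈ ρ.grading j
  f_eq : ρ.toPolynomial f = Polynomial.monomial j (chi m)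
  pt_eq : pt m = ((k * j : ℕ) : ℝ) • (kerInclusion α x + ratToReal M x₀)

namespace Linearization.ChartSection

variable {ρ : Linearization α F m' k} {x₀ : ℚ ⊗[ℤ] M} {Q : Set (MR (LinearMap.ker α))}
  {τ τ' : PointedCone ℝ (NR (LinearMap.ker α))}

theorem evalOne_f (D : ρ.ChartSection x₀ Q τ) : ρ.evalOne D.f = chi D.m := by
  rw [evalOne_of_mem D.f_mem, D.f_eq, Polynomial.coeff_monomial, if_pos rfl]

theorem isUnit_evalOne_f (D : ρ.ChartSection x₀ Q τ) : IsUnit (ρ.evalOne D.f) :=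
  D.evalOne_f ▸ isUnit_chi D.m

theorem awayEval_mk_mul_chi (D : ρ.ChartSection x₀ Q τ) (i : ℕ) (g : ρ.InvariantRing)
    (hg : g ∈ ρ.grading (i • D.j)) :
    awayEval ρ.grading ρ.evalOne D.isUnit_evalOne_f
      (HomogeneousLocalization.Away.mk ρ.grading D.f_mem i g hg) * chi (i • D.m) =
        (ρ.toPolynomial g).coeff (i • D.j) := by
  rw [← evalOne_of_mem hg, ← awayEval_mk ρ.grading ρ.evalOne D.isUnit_evalOne_f D.f_mem i g hg,
    D.evalOne_f, chi_pow]

/-- Evaluation at `T = 1` loses nothing on fractions of degree zero. -/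
theorem awayEval_injective (D : ρ.ChartSection x₀ Q τ) :
    Function.Injective (awayEval ρ.grading ρ.evalOne D.isUnit_evalOne_f) := by
  rw [injective_iff_map_eq_zero]
  intro z hz
  obtain ⟨i, g, hg, rfl⟩ := HomogeneousLocalization.Away.mk_surjective ρ.grading D.f_mem z
  have h := awayEval_mk ρ.grading ρ.evalOne D.isUnit_evalOne_f D.f_mem i g hg
  rw [hz, zero_mul] at h
  exact HomogeneousLocalization.mk_eq_zero_of_num _
    (Subtype.ext (eq_zero_of_evalOne_eq_zero hg h.symm))

end Linearization.ChartSection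

end Charts

end ToricGIT

/-! ### Gluing along directed open covers -/

namespace ToricGIT

section Gluing

open CategoryTheory.Limits

/-- A scheme is the colimit of open subschemes which cover it, and whose pairwise intersections are
covered by members of the family. -/
theorem nonempty_isColimit_of_isOpenImmersion {S : Scheme.{0}} {J : Type} [Category.{0} J]
    (D : J ⥤ Over S) (Y : Over S) (charts : D ⟶ (Functor.const J).obj Y)
    (hopen : ∀ i, IsOpenImmersion (charts.app i).left)
    (hcover : ∀ y : Y.left, ∃ i, y ∈ Set.range (charts.app i).left)
    (hdir : ∀ i j, ∃ (l : J) (_ : l ⟶ i) (_ : l ⟶ j), Set.range (charts.app i).left ∩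
      Set.range (charts.app j).left ⊆ Set.range (charts.app l).left) :
    Nonempty (IsColimit (Cocone.mk Y charts)) := by
  have hw : ∀ {i j : J} (a : i ⟶ j),
      (D.map a).left ≫ (charts.app j).left = (charts.app i).left := by
    intro i j a
    rw [← Over.comp_left, charts.naturality]
    simp
  let 𝒰 : Y.left.OpenCover :=
    { I₀ := J
      X := fun i => (D.obj i).left
      f := fun i => (charts.app i).left
      mem₀ := by
        rw [Scheme.presieve₀_mem_precoverage_iff]
        exact ⟨hcover, hopen⟩ }
  let : Category 𝒰.I₀ := inferInstanceAs (Category J)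
  have : ∀ i, IsOpenImmersion (𝒰.f i) := hopen
  let : Scheme.Cover.LocallyDirected 𝒰 :=
    { trans := fun {i j} a => (D.map (X := i) (Y := j) a).left
      trans_id := fun i => by
        change (D.map (𝟙 _)).left = _
        rw [D.map_id]
        rfl
      trans_comp := fun a b => by
        change (D.map (_ ≫ _)).left = _
        rw [D.map_comp]
        rfl
      w := fun a => hw a
      directed := fun {i j} x => by
        obtain ⟨l, a, b, h⟩ := hdir i j
        have hx1 : (pullback.fst (𝒰.f i) (𝒰.f j) ≫ 𝒰.f i) x ∈ Set.range (𝒰.f i) :=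
          ⟨pullback.fst (𝒰.f i) (𝒰.f j) x, by rw [Scheme.Hom.comp_apply]⟩
        have hx2 : (pullback.fst (𝒰.f i) (𝒰.f j) ≫ 𝒰.f i) x ∈ Set.range (𝒰.f j) :=
          ⟨pullback.snd (𝒰.f i) (𝒰.f j) x, by rw [pullback.condition, Scheme.Hom.comp_apply]⟩
        obtain ⟨y, hy⟩ := h ⟨hx1, hx2⟩
        refine ⟨l, a, b, y, ?_⟩
        apply (pullback.fst (𝒰.f i) (𝒰.f j) ≫ 𝒰.f i).isOpenEmbedding.injective
        rw [← Scheme.Hom.comp_apply, pullback.lift_fst_assoc, ← hy]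
        exact congrArg (fun (t : (D.obj l).left ⟶ Y.left) => t y) (hw a)
      property_trans := fun {i j} a => by
        have : IsOpenImmersion ((D.map (X := i) (Y := j) a).left ≫ (charts.app j).left) := by
          rw [hw]
          exact hopen i
        have := hopen j
        exact IsOpenImmersion.of_comp _ (charts.app j).left }
  refine ⟨{ desc := fun t => 𝒰.glueMorphismsOverOfLocallyDirected
              (fun i => (t.ι.app i).left) (fun {i j} a => ?_) (fun i => ?_)
            fac := fun t i => ?_
            uniq := fun t u hu => ?_ }⟩
  · change (D.map _).left ≫ _ = _
    rw [← Over.comp_left, t.w]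
  · exact (Over.w (t.ι.app i)).trans (Over.w (charts.app i)).symm
  · apply Over.OverMorphism.ext
    exact 𝒰.map_glueMorphismsOverOfLocallyDirected_left _ _ _ i
  · apply Over.OverMorphism.ext
    refine 𝒰.hom_ext _ _ fun i => ?_
    rw [𝒰.map_glueMorphismsOverOfLocallyDirected_left, ← hu i]
    rfl

end Gluing

end ToricGIT

/-! ### The charts of the quotient are toric -/

namespace ToricGIT

section Charts

variable {M MG : Type} [AddCommGroup M] [AddCommGroup MG]
variable {α : M →ₗ[ℤ] MG} {F : Set (PointedCone ℝ (NR M))} {s : ℕ} {m' : Fin s → M} {k : ℕ}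
variable {ρ : Linearization α F m' k} {x₀ : ℚ ⊗[ℤ] M} {Q : Set (MR (LinearMap.ker α))}
  {τ τ' : PointedCone ℝ (NR (LinearMap.ker α))}

theorem Linearization.exists_toPolynomial_eq {j : ℕ} {m : M}
    (h : Polynomial.monomial j (chi m) ∈ ρ.invariants) :
    ∃ f ∈ ρ.grading j, ρ.toPolynomial f = Polynomial.monomial j (chi m) := by
  refine ⟨⟨_, h⟩, fun i hi => ?_, rfl⟩
  change (Polynomial.monomial j (chi m)).coeff i = 0
  rw [Polynomial.coeff_monomial, if_neg (Ne.symm hi)]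

namespace Linearization.ChartSection

theorem monomial_mem (D : ρ.ChartSection x₀ Q τ) :
    Polynomial.monomial D.j (chi D.m) ∈ ρ.invariants :=
  D.f_eq ▸ D.f.2

/-- If `χ^n T^(ij)` is an invariant, then `χ^n / χ^(im)` is a monomial on the chart. -/
theorem exists_mem_chartMonoid [Module.Free ℤ M] [Module.Free ℤ MG]
    (h : ρ.HasMonomialInvariants x₀ Q)
    (D : ρ.ChartSection x₀ Q τ) {i : ℕ} {n : M}
    (hn : Polynomial.monomial (i * D.j) (chi n) ∈ ρ.invariants) :
    ∃ p : chartMonoid τ, ((p : LinearMap.ker α) : M) = n - i • D.m := by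
  -- Multiplication by `χ^m T^j` makes the degree positive.
  have hn' : Polynomial.monomial ((i + 1) * D.j) (chi (n + D.m)) ∈ ρ.invariants := by
    have h1 := mul_mem hn D.monomial_mem
    rwa [Polynomial.monomial_mul_monomial, chi_mul_chi, ← Nat.succ_mul] at h1
  obtain ⟨y, hy, hpt⟩ := (h.mem_iff (Nat.mul_pos i.succ_pos D.pos) _).1 hn'
  have e : pt (n - i • D.m) = ((k * ((i + 1) * D.j) : ℕ) : ℝ) • kerInclusion α (y - D.x) := by
    have e1 : n - i • D.m = n + D.m - (i + 1) • D.m := by rw [succ_nsmul]; abel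
    rw [e1, pt_sub, pt_nsmul, hpt, D.pt_eq, smul_smul, map_sub]
    have e2 : (((i + 1 : ℕ) : ℝ) * ((k * D.j : ℕ) : ℝ)) = ((k * ((i + 1) * D.j) : ℕ) : ℝ) := by
      push_cast
      ring
    rw [e2, ← smul_sub]
    congr 1
    abel
  have hker : α (n - i • D.m) = 0 := by
    apply pt_injective
    rw [← baseChange_pt, e, map_smul, baseChange_kerInclusion, smul_zero, pt_zero]
  refine ⟨⟨⟨_, hker⟩, ?_⟩, rfl⟩
  rw [mem_chartMonoid_iff]
  intro u hu
  have e' : pt (⟨_, hker⟩ : LinearMap.ker α) = ((k * ((i + 1) * D.j) : ℕ) : ℝ) • (y - D.x) := by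
    apply kerInclusion_injective α
    rw [kerInclusion_pt, map_smul]
    exact e
  rw [e', map_smul, map_sub, smul_eq_mul]
  rw [D.cone_eq] at hu
  exact mul_nonneg (Nat.cast_nonneg _) (sub_nonneg.2 (hu y hy))

/-- Every monomial on the chart becomes an invariant after multiplication by a power of
`χ^m T^j`. -/
theorem exists_monomial_mem [Module.Finite ℤ (LinearMap.ker α)]
    (h : ρ.HasMonomialInvariants x₀ Q) (hQ : IsFractionalLatticePolyhedron Q)
    (D : ρ.ChartSection x₀ Q τ) (p : chartMonoid τ) :
    ∃ i : ℕ, Polynomial.monomial (i * D.j) (chi (((p : LinearMap.ker α) : M) + i • D.m)) ∈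
      ρ.invariants := by
  obtain ⟨ε, hε, hmem⟩ := hQ.exists_add_smul_mem D.mem (q := pt (p : LinearMap.ker α))
    (D.cone_eq ▸ p.2)
  obtain ⟨i, hi⟩ := exists_nat_gt ε⁻¹
  have hi0 : 0 < i := Nat.cast_pos.1 ((inv_pos.2 hε).trans hi)
  have hn : 0 < k * (i * D.j) := Nat.mul_pos h.pos (Nat.mul_pos hi0 D.pos)
  have hn' : (0 : ℝ) < ((k * (i * D.j) : ℕ) : ℝ) := Nat.cast_pos.2 hn
  have hle : (i : ℝ) ≤ ((k * (i * D.j) : ℕ) : ℝ) := by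
    have : i ≤ k * (i * D.j) := by
      have := Nat.mul_pos h.pos D.pos
      calc i = i * 1 := (mul_one i).symm
        _ ≤ i * (k * D.j) := Nat.mul_le_mul_left i this
        _ = k * (i * D.j) := by ring
    exact_mod_cast this
  refine ⟨i, (h.mem_iff (Nat.mul_pos hi0 D.pos) _).2
    ⟨_, hmem (((k * (i * D.j) : ℕ) : ℝ)⁻¹) (inv_nonneg.2 hn'.le) ?_, ?_⟩⟩
  · rw [inv_le_comm₀ hn' hε]
    exact hi.le.trans hle
  · have e2 : ((i : ℝ) * ((k * D.j : ℕ) : ℝ)) = ((k * (i * D.j) : ℕ) : ℝ) := by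
      push_cast
      ring
    rw [pt_add, pt_nsmul, D.pt_eq, map_add, map_smul, kerInclusion_pt, smul_smul, e2,
      add_right_comm, smul_add _ (_ + _) (_ • _), smul_inv_smul₀ hn'.ne', add_comm]

/-- The coordinate ring of `D₊(f)` is `ℂ[τ^∨ ∩ Ker α]`: both are identified, by evaluation at
`T = 1` and by inclusion, with the same subring of `ℂ[M]`. -/
theorem exists_equiv [Module.Free ℤ M] [Module.Free ℤ MG] [Module.Finite ℤ (LinearMap.ker α)]
    (h : ρ.HasMonomialInvariants x₀ Q) (hQ : IsFractionalLatticePolyhedron Q)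
    (D : ρ.ChartSection x₀ Q τ) :
    ∃ φ : HomogeneousLocalization.Away ρ.grading D.f ≃+* AddMonoidAlgebra ℂ (chartMonoid τ),
      ∀ z, chartInclusion α τ (φ z) = awayEval ρ.grading ρ.evalOne D.isUnit_evalOne_f z := by
  refine exists_ringEquiv_of_range_eq _ _ D.awayEval_injective (chartInclusion_injective τ)
    (fun z => ?_) (fun g => ?_)
  · obtain ⟨i, g, hg, rfl⟩ := HomogeneousLocalization.Away.mk_surjective ρ.grading D.f_mem z
    have h1 := D.awayEval_mk_mul_chi i g hg
    refine exists_chartInclusion_eq τ _ fun n hn => ?_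
    have h2 : ((ρ.toPolynomial g).coeff (i • D.j)).coeff (n + i • D.m) ≠ 0 := by
      rw [← h1, AddMonoidAlgebra.coeff_mul_single_add, mul_one]
      exact hn
    obtain ⟨p, hp⟩ := D.exists_mem_chartMonoid h (h.monomial_mem g.2 h2)
    exact ⟨p, by rw [hp, add_sub_cancel_right]⟩
  · induction g using AddMonoidAlgebra.induction_linear with
    | zero => exact ⟨0, by rw [map_zero, map_zero]⟩
    | add g g' hg hg' =>
      obtain ⟨z, hz⟩ := hg
      obtain ⟨z', hz'⟩ := hg'
      exact ⟨z + z', by rw [map_add, map_add, hz, hz']⟩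
    | single p a =>
      obtain ⟨i, hi⟩ := D.exists_monomial_mem h hQ p
      obtain ⟨f, hf, hf'⟩ := exists_toPolynomial_eq hi
      refine ⟨HomogeneousLocalization.Away.mk ρ.grading D.f_mem i (a • f)
        (Submodule.smul_mem _ a (smul_eq_mul i D.j ▸ hf)), ?_⟩
      apply (isUnit_chi (i • D.m)).mul_right_cancel
      rw [D.awayEval_mk_mul_chi, map_smul, hf', smul_eq_mul, Polynomial.coeff_smul,
        Polynomial.coeff_monomial, if_pos rfl, chartInclusion_single, ← chi_mul_chi,
        ← smul_mul_assoc]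
      simp [chi]

/-- An isomorphism of the coordinate ring of `D₊(f)` with `ℂ[τ^∨ ∩ Ker α]` is monomial if it sends
`χ^p T^(ij) / f^i` to `χ^(p - im)`. -/
def IsMonomialEquiv (D : ρ.ChartSection x₀ Q τ)
    (φ : HomogeneousLocalization.Away ρ.grading D.f ≃+* AddMonoidAlgebra ℂ (chartMonoid τ)) :
    Prop :=
  ∀ z, chartInclusion α τ (φ z) = awayEval ρ.grading ρ.evalOne D.isUnit_evalOne_f z

theorem IsMonomialEquiv.mapDomain_mul_chi {D : ρ.ChartSection x₀ Q τ}
    {φ : HomogeneousLocalization.Away ρ.grading D.f ≃+* AddMonoidAlgebra ℂ (chartMonoid τ)}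
    (hφ : D.IsMonomialEquiv φ) (i : ℕ) (g : ρ.InvariantRing) (hg : g ∈ ρ.grading (i • D.j)) :
    AddMonoidAlgebra.mapDomain (fun p : chartMonoid τ => ((p : LinearMap.ker α) : M))
      (φ (HomogeneousLocalization.Away.mk ρ.grading D.f_mem i g hg)) * chi (i • D.m) =
        (ρ.toPolynomial g).coeff (i • D.j) := by
  rw [mapDomain_eq_chartInclusion, hφ]
  exact D.awayEval_mk_mul_chi i g hg

/-- The open immersion of the affine toric variety of `τ` onto `D₊(f)`. -/
noncomputable def toProj (D : ρ.ChartSection x₀ Q τ)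
    (φ : HomogeneousLocalization.Away ρ.grading D.f ≃+* AddMonoidAlgebra ℂ (chartMonoid τ)) :
    (affineToric τ).left ⟶ ρ.gitQuotient.left :=
  Spec.map (CommRingCat.ofHom φ.toRingHom) ≫ Proj.awayι ρ.grading D.f D.f_mem D.pos

instance (D : ρ.ChartSection x₀ Q τ)
    (φ : HomogeneousLocalization.Away ρ.grading D.f ≃+* AddMonoidAlgebra ℂ (chartMonoid τ)) :
    IsIso (Spec.map (CommRingCat.ofHom φ.toRingHom)) := by
  have : IsIso (CommRingCat.ofHom φ.toRingHom) := (φ.toCommRingCatIso).isIso_hom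
  infer_instance

theorem isOpenImmersion_toProj (D : ρ.ChartSection x₀ Q τ)
    (φ : HomogeneousLocalization.Away ρ.grading D.f ≃+* AddMonoidAlgebra ℂ (chartMonoid τ)) :
    IsOpenImmersion (D.toProj φ) := by
  have h : IsOpenImmersion (Spec.map (CommRingCat.ofHom φ.toRingHom) ≫
    Proj.awayι ρ.grading D.f D.f_mem D.pos) := inferInstance
  exact h

theorem range_toProj (D : ρ.ChartSection x₀ Q τ)
    (φ : HomogeneousLocalization.Away ρ.grading D.f ≃+* AddMonoidAlgebra ℂ (chartMonoid τ)) :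
    Set.range (D.toProj φ) = (Proj.basicOpen ρ.grading D.f : Set (Proj ρ.grading)) := by
  rw [← Proj.opensRange_awayι ρ.grading D.f D.f_mem D.pos, ← Scheme.Hom.opensRange_comp_of_isIso
    (Spec.map (CommRingCat.ofHom φ.toRingHom)) (Proj.awayι ρ.grading D.f D.f_mem D.pos)]
  rfl

theorem toProj_comp_hom {D : ρ.ChartSection x₀ Q τ}
    {φ : HomogeneousLocalization.Away ρ.grading D.f ≃+* AddMonoidAlgebra ℂ (chartMonoid τ)}
    (hφ : D.IsMonomialEquiv φ) : D.toProj φ ≫ ρ.gitQuotient.hom = (affineToric τ).hom := by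
  change (Spec.map _ ≫ Proj.awayι _ _ _ _) ≫ Proj.toSpecZero ρ.grading ≫ Spec.map _ = Spec.map _
  rw [Category.assoc, Proj.awayι_toSpecZero_assoc, ← Spec.map_comp, ← Spec.map_comp,
    ← CommRingCat.ofHom_comp, ← CommRingCat.ofHom_comp]
  congr 2
  refine RingHom.ext fun a => chartInclusion_injective (α := α) τ ?_
  refine (hφ _).trans ?_
  refine (awayEval_fromZeroRingHom ρ.grading ρ.evalOne _ _).trans ?_
  have h1 : ρ.evalOne (algebraMap ℂ ρ.InvariantRing a) = algebraMap ℂ _ a := by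
    change Polynomial.eval 1 (ρ.toPolynomial (algebraMap ℂ ρ.InvariantRing a)) = _
    rw [AlgHom.commutes, Polynomial.algebraMap_apply, Polynomial.eval_C]
  refine h1.trans ?_
  simp [chartInclusion]

theorem awayι_congr {A : Type} [CommRing A] [Algebra ℂ A] (𝒜 : ℕ → Submodule ℂ A)
    [GradedAlgebra 𝒜] (f : A) {i j : ℕ} (h : i = j) (hi : f ∈ 𝒜 i) (hj : f ∈ 𝒜 j) (hi0 : 0 < i)
    (hj0 : 0 < j) : Proj.awayι 𝒜 f hi hi0 = Proj.awayι 𝒜 f hj hj0 := by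
  subst h
  rfl

theorem affineToricMap_refl_left {M : Type} [AddCommGroup M] (τ : PointedCone ℝ (NR M)) :
    (affineToricMap (le_refl τ)).left = 𝟙 _ :=
  congrArg CommaMorphism.left ((toricCharts {τ}).map_id ⟨τ, rfl⟩)

/-- The charts given by `f` and by a multiple of `f` are compatible. -/
theorem affineToricMap_comp_toProj {D : ρ.ChartSection x₀ Q τ} {D' : ρ.ChartSection x₀ Q τ'}
    {φ : HomogeneousLocalization.Away ρ.grading D.f ≃+* AddMonoidAlgebra ℂ (chartMonoid τ)}
    {φ' : HomogeneousLocalization.Away ρ.grading D'.f ≃+* AddMonoidAlgebra ℂ (chartMonoid τ')}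
    (hφ : D.IsMonomialEquiv φ) (hφ' : D'.IsMonomialEquiv φ') (h : τ ≤ τ') {g : ρ.InvariantRing}
    {e : ℕ} (hg : g ∈ ρ.grading e) (hf : D.f = D'.f * g) (hj : D.j = D'.j + e) :
    (affineToricMap h).left ≫ D'.toProj φ' = D.toProj φ := by
  have h1 : CommRingCat.ofHom φ'.toRingHom ≫ CommRingCat.ofHom (AddMonoidAlgebra.mapDomainRingHom ℂ
      (AddSubmonoid.inclusion (chartMonoid_anti h))) =
      CommRingCat.ofHom (HomogeneousLocalization.awayMap ρ.grading hg hf) ≫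
        CommRingCat.ofHom φ.toRingHom := by
    rw [← CommRingCat.ofHom_comp, ← CommRingCat.ofHom_comp]
    congr 1
    refine RingHom.ext fun z => chartInclusion_injective (α := α) τ ?_
    refine (chartInclusion_mapDomain_inclusion h (φ' z)).trans ((hφ' z).trans ?_)
    refine ((hφ _).trans ?_).symm
    exact awayEval_awayMap ρ.grading ρ.evalOne hg hf D'.isUnit_evalOne_f D.isUnit_evalOne_f z
  have h2 := congrArg Spec.map h1
  rw [Spec.map_comp, Spec.map_comp] at h2
  change Spec.map _ ≫ Spec.map _ ≫ Proj.awayι _ _ _ _ = Spec.map _ ≫ Proj.awayι _ _ _ _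
  rw [reassoc_of% h2, Proj.SpecMap_awayMap_awayι]
  rw [awayι_congr ρ.grading D.f hj D.f_mem]

/-- The product of the monomials of two charts is a monomial for the intersection of the charts. -/
noncomputable def mul (hQ : Convex ℝ Q) (D : ρ.ChartSection x₀ Q τ)
    (D' : ρ.ChartSection x₀ Q τ') : ρ.ChartSection x₀ Q (τ ⊓ τ') where
  x := ((D.j : ℝ) / (D.j + D'.j)) • D.x + ((D'.j : ℝ) / (D.j + D'.j)) • D'.x
  mem := by
    have h : (0 : ℝ) < D.j := Nat.cast_pos.2 D.pos
    have h' : (0 : ℝ) < D'.j := Nat.cast_pos.2 D'.pos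
    exact hQ D.mem D'.mem (by positivity) (by positivity) (by field_simp)
  cone_eq := by
    have h : (0 : ℝ) < D.j := Nat.cast_pos.2 D.pos
    have h' : (0 : ℝ) < D'.j := Nat.cast_pos.2 D'.pos
    rw [normalCone_combo D.mem D'.mem (by positivity) (by positivity) (by field_simp),
      ← D.cone_eq, ← D'.cone_eq]
  j := D.j + D'.j
  pos := Nat.add_pos_left D.pos _
  m := D.m + D'.m
  f := D.f * D'.f
  f_mem := SetLike.mul_mem_graded D.f_mem D'.f_mem
  f_eq := by
    rw [map_mul, D.f_eq, D'.f_eq, Polynomial.monomial_mul_monomial, chi_mul_chi]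
  pt_eq := by
    have h : (0 : ℝ) < D.j := Nat.cast_pos.2 D.pos
    have h' : (0 : ℝ) < D'.j := Nat.cast_pos.2 D'.pos
    rw [pt_add, D.pt_eq, D'.pt_eq, map_add, map_smul, map_smul]
    match_scalars <;> field_simp

/-- The chart of a cone as an open subscheme does not depend on the choice of the monomial, and
the charts are compatible with the inclusions of cones. -/
theorem affineToricMap_comp_toProj_of_le [Module.Free ℤ M] [Module.Free ℤ MG]
    [Module.Finite ℤ (LinearMap.ker α)]
    (h : ρ.HasMonomialInvariants x₀ Q) (hQ : IsFractionalLatticePolyhedron Q)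
    {D : ρ.ChartSection x₀ Q τ} {D' : ρ.ChartSection x₀ Q τ'}
    {φ : HomogeneousLocalization.Away ρ.grading D.f ≃+* AddMonoidAlgebra ℂ (chartMonoid τ)}
    {φ' : HomogeneousLocalization.Away ρ.grading D'.f ≃+* AddMonoidAlgebra ℂ (chartMonoid τ')}
    (hφ : D.IsMonomialEquiv φ) (hφ' : D'.IsMonomialEquiv φ') (hle : τ ≤ τ') :
    (affineToricMap hle).left ≫ D'.toProj φ' = D.toProj φ := by
  obtain ⟨E, hE, hE'⟩ : ∃ E : ρ.ChartSection x₀ Q τ, E.f = D.f * D'.f ∧ E.j = D.j + D'.j := by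
    have key : ∀ τ₁, τ ⊓ τ' = τ₁ →
        ∃ E : ρ.ChartSection x₀ Q τ₁, E.f = D.f * D'.f ∧ E.j = D.j + D'.j := by
      rintro _ rfl
      exact ⟨D.mul hQ.convex D', rfl, rfl⟩
    exact key τ (inf_eq_left.2 hle)
  obtain ⟨ψ, hψ⟩ := E.exists_equiv h hQ
  have h1 := affineToricMap_comp_toProj hψ hφ le_rfl D'.f_mem hE hE'
  have h2 := affineToricMap_comp_toProj hψ hφ' hle D.f_mem (hE.trans (mul_comm _ _))
    (hE'.trans (add_comm _ _))
  rw [h2, ← h1, affineToricMap_refl_left, Category.id_comp]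

end Linearization.ChartSection

end Charts

end ToricGIT

/-! ### The quotient is the toric variety of the polyhedron -/

namespace ToricGIT

section Quotient

variable {M MG : Type} [AddCommGroup M] [AddCommGroup MG]
variable {α : M →ₗ[ℤ] MG} {F : Set (PointedCone ℝ (NR M))} {s : ℕ} {m' : Fin s → M} {k : ℕ}
variable {ρ : Linearization α F m' k} {x₀ : ℚ ⊗[ℤ] M} {Q : Set (MR (LinearMap.ker α))}

namespace Linearization

/-- Each cone of the normal fan is the normal cone at a rational point `x`, and clearing
denominators in `x + x₀` gives an invariant monomial. -/
theorem exists_chartSection (h : ρ.HasMonomialInvariants x₀ Q)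
    (hQ : IsFractionalLatticePolyhedron Q) {τ : PointedCone ℝ (NR (LinearMap.ker α))}
    (hτ : τ ∈ normalFan Q) : Nonempty (ρ.ChartSection x₀ Q τ) := by
  obtain ⟨x, hx, rfl⟩ := hτ
  obtain ⟨n, κ, hn, hmem, hcone⟩ := hQ.exists_rational_point hx
  obtain ⟨d, m₀, hm₀⟩ := exists_eq_inv_tmul x₀
  have hn' : (n : ℝ) ≠ 0 := Nat.cast_ne_zero.2 hn.ne'
  have hd' : ((d : ℕ) : ℝ) ≠ 0 := Nat.cast_ne_zero.2 d.ne_zero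
  have hj : 0 < n * (d : ℕ) := Nat.mul_pos hn d.pos
  have hpt : pt ((k * d) • (κ : M) + (k * n) • m₀) =
      ((k * (n * d) : ℕ) : ℝ) • (kerInclusion α ((n : ℝ)⁻¹ • pt κ) + ratToReal M x₀) := by
    rw [hm₀, ratToReal_tmul, pt_add, pt_nsmul, pt_nsmul, map_smul, kerInclusion_pt]
    push_cast
    match_scalars <;> field_simp
  obtain ⟨f, hf, hf'⟩ := exists_toPolynomial_eq ((h.mem_iff hj _).2 ⟨_, hmem, hpt⟩)
  exact ⟨⟨_, hmem, hcone.symm, _, hj, _, f, hf, hf', hpt⟩⟩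

/-- The charts cover the quotient. -/
theorem exists_mem_basicOpen (h : ρ.HasMonomialInvariants x₀ Q) (y : Proj ρ.grading) :
    ∃ τ ∈ normalFan Q, ∃ D : ρ.ChartSection x₀ Q τ, y ∈ Proj.basicOpen ρ.grading D.f := by
  by_contra! hy
  -- Otherwise the homogeneous prime `y` contains all invariant monomials of positive degree.
  let N : Submodule ℂ (Polynomial (AddMonoidAlgebra ℂ M)) :=
    (y.asHomogeneousIdeal.toIdeal.restrictScalars ℂ).map ρ.toPolynomial.toLinearMap
  refine y.not_irrelevant_le ((HomogeneousIdeal.toIdeal_irrelevant_le _).2 fun j hj g hg => ?_)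
  have hg' : ρ.toPolynomial g ∈ N := by
    rw [toPolynomial_eq_monomial hg, eq_sum_smul_chi ((ρ.toPolynomial g).coeff j), map_sum]
    refine sum_mem fun m hm => ?_
    rw [← Polynomial.smul_monomial]
    refine Submodule.smul_mem _ _ ?_
    have hm' := h.monomial_mem g.2 (Finsupp.mem_support_iff.1 hm)
    obtain ⟨f, hf, hfm⟩ := exists_toPolynomial_eq hm'
    obtain ⟨x, hx, hpt⟩ := (h.mem_iff hj m).1 hm'
    have hf' := hy _ ⟨x, hx, rfl⟩ ⟨x, hx, rfl, j, hj, m, f, hf, hfm, hpt⟩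
    rw [Proj.mem_basicOpen, not_not] at hf'
    exact ⟨f, hf', hfm⟩
  obtain ⟨f, hf, hfg⟩ := hg'
  exact ρ.toPolynomial_injective hfg ▸ hf

/-- The charts of the quotient: the chart of `τ` is `D₊(f)` for each monomial `f` that belongs to
`τ`. -/
theorem exists_charts [Module.Free ℤ M] [Module.Free ℤ MG] [Module.Finite ℤ (LinearMap.ker α)]
    (h : ρ.HasMonomialInvariants x₀ Q) (hQ : IsFractionalLatticePolyhedron Q) :
    ∃ charts : toricCharts (normalFan Q) ⟶ (Functor.const _).obj ρ.gitQuotient,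
      ∀ (τ : normalFan Q) (E : ρ.ChartSection x₀ Q τ.1)
        (ψ : HomogeneousLocalization.Away ρ.grading E.f ≃+* AddMonoidAlgebra ℂ (chartMonoid τ.1)),
        E.IsMonomialEquiv ψ → (charts.app τ).left = E.toProj ψ := by
  obtain ⟨D⟩ : Nonempty (∀ τ : normalFan Q, ρ.ChartSection x₀ Q τ.1) :=
    ⟨fun τ => (exists_chartSection h hQ τ.2).some⟩
  choose φ hφ using fun τ => (D τ).exists_equiv h hQ
  refine ⟨{ app := fun τ => Over.homMk ((D τ).toProj (φ τ)) (ChartSection.toProj_comp_hom (hφ τ))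
            naturality := fun τ τ' a => ?_ }, fun τ E ψ hψ => ?_⟩
  · apply Over.OverMorphism.ext
    refine (ChartSection.affineToricMap_comp_toProj_of_le h hQ (hφ τ) (hφ τ') (leOfHom a)).trans ?_
    exact (Category.comp_id _).symm
  · have h1 := ChartSection.affineToricMap_comp_toProj_of_le h hQ hψ (hφ τ) le_rfl
    rw [ChartSection.affineToricMap_refl_left, Category.id_comp] at h1
    exact h1

/-- The toric structure on the quotient given by monomials. -/
theorem exists_toricStructure [Module.Free ℤ M] [Module.Free ℤ MG]
    [Module.Finite ℤ (LinearMap.ker α)]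
    (h : ρ.HasMonomialInvariants x₀ Q) (hQ : IsFractionalLatticePolyhedron Q) :
    ∃ t : ToricStructure Q ρ.gitQuotient, ρ.IsMonomial x₀ t := by
  obtain ⟨charts, hcharts⟩ := exists_charts h hQ
  have hopen : ∀ τ, IsOpenImmersion (charts.app τ).left := by
    intro τ
    obtain ⟨E⟩ := exists_chartSection h hQ τ.2
    obtain ⟨ψ, hψ⟩ := E.exists_equiv h hQ
    rw [hcharts τ E ψ hψ]
    exact E.isOpenImmersion_toProj ψ
  have hrange : ∀ (τ : normalFan Q) (E : ρ.ChartSection x₀ Q τ.1),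
      Set.range (charts.app τ).left = (Proj.basicOpen ρ.grading E.f : Set (Proj ρ.grading)) := by
    intro τ E
    obtain ⟨ψ, hψ⟩ := E.exists_equiv h hQ
    exact (congrArg (fun g : (affineToric τ.1).left ⟶ ρ.gitQuotient.left => Set.range g)
      (hcharts τ E ψ hψ)).trans (E.range_toProj ψ)
  have hcolim := nonempty_isColimit_of_isOpenImmersion _ _ charts hopen (fun y => by
    obtain ⟨τ, hτ, E, hE⟩ := exists_mem_basicOpen h y
    exact ⟨⟨τ, hτ⟩, (hrange ⟨τ, hτ⟩ E).symm ▸ hE⟩) (fun τ τ' => by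
    obtain ⟨D⟩ := exists_chartSection h hQ τ.2
    obtain ⟨D'⟩ := exists_chartSection h hQ τ'.2
    let κ : normalFan Q := ⟨τ.1 ⊓ τ'.1, inf_mem_normalFan hQ.convex τ.2 τ'.2⟩
    refine ⟨κ, homOfLE (inf_le_left : τ.1 ⊓ τ'.1 ≤ τ.1), homOfLE (inf_le_right : τ.1 ⊓ τ'.1 ≤ τ'.1),
      ?_⟩
    rw [hrange τ D, hrange τ' D', hrange κ (D.mul hQ.convex D')]
    intro y hy
    change y ∈ Proj.basicOpen ρ.grading (D.f * D'.f)
    rw [Proj.basicOpen_mul]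
    exact hy)
  refine ⟨⟨charts, hopen, hcolim⟩, ?_⟩
  intro τ x hx hτ j hj m f hf hfm hpt
  obtain ⟨E, rfl, rfl, rfl, rfl⟩ : ∃ E : ρ.ChartSection x₀ Q τ.1,
      E.x = x ∧ E.j = j ∧ E.m = m ∧ E.f = f :=
    ⟨⟨x, hx, hτ, j, hj, m, f, hf, hfm, hpt⟩, rfl, rfl, rfl, rfl⟩
  obtain ⟨ψ, hψ⟩ := E.exists_equiv h hQ
  exact ⟨ψ, fun i g hg => ChartSection.IsMonomialEquiv.mapDomain_mul_chi hψ i g hg,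
    hcharts τ E ψ hψ⟩

end Linearization

end Quotient

end ToricGIT

theorem mainTheorem4 {M MG : Type} [AddCommGroup M] [Module.Free ℤ M] [Module.Finite ℤ M]
    [AddCommGroup MG] [Module.Free ℤ MG] [Module.Finite ℤ MG]
    (α : M →ₗ[ℤ] MG) (hα : Function.Surjective α)
    (σ : PointedCone ℝ (NR M)) (hσ : IsRationalCone σ)
    (hσ' : (dualCone σ : ConvexCone ℝ (MR M)).Salient)
    {s : ℕ} (m' : Fin s → M) :
    ∃ e : FractionalLinearization α (normalFan (polyhedron σ m')) m' ≃ ℚ ⊗[ℤ] MG,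
      (∀ (k : ℕ+) (ρ : Linearization α (normalFan (polyhedron σ m')) m' k),
        ∃ c : MG, ρ.HasWeight c ∧ e ρ.toFractional = (1 / (k : ℚ)) ⊗ₜ[ℤ] c) ∧
      ∀ b : ℚ ⊗[ℤ] MG,
        (∃ x₀ : ℚ ⊗[ℤ] M, α.lTensor ℚ x₀ = -b) ∧
        ∀ x₀ : ℚ ⊗[ℤ] M, α.lTensor ℚ x₀ = -b →
          Set.BijOn (fun y => kerInclusion α y + ratToReal M x₀)
            (kerSlice α (polyhedron σ m') b x₀) (slice α (polyhedron σ m') b) ∧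
          IsFractionalLatticePolyhedron (kerSlice α (polyhedron σ m') b x₀) ∧
          ∀ (k : ℕ+) (ρ : Linearization α (normalFan (polyhedron σ m')) m' k),
            e ρ.toFractional = b →
              ∃ t : ToricStructure (kerSlice α (polyhedron σ m') b x₀) ρ.gitQuotient,
                ρ.IsMonomial x₀ t := by
  obtain ⟨e, he⟩ := exists_fractionalLinearization_equiv hσ α m'
  refine ⟨e, fun k ρ => ?_, fun b => ⟨LinearMap.lTensor_surjective ℚ hα (-b), fun x₀ hx₀ =>
    ⟨bijOn_kerSlice hα _ hx₀, isFractionalLatticePolyhedron_kerSlice hσ hσ' m' hx₀,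
      fun k ρ hρ => ?_⟩⟩⟩
  · obtain ⟨c, hc⟩ := ρ.exists_hasWeight
    exact ⟨c, hc, he k ρ c hc⟩
  · obtain ⟨c, hc⟩ := ρ.exists_hasWeight
    obtain rfl : (1 / (k : ℚ)) ⊗ₜ[ℤ] c = b := (he k ρ c hc).symm.trans hρ
    exact Linearization.exists_toricStructure (hc.hasMonomialInvariants hα hσ hx₀)
      (isFractionalLatticePolyhedron_kerSlice hσ hσ' m' hx₀)
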